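/- Let $\mathbb H=\{\tau\in\mathbb C:\operatorname{Im}\tau>0\}$ and, for $p,q\in\{0,1\}$, let $$\vartheta_{pq}(\tau)=\sum_{n\in\mathbb Z}\exp\!\Big(\pi i\big(n+\tfrac p2\big)^2\tau+2\pi i\big(n+\tfrac p2\big)\tfrac q2\Big),\qquad \zeta(\tau)=\frac{4\vartheta_{01}(\tau)^4\vartheta_{10}(\tau)^4}{\vartheta_{00}(\tau)^8}\qquad(\tau\in\mathbb H).$$ Let $$\mathbb D_{12}=\{\tau\in\mathbb H: -1<\operatorname{Re}\tau\le 1,\ |\tau|>1\}\cup\{\tau\in\mathbb H: |\tau|=1,\ 0\le\operatorname{Re}\tau\le1\},$$ let $\Gamma(2,4)=\{g\in SL_2(\mathbb Z): g_{11}\equiv g_{22}\equiv1 \bmod 4,\ g_{12}\equiv g_{21}\equiv 0\bmod 2\}$, $iJ=\begin{pmatrix}0&i\\-i&0\end{pmatrix}$ and $$\Gamma(2,4)\langle iJ\rangle=\{g\in GL_2(\mathbb Z[i]): g\in\Gamma(2,4)\text{ or }(iJ)g\in\Gamma(2,4)\}.$$ Let $F(a,b,c;z)$ be the Gauss hypergeometric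 series, continued holomorphically from the unit disk to $\mathbb C\setminus[1,\infty)$, and extended to $z=t\in(1,\infty)$ by its limit as $z\to t$ with $\operatorname{Im}z>0$; for $(a,b,c)=(\frac14,\frac14,1)$ let $F(a,b,c;1)$ be the limit as $z\to1$ in the unit disk. For a path $\rho$ in $\mathbb C\setminus\{0,1\}$ ending at $w$, $F_\rho(a,b,c;w)$ is the value at $w$ of the analytic continuation along $\rho$ of the germ of $F(a,b,c;\cdot)$ at the starting point of $\rho$ (if the starting point lies on $(1,\infty)$: of the germ that agrees with $F$ on the upper side of the cut). Every $\tau\in\mathbb H$ can be written as $$\tau=g\cdot\tau_0=\frac{g_{11}\tau_0+g_{12}}{g_{21}\tau_0+g_{22}}\quad\text{with }\tau_0\in\mathbb D_{12},\ g=(g_{ij})\in\Gamma(2,4)\langle iJ\rangle,$$ and for all such $\tau,\tau_0,g$ the following hold. 1. $$\vartheta_{00}(\tau)^2=(g_{21}\tau_0+g_{22})\,F(\tfrac14,\tfrac14,1;\zeta(\tau_0))=\frac{\det(g)\,F(\frac14,\frac14,1;\zeta(\tau))}{-g_{21}\tau+g_{11}},$$ and $\vartheta_{00}(\tau)^2=F_\rho(\tfrac14,\tfrac14,1;\zeta(\tau))$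 whenever $\rho$ is the image under $\zeta$ of a path in $\mathbb H$ from $\tau_0$ to $\tau$ on which $\zeta\ne1$. 2. If $\zeta(\tau)\neq1$, then $\vartheta_{01}(\tau)^4\ne\vartheta_{10}(\tau)^4$, $$\frac{\vartheta_{00}(\tau)^6}{\vartheta_{01}(\tau)^4-\vartheta_{10}(\tau)^4}=\frac{g_{21}\tau_0+g_{22}}{\det(g)}\,F(\tfrac34,\tfrac34,1;\zeta(\tau_0))=\frac{F(\frac34,\frac34,1;\zeta(\tau))}{-g_{21}\tau+g_{11}},$$ and this quantity equals $F_\rho(\tfrac34,\tfrac34,1;\zeta(\tau))$ whenever $\rho$ is the image under $\zeta$ of a path in $\mathbb H$ from $\tau_0$ to $\tau$ on which $\zeta\neq1$. In both cases the existence of the analytic continuation along $\rho$ and the independence of its end value of choices are part of the claim. -/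

import Mathlib

open scoped Topology
open Filter

noncomputable section

namespace HGTheta

/-- The theta constant `ϑ_{pq}(τ)` (used with `p, q ∈ {0, 1}` and `τ` in the upper half plane). -/
def theta (p q : ℕ) (τ : ℂ) : ℂ :=
  ∑' n : ℤ, Complex.exp (Real.pi * Complex.I * ((n : ℂ) + (p : ℂ) / 2) ^ 2 * τ
    + 2 * Real.pi * Complex.I * ((n : ℂ) + (p : ℂ) / 2) * ((q : ℂ) / 2))

/-- `ζ(τ) = 4 ϑ₀₁(τ)⁴ ϑ₁₀(τ)⁴ / ϑ₀₀(τ)⁸`. -/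
def zeta (τ : UpperHalfPlane) : ℂ :=
  4 * theta 0 1 τ ^ 4 * theta 1 0 τ ^ 4 / theta 0 0 τ ^ 8

/-- The fundamental region `𝔻₁₂` of `Γ₁₂`. -/
def D12 : Set UpperHalfPlane :=
  {τ | -1 < τ.re ∧ τ.re ≤ 1 ∧ 1 < ‖(τ : ℂ)‖} ∪
  {τ | ‖(τ : ℂ)‖ = 1 ∧ 0 ≤ τ.re ∧ τ.re ≤ 1}

/-! ### The groups -/

/-- `Γ(2,4)`: matrices in `SL₂(ℤ)` with diagonal entries `≡ 1 mod 4` and even off-diagonal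
entries. -/
def Gamma24 : Set (Matrix.SpecialLinearGroup (Fin 2) ℤ) :=
  {g | g 0 0 ≡ 1 [ZMOD 4] ∧ g 1 1 ≡ 1 [ZMOD 4] ∧ g 0 1 ≡ 0 [ZMOD 2] ∧ g 1 0 ≡ 0 [ZMOD 2]}

/-- The inclusion of `SL₂(ℤ)` in `GL₂(ℤ[i])`. -/
def toGLGauss (g : Matrix.SpecialLinearGroup (Fin 2) ℤ) : GL (Fin 2) GaussianInt :=
  Matrix.SpecialLinearGroup.toGL
    (Matrix.SpecialLinearGroup.map (Int.castRingHom GaussianInt) g)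

/-- The imaginary unit `i` of `ℤ[i]`. -/
def gaussI : GaussianInt := ⟨0, 1⟩

/-- The matrix `iJ = (0, i; -i, 0)`, which is its own inverse. -/
def iJ : GL (Fin 2) GaussianInt where
  val := !![0, gaussI; -gaussI, 0]
  inv := !![0, gaussI; -gaussI, 0]
  val_inv := by decide
  inv_val := by decide

/-- `Γ(2,4)⟨iJ⟩ = {g ∈ GL₂(ℤ[i]) | g ∈ Γ(2,4) or (iJ) g ∈ Γ(2,4)}`. -/
def Gamma24iJ : Set (GL (Fin 2) GaussianInt) :=
  {g | g ∈ toGLGauss '' Gamma24 ∨ iJ * g ∈ toGLGauss '' Gamma24}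

/-- The entry of `g`, as a complex number. -/
def entry (g : GL (Fin 2) GaussianInt) (i j : Fin 2) : ℂ :=
  GaussianInt.toComplex ((g : Matrix (Fin 2) (Fin 2) GaussianInt) i j)

/-- The determinant of `g`, as a complex number. -/
def detC (g : GL (Fin 2) GaussianInt) : ℂ :=
  GaussianInt.toComplex (g : Matrix (Fin 2) (Fin 2) GaussianInt).det

/-! ### The hypergeometric function -/

/-- The slit plane `ℂ - [1, ∞)`. -/
def slitDomain : Set ℂ := {z | ¬ (z.im = 0 ∧ 1 ≤ z.re)}

/-- The single-valued holomorphic continuation of the hypergeometric series from the unit disk to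
`ℂ - [1, ∞)`; only its values on `ℂ - [1, ∞)` are meaningful. -/
def hgSlit (a b c : ℂ) : ℂ → ℂ :=
  Classical.epsilon fun f : ℂ → ℂ =>
    DifferentiableOn ℂ f slitDomain ∧
      Set.EqOn f (fun z => ordinaryHypergeometric a b c z) (Metric.ball 0 1)

open Classical in
/-- The single-valued extension of `F(a,b,c;z)`: the holomorphic continuation on `ℂ - [1, ∞)`; on
`(1, ∞)` the limit from the upper half plane; at `z = 1` the limit from the unit disk (which exists
when `Re (c - a - b) > 0`). -/
def hg (a b c z : ℂ) : ℂ :=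
  if z ∈ slitDomain then hgSlit a b c z
  else if z = 1 then limUnder (𝓝[Metric.ball 0 1] (1 : ℂ)) (hgSlit a b c)
  else limUnder (𝓝[{w : ℂ | 0 < w.im}] z) (hgSlit a b c)

/-- `Φ` is an analytic continuation along the path `ρ`: for each `t` a function `Φ t` analytic at
`ρ t`, such that the germ of `Φ s` at `ρ s` is the one given by `Φ t` for all `s` near `t`. -/
structure IsAnalyticContinuationAlong (ρ : unitInterval → ℂ) (Φ : unitInterval → ℂ → ℂ) :
    Prop where
  analyticAt : ∀ t, AnalyticAt ℂ (Φ t) (ρ t)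
  compatible : ∀ t, ∀ᶠ s in 𝓝 t, Φ s =ᶠ[𝓝 (ρ s)] Φ t

/-- `Φ` is an analytic continuation of `F(a,b,c;z)` along `ρ`. The initial germ is that of the
single-valued function `F(a,b,c;z)` at `ρ 0`; if `ρ 0` is on the cut `[1, ∞)`, it is the germ which
coincides with `F(a,b,c;z)` on the upper side of the cut. -/
structure IsHGContinuation (a b c : ℂ) (ρ : unitInterval → ℂ) (Φ : unitInterval → ℂ → ℂ) :
    Prop where
  continuation : IsAnalyticContinuationAlong ρ Φ
  start : ρ 0 ∈ slitDomain → Φ 0 =ᶠ[𝓝 (ρ 0)] hg a b c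
  start_cut : ρ 0 ∉ slitDomain → Φ 0 =ᶠ[𝓝[{w : ℂ | 0 < w.im}] (ρ 0)] hg a b c

/-- `F_ρ(a,b,c;ρ(1))` exists and has the value `v`: there is an analytic continuation of
`F(a,b,c;z)` along `ρ`, and every such continuation has the value `v` at the end point. -/
def HGContinuesTo (a b c : ℂ) (ρ : unitInterval → ℂ) (v : ℂ) : Prop :=
  (∃ Φ, IsHGContinuation a b c ρ Φ) ∧ ∀ Φ, IsHGContinuation a b c ρ Φ → Φ 1 (ρ 1) = v

end HGTheta

end

noncomputable section

namespace HGTheta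

/-! ### Theta constants: relation to the Jacobi theta function -/

/-! The core is Jacobi's identity F(1/2,1/2,1; λ(τ)) = ϑ₀₀(τ)² near i∞, where λ = ϑ₁₀⁴/ϑ₀₀⁴
(`hypergeometric_lam`). By Landen's transformation of F and the duplication formulas for theta
constants, the quotient of the two sides is unchanged under τ ↦ 2τ; it tends to 1 at i∞, hence
equals 1. Since ζ = 4λ(1-λ) = 1-(1-2λ)², a quadratic transformation turns this into F(1/4,1/4,1; ζ)
= ϑ₀₀² near i∞. All transformations of F come from uniqueness of the regular solution of a second
order equation with double exponent 0 (`SolvesODE.unique`).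

The identity spreads over the interior of 𝔻₁₂ by the identity theorem once ζ is known to avoid the
cut there, which follows from Re λ < 1/2 (`re_lam_lt_half_of_mem_innerD`). As λ(τ+1) = λ/(λ-1), this
inequality says |λ(τ+1)| < 1, a case of the maximum principle. On the arc |τ| = 1, Re τ > 0 one has
Re λ = 1/2 and Im λ > 0, so from outside the circle ζ approaches the cut from above, in accordance
with the convention for F on (1,∞). At τ = i, ζ = 1. The case (3/4,3/4,1) follows from Euler's
transformation F(3/4,3/4,1;z) = (1-z)^(-1/2) F(1/4,1/4,1;z), because the root of 1-ζ with positive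
real part is 1-2λ = (ϑ₀₁⁴-ϑ₁₀⁴)/ϑ₀₀⁴.

Since λ' = πi λ ϑ₀₁⁴ has no zeros, ζ is locally biholomorphic wherever ζ ≠ 1. Composing the modular
form with local inverses of ζ continues F along the image of any path avoiding ζ = 1
(`IsUniformization.hgContinuesTo`).

Finally Γ(2,4) multiplies ϑ₀₀² by cτ+d and fixes λ, while iJ acts as τ ↦ -1/τ and changes the sign
of 1-2λ (`gamma24iJ_transformation`). So ζ is invariant and 1-2λ acquires the factor det g. The
region meets every orbit by reduction theory for the theta group (`exists_D12_gamma24iJ`). -/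

lemma theta_term_eq (p q : ℕ) (τ : ℂ) (n : ℤ) :
    Complex.exp (Real.pi * Complex.I * ((n : ℂ) + (p : ℂ) / 2) ^ 2 * τ
      + 2 * Real.pi * Complex.I * ((n : ℂ) + (p : ℂ) / 2) * ((q : ℂ) / 2)) =
    Complex.exp (Real.pi * Complex.I * ((p : ℂ) ^ 2 / 4 * τ + p * q / 2)) *
      jacobiTheta₂_term n (p * τ / 2 + q / 2) τ := by
  rw [jacobiTheta₂_term, ← Complex.exp_add]
  congr 1
  ring

lemma theta_eq (p q : ℕ) (τ : ℂ) :
    theta p q τ = Complex.exp (Real.pi * Complex.I * ((p : ℂ) ^ 2 / 4 * τ + p * q / 2)) *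
      jacobiTheta₂ (p * τ / 2 + q / 2) τ := by
  simp only [theta, theta_term_eq, tsum_mul_left, jacobiTheta₂]

lemma theta00_eq (τ : ℂ) : theta 0 0 τ = jacobiTheta₂ 0 τ := by
  simp [theta_eq]

lemma theta00_eq_jacobiTheta (τ : ℂ) : theta 0 0 τ = jacobiTheta τ := by
  rw [theta00_eq, jacobiTheta_eq_jacobiTheta₂]

lemma theta01_eq (τ : ℂ) : theta 0 1 τ = jacobiTheta₂ (1 / 2) τ := by
  simp [theta_eq]

lemma theta10_eq (τ : ℂ) :
    theta 1 0 τ = Complex.exp (Real.pi * Complex.I * τ / 4) * jacobiTheta₂ (τ / 2) τ := by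
  rw [theta_eq]
  congr 2 <;> · push_cast; ring

lemma summable_theta (p q : ℕ) {τ : ℂ} (hτ : 0 < τ.im) :
    Summable fun n : ℤ => ‖Complex.exp (Real.pi * Complex.I * ((n : ℂ) + (p : ℂ) / 2) ^ 2 * τ
      + 2 * Real.pi * Complex.I * ((n : ℂ) + (p : ℂ) / 2) * ((q : ℂ) / 2))‖ := by
  simp only [theta_term_eq, summable_norm_iff]
  exact ((summable_jacobiTheta₂_term_iff _ _).2 hτ).mul_left _

/-! ### Translation, inversion and conjugation formulas. -/

lemma theta00_add_one (τ : ℂ) : theta 0 0 (τ + 1) = theta 0 1 τ := by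
  refine tsum_congr fun n => ?_
  -- As n² - n is even, the exponents πi n² and πi n differ by a multiple of 2πi.
  obtain ⟨k, hk⟩ := (Int.even_mul_pred_self n)
  have hk' : (n : ℂ) * (n - 1) = k + k := by exact_mod_cast hk
  rw [Complex.exp_eq_exp_iff_exists_int]
  refine ⟨k, ?_⟩
  push_cast
  linear_combination (Real.pi * Complex.I) * hk'

lemma theta00_add_two (τ : ℂ) : theta 0 0 (τ + 2) = theta 0 0 τ := by
  simp [theta00_eq, jacobiTheta₂_add_right]

lemma theta01_add_one (τ : ℂ) : theta 0 1 (τ + 1) = theta 0 0 τ := by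
  rw [← theta00_add_one, add_assoc, one_add_one_eq_two, theta00_add_two]

lemma theta01_add_two (τ : ℂ) : theta 0 1 (τ + 2) = theta 0 1 τ := by
  simp [theta01_eq, jacobiTheta₂_add_right]

lemma theta10_add_two_sq (τ : ℂ) : theta 1 0 (τ + 2) ^ 2 = -theta 1 0 τ ^ 2 := by
  rw [theta10_eq, theta10_eq, mul_pow, mul_pow, ← Complex.exp_nat_mul, ← Complex.exp_nat_mul,
    jacobiTheta₂_add_right, add_div, div_self two_ne_zero, jacobiTheta₂_add_left]
  have : ((2 : ℕ) : ℂ) * (Real.pi * Complex.I * (τ + 2) / 4) =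
      ((2 : ℕ) : ℂ) * (Real.pi * Complex.I * τ / 4) + Real.pi * Complex.I := by
    push_cast; ring
  rw [this, Complex.exp_add, Complex.exp_pi_mul_I]
  ring

lemma cpow_half_sq {x : ℂ} : (x ^ (1 / 2 : ℂ)) ^ 2 = x := by
  rw [← Complex.cpow_nat_mul]
  simp

lemma theta00_neg_inv_sq {τ : ℂ} (hτ : τ ≠ 0) :
    theta 0 0 (-1 / τ) ^ 2 = -Complex.I * τ * theta 0 0 τ ^ 2 := by
  have h := congrArg (· ^ 2) (jacobiTheta₂_functional_equation 0 τ)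
  simp only [mul_pow, div_pow, cpow_half_sq, zero_div, ← theta00_eq] at h
  rw [h, zero_pow two_ne_zero, mul_zero, zero_div, Complex.exp_zero]
  field_simp

lemma theta01_neg_inv_sq {τ : ℂ} (hτ : τ ≠ 0) :
    theta 0 1 (-1 / τ) ^ 2 = -Complex.I * τ * theta 1 0 τ ^ 2 := by
  have e : τ / 2 / τ = 1 / 2 := by field_simp
  rw [theta10_eq, jacobiTheta₂_functional_equation, e, ← theta01_eq, ← mul_assoc, mul_left_comm,
    ← Complex.exp_add]
  have : Real.pi * Complex.I * τ / 4 + -Real.pi * Complex.I * (τ / 2) ^ 2 / τ = 0 := by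
    field_simp; ring
  rw [this, Complex.exp_zero, mul_one, mul_pow, div_pow, cpow_half_sq]
  field_simp

lemma theta00_conj (τ : ℂ) : theta 0 0 (-(starRingEnd ℂ) τ) = (starRingEnd ℂ) (theta 0 0 τ) := by
  simp [theta00_eq, jacobiTheta₂_conj]

lemma theta01_conj (τ : ℂ) : theta 0 1 (-(starRingEnd ℂ) τ) = (starRingEnd ℂ) (theta 0 1 τ) := by
  have : (starRingEnd ℂ) (1 / 2) = 1 / 2 := by
    rw [map_div₀, map_one, Complex.conj_ofNat]
  rw [theta01_eq, theta01_eq, jacobiTheta₂_conj, this]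

/-! ### Holomorphy of the theta constants. -/

lemma differentiableAt_theta00 {τ : ℂ} (hτ : 0 < τ.im) : DifferentiableAt ℂ (theta 0 0) τ := by
  rw [funext theta00_eq]
  exact differentiableAt_jacobiTheta₂_snd 0 hτ

lemma differentiableAt_theta01 {τ : ℂ} (hτ : 0 < τ.im) : DifferentiableAt ℂ (theta 0 1) τ := by
  rw [funext theta01_eq]
  exact differentiableAt_jacobiTheta₂_snd _ hτ

/-- The series `∑ exp (π i (n² + n) τ)`, that is `exp (-π i τ / 4) ϑ₁₀(τ)`. -/
def thetaTen (τ : ℂ) : ℂ := jacobiTheta₂ (τ / 2) τ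

lemma differentiableAt_thetaTen {τ : ℂ} (hτ : 0 < τ.im) : DifferentiableAt ℂ thetaTen τ := by
  have h := (hasFDerivAt_jacobiTheta₂ (τ / 2) hτ).differentiableAt
  have h2 : DifferentiableAt ℂ (fun t : ℂ => (t / 2, t)) τ := by fun_prop
  exact DifferentiableAt.comp (f := fun t : ℂ => (t / 2, t))
    (g := fun p : ℂ × ℂ => jacobiTheta₂ p.1 p.2) τ h h2

lemma differentiableAt_theta10 {τ : ℂ} (hτ : 0 < τ.im) : DifferentiableAt ℂ (theta 1 0) τ := by
  rw [funext theta10_eq]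
  exact DifferentiableAt.mul (by fun_prop) (differentiableAt_thetaTen hτ)

/-! ### Duplication formulas -/

/-- A pair of integers is `(a + b, a - b)` or `(a + b + 1, a - b)`. -/
def paritySplit : (ℤ × ℤ) ⊕ (ℤ × ℤ) ≃ ℤ × ℤ where
  toFun := Sum.elim (fun x => (x.1 + x.2, x.1 - x.2)) (fun x => (x.1 + x.2 + 1, x.1 - x.2))
  invFun x := if (x.1 + x.2) % 2 = 0 then Sum.inl ((x.1 + x.2) / 2, (x.1 - x.2) / 2)
    else Sum.inr ((x.1 + x.2 - 1) / 2, (x.1 - x.2 - 1) / 2)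
  left_inv := by
    rintro (⟨a, b⟩ | ⟨a, b⟩)
    · have : (a + b + (a - b)) % 2 = 0 := by omega
      simp only [Sum.elim_inl, this, if_true, Sum.inl.injEq, Prod.mk.injEq]
      omega
    · have : ¬ (a + b + 1 + (a - b)) % 2 = 0 := by omega
      simp only [Sum.elim_inr, this, if_false, Sum.inr.injEq, Prod.mk.injEq]
      omega
  right_inv := by
    rintro ⟨m, n⟩
    dsimp only
    split_ifs with h
    · simp only [Sum.elim_inl, Prod.mk.injEq]
      omega
    · simp only [Sum.elim_inr, Prod.mk.injEq]
      omega

/-- Splitting by the parity of m + n diagonalizes m² + n² into twice a sum of two squares; this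
produces the argument 2τ in the duplication formulas. -/
lemma tsum_paritySplit {f : ℤ × ℤ → ℂ} (hf : Summable f) :
    ∑' x, f x = ∑' x : ℤ × ℤ, f (x.1 + x.2, x.1 - x.2) +
      ∑' x : ℤ × ℤ, f (x.1 + x.2 + 1, x.1 - x.2) := by
  rw [← paritySplit.tsum_eq]
  have h : Summable (f ∘ paritySplit) := paritySplit.summable_iff.2 hf
  exact Summable.tsum_sum (f := f ∘ paritySplit) (h.comp_injective Sum.inl_injective)
    (h.comp_injective Sum.inr_injective)

lemma im_two_mul_pos {τ : ℂ} (hτ : 0 < τ.im) : 0 < (2 * τ).im := by simpa using hτ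

lemma theta00_sq {τ : ℂ} (hτ : 0 < τ.im) :
    theta 0 0 τ ^ 2 = theta 0 0 (2 * τ) ^ 2 + theta 1 0 (2 * τ) ^ 2 := by
  have h0 := summable_theta 0 0 hτ
  have h2 := summable_theta 0 0 (im_two_mul_pos hτ)
  have h3 := summable_theta 1 0 (im_two_mul_pos hτ)
  rw [pow_two (theta 0 0 τ), pow_two (theta 0 0 (2 * τ)), pow_two (theta 1 0 (2 * τ))]
  simp only [theta]
  rw [tsum_mul_tsum_of_summable_norm h0 h0, tsum_mul_tsum_of_summable_norm h2 h2,
    tsum_mul_tsum_of_summable_norm h3 h3, tsum_paritySplit (summable_mul_of_summable_norm h0 h0)]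
  congr 1 <;>
  · refine tsum_congr fun x => ?_
    rw [← Complex.exp_add, ← Complex.exp_add]
    congr 1
    push_cast
    ring

lemma theta10_sq {τ : ℂ} (hτ : 0 < τ.im) :
    theta 1 0 τ ^ 2 = 2 * theta 0 0 (2 * τ) * theta 1 0 (2 * τ) := by
  have h0 := summable_theta 1 0 hτ
  have h2 := summable_theta 0 0 (im_two_mul_pos hτ)
  have h3 := summable_theta 1 0 (im_two_mul_pos hτ)
  -- For m + n odd the squares add up to 2((a+1)² + (b+1/2)²), so the matching series for ϑ₀₀(2τ) is
  -- indexed by a + 1. Only the second summand below uses this shifted form.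
  have hs : theta 0 0 (2 * τ) = ∑' n : ℤ, Complex.exp (Real.pi * Complex.I *
      (((n + 1 : ℤ) : ℂ) + ((0 : ℕ) : ℂ) / 2) ^ 2 * (2 * τ)
      + 2 * Real.pi * Complex.I * (((n + 1 : ℤ) : ℂ) + ((0 : ℕ) : ℂ) / 2) * (((0 : ℕ) : ℂ) / 2)) :=
    ((Equiv.addRight (1 : ℤ)).tsum_eq (fun n : ℤ => Complex.exp (Real.pi * Complex.I *
      ((n : ℂ) + ((0 : ℕ) : ℂ) / 2) ^ 2 * (2 * τ)
      + 2 * Real.pi * Complex.I * ((n : ℂ) + ((0 : ℕ) : ℂ) / 2) * (((0 : ℕ) : ℂ) / 2)))).symm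
  have h2' : Summable fun n : ℤ => ‖Complex.exp (Real.pi * Complex.I *
      (((n + 1 : ℤ) : ℂ) + ((0 : ℕ) : ℂ) / 2) ^ 2 * (2 * τ)
      + 2 * Real.pi * Complex.I * (((n + 1 : ℤ) : ℂ) + ((0 : ℕ) : ℂ) / 2) * (((0 : ℕ) : ℂ) / 2))‖ :=
    (Equiv.addRight (1 : ℤ)).summable_iff.2 h2
  have e1 : theta 1 0 τ ^ 2 = theta 1 0 (2 * τ) * theta 0 0 (2 * τ) +
      theta 0 0 (2 * τ) * theta 1 0 (2 * τ) := by
    conv_rhs => rw [hs]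
    conv_rhs => enter [1]; rw [← hs]
    rw [pow_two (theta 1 0 τ)]
    simp only [theta]
    rw [tsum_mul_tsum_of_summable_norm h0 h0, tsum_mul_tsum_of_summable_norm h3 h2,
      tsum_mul_tsum_of_summable_norm h2' h3,
      tsum_paritySplit (summable_mul_of_summable_norm h0 h0)]
    congr 1 <;>
    · refine tsum_congr fun x => ?_
      rw [← Complex.exp_add, ← Complex.exp_add]
      congr 1
      push_cast
      ring
  rw [e1]
  ring

lemma theta01_sq {τ : ℂ} (hτ : 0 < τ.im) :
    theta 0 1 τ ^ 2 = theta 0 0 (2 * τ) ^ 2 - theta 1 0 (2 * τ) ^ 2 := by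
  have h := theta00_sq (τ := τ + 1) (by simpa using hτ)
  rw [theta00_add_one, mul_add, mul_one, theta00_add_two, theta10_add_two_sq] at h
  rw [h]
  ring

/-- Jacobi's identity. -/
lemma jacobi_identity {τ : ℂ} (hτ : 0 < τ.im) :
    theta 0 0 τ ^ 4 = theta 0 1 τ ^ 4 + theta 1 0 τ ^ 4 := by
  have e (x : ℂ) : x ^ 4 = (x ^ 2) ^ 2 := by ring
  rw [e, e (theta 0 1 τ), e (theta 1 0 τ), theta00_sq hτ, theta01_sq hτ, theta10_sq hτ]
  ring

/-- This is the geometric mean step of the arithmetic-geometric mean; it makes zeros of ϑ₀₁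
propagate from τ to 2τ. -/
lemma theta01_two_mul_pow_four {τ : ℂ} (hτ : 0 < τ.im) :
    theta 0 1 (2 * τ) ^ 4 = theta 0 0 τ ^ 2 * theta 0 1 τ ^ 2 := by
  rw [theta00_sq hτ, theta01_sq hτ]
  linear_combination -jacobi_identity (im_two_mul_pos hτ)

/-! ### Behaviour at the cusp `i∞` -/

lemma tendsto_theta00 : Tendsto (theta 0 0) (comap Complex.im atTop) (𝓝 1) := by
  rw [funext theta00_eq_jacobiTheta, ← tendsto_sub_nhds_zero_iff]
  refine isBigO_at_im_infty_jacobiTheta_sub_one.trans_tendsto ?_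
  refine Real.tendsto_exp_atBot.comp ?_
  exact tendsto_comap.const_mul_atTop_of_neg (neg_lt_zero.2 Real.pi_pos)

lemma tendsto_theta01 : Tendsto (theta 0 1) (comap Complex.im atTop) (𝓝 1) := by
  have : theta 0 1 = fun τ => theta 0 0 (τ + 1) := funext fun τ => (theta00_add_one τ).symm
  rw [this]
  refine tendsto_theta00.comp ?_
  rw [tendsto_comap_iff]
  refine tendsto_comap.congr fun τ => by simp

lemma tendsto_thetaTen : Tendsto thetaTen (comap Complex.im atTop) (𝓝 2) := by
  -- The n-th term has norm exp(-π n(n+1) Im τ), so for Im τ ≥ 1 the series at τ = i dominates. The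
  -- limit 2 counts the terms n = 0 and n = -1, where n(n+1) = 0.
  have hbound := (summable_jacobiTheta₂_term_iff (Complex.I / 2) Complex.I).2 (by simp)
  have hsum : ∑' n : ℤ, (if n ∈ ({0, -1} : Finset ℤ) then (1 : ℂ) else 0) = 2 := by
    rw [tsum_eq_sum (s := ({0, -1} : Finset ℤ)) (fun n hn => by simp [hn])]
    rw [Finset.sum_pair (by decide)]
    norm_num
  rw [← hsum]
  have him : ∀ᶠ τ : ℂ in comap Complex.im atTop, 1 ≤ τ.im :=
    tendsto_comap.eventually (eventually_ge_atTop 1)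
  have hnorm (n : ℤ) (τ : ℂ) : ‖jacobiTheta₂_term n (τ / 2) τ‖ =
      Real.exp (-(Real.pi * (n * (n + 1)) * τ.im)) := by
    rw [norm_jacobiTheta₂_term]
    congr 1
    simp
    ring
  refine tendsto_tsum_of_dominated_convergence hbound.norm ?_ ?_
  · intro n
    split_ifs with hn
    · refine tendsto_const_nhds.congr fun τ => ?_
      simp only [Finset.mem_insert, Finset.mem_singleton] at hn
      rcases hn with rfl | rfl
      · simp [jacobiTheta₂_term]
      · rw [jacobiTheta₂_term, eq_comm, Complex.exp_eq_one_iff]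
        exact ⟨0, by push_cast; ring⟩
    · rw [tendsto_zero_iff_norm_tendsto_zero]
      simp only [hnorm]
      refine Real.tendsto_exp_neg_atTop_nhds_zero.comp ?_
      refine tendsto_comap.const_mul_atTop ?_
      have : 0 < n * (n + 1) := by
        simp only [Finset.mem_insert, Finset.mem_singleton, not_or] at hn
        rcases lt_or_ge n 0 with h | h
        · exact mul_pos_of_neg_of_neg h (by omega)
        · exact mul_pos (by omega) (by omega)
      have : (0 : ℝ) < n * (n + 1) := by exact_mod_cast this
      exact mul_pos Real.pi_pos this
  · filter_upwards [him] with τ hτ n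
    rw [hnorm, hnorm]
    have : 0 ≤ n * (n + 1) := by
      rcases lt_or_ge n 0 with h | h
      · exact mul_nonneg_of_nonpos_of_nonpos h.le (by omega)
      · exact mul_nonneg (by omega) (by omega)
    have : (0 : ℝ) ≤ n * (n + 1) := by exact_mod_cast this
    refine Real.exp_le_exp.2 (neg_le_neg ?_)
    refine mul_le_mul_of_nonneg_left ?_ (mul_nonneg Real.pi_pos.le this)
    simpa using hτ

lemma im_two_pow_mul_pos {τ : ℂ} (hτ : 0 < τ.im) (n : ℕ) : 0 < (2 ^ n * τ).im := by
  have : ((2 : ℂ) ^ n * τ).im = 2 ^ n * τ.im := by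
    rw [show ((2 : ℂ) ^ n) = ((2 ^ n : ℝ) : ℂ) by push_cast; rfl, Complex.im_ofReal_mul]
  rw [this]
  positivity

lemma tendsto_two_pow_mul {τ : ℂ} (hτ : 0 < τ.im) :
    Tendsto (fun n : ℕ => 2 ^ n * τ) atTop (comap Complex.im atTop) := by
  rw [tendsto_comap_iff]
  have : (Complex.im ∘ fun n : ℕ => 2 ^ n * τ) = fun n : ℕ => (2 : ℝ) ^ n * τ.im := by
    ext n
    simp only [Function.comp]
    rw [show ((2 : ℂ) ^ n) = ((2 ^ n : ℝ) : ℂ) by push_cast; rfl, Complex.im_ofReal_mul]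
  rw [this]
  exact (tendsto_pow_atTop_atTop_of_one_lt one_lt_two).atTop_mul_const hτ

/-- A function on the upper half plane which is invariant under `τ ↦ 2τ` is equal to its limit at
`i∞`. -/
lemma eq_of_two_mul_invariant {f : ℂ → ℂ} {c : ℂ}
    (hf : Tendsto f (comap Complex.im atTop) (𝓝 c)) {τ : ℂ} (hτ : 0 < τ.im)
    (h : ∀ n : ℕ, f (2 ^ n * τ) = f (2 * (2 ^ n * τ))) : f τ = c := by
  have key (n : ℕ) : f (2 ^ n * τ) = f τ := by
    induction n with
    | zero => simp
    | succ n ih => rw [← ih, h n, pow_succ' , mul_assoc]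
  exact tendsto_nhds_unique (tendsto_const_nhds.congr fun n => (key n).symm)
    (hf.comp (tendsto_two_pow_mul hτ))

/-! ### Nonvanishing -/

/-- A zero at τ would give zeros at all 2ⁿτ, against the limit 1 at i∞. -/
lemma theta01_ne_zero {τ : ℂ} (hτ : 0 < τ.im) : theta 0 1 τ ≠ 0 := by
  intro h0
  have key (n : ℕ) : theta 0 1 (2 ^ n * τ) = 0 := by
    induction n with
    | zero => simpa using h0
    | succ n ih =>
      have := theta01_two_mul_pow_four (im_two_pow_mul_pos hτ n)
      rw [ih, zero_pow two_ne_zero, mul_zero, ← mul_assoc, ← pow_succ'] at this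
      exact pow_eq_zero_iff (by norm_num) |>.1 this
  have := tendsto_nhds_unique (tendsto_const_nhds.congr fun n => (key n).symm)
    (tendsto_theta01.comp (tendsto_two_pow_mul hτ))
  exact zero_ne_one this

lemma theta00_ne_zero {τ : ℂ} (hτ : 0 < τ.im) : theta 0 0 τ ≠ 0 := by
  rw [← theta01_add_one]
  exact theta01_ne_zero (by simpa using hτ)

lemma ne_zero_of_im_pos {τ : ℂ} (hτ : 0 < τ.im) : τ ≠ 0 := by
  rintro rfl
  simp at hτ

lemma im_neg_inv (τ : ℂ) : (-1 / τ).im = τ.im / Complex.normSq τ := by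
  rw [neg_div, one_div, Complex.neg_im, Complex.inv_im]
  ring

lemma im_neg_inv_pos {τ : ℂ} (hτ : 0 < τ.im) : 0 < (-1 / τ).im := by
  rw [im_neg_inv]
  exact div_pos hτ (Complex.normSq_pos.2 (ne_zero_of_im_pos hτ))

lemma theta10_ne_zero {τ : ℂ} (hτ : 0 < τ.im) : theta 1 0 τ ≠ 0 := by
  intro h
  have := theta01_neg_inv_sq (ne_zero_of_im_pos hτ)
  rw [h] at this
  exact theta01_ne_zero (im_neg_inv_pos hτ) (by simpa using this)

/-! ### The modular functions `λ` and `ζ` -/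

/-- The modular lambda function `ϑ₁₀⁴ / ϑ₀₀⁴`. -/
def lam (τ : ℂ) : ℂ := theta 1 0 τ ^ 4 / theta 0 0 τ ^ 4

/-- The function `ζ` on the complex plane. -/
def zetaC (τ : ℂ) : ℂ := 4 * theta 0 1 τ ^ 4 * theta 1 0 τ ^ 4 / theta 0 0 τ ^ 8

lemma zeta_eq_zetaC (τ : UpperHalfPlane) : zeta τ = zetaC τ := rfl

lemma one_sub_lam {τ : ℂ} (hτ : 0 < τ.im) : 1 - lam τ = theta 0 1 τ ^ 4 / theta 0 0 τ ^ 4 := by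
  have h := theta00_ne_zero hτ
  rw [lam, eq_div_iff (pow_ne_zero 4 h), sub_mul, div_mul_cancel₀ _ (pow_ne_zero 4 h), one_mul,
    jacobi_identity hτ]
  ring

lemma lam_ne_zero {τ : ℂ} (hτ : 0 < τ.im) : lam τ ≠ 0 :=
  div_ne_zero (pow_ne_zero 4 (theta10_ne_zero hτ)) (pow_ne_zero 4 (theta00_ne_zero hτ))

lemma one_sub_lam_ne_zero {τ : ℂ} (hτ : 0 < τ.im) : 1 - lam τ ≠ 0 := by
  rw [one_sub_lam hτ]
  exact div_ne_zero (pow_ne_zero 4 (theta01_ne_zero hτ)) (pow_ne_zero 4 (theta00_ne_zero hτ))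

lemma one_sub_two_mul_lam {τ : ℂ} (hτ : 0 < τ.im) :
    1 - 2 * lam τ = (theta 0 1 τ ^ 4 - theta 1 0 τ ^ 4) / theta 0 0 τ ^ 4 := by
  rw [sub_div, ← one_sub_lam hτ, ← lam]
  ring

lemma zetaC_eq {τ : ℂ} (hτ : 0 < τ.im) : zetaC τ = 4 * lam τ * (1 - lam τ) := by
  have h := theta00_ne_zero hτ
  rw [one_sub_lam hτ, zetaC, lam]
  field_simp

lemma zetaC_eq_one_sub_sq {τ : ℂ} (hτ : 0 < τ.im) : zetaC τ = 1 - (1 - 2 * lam τ) ^ 2 := by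
  rw [zetaC_eq hτ]
  ring

lemma zetaC_eq_one_iff {τ : ℂ} (hτ : 0 < τ.im) : zetaC τ = 1 ↔ 1 - 2 * lam τ = 0 := by
  rw [zetaC_eq_one_sub_sq hτ, sub_eq_self, sq_eq_zero_iff]

/-! ### Transformation laws, holomorphy and cusp behaviour of λ and ζ. -/

lemma im_add_one_pos {τ : ℂ} (hτ : 0 < τ.im) : 0 < (τ + 1).im := by simpa using hτ

lemma lam_add_one {τ : ℂ} (hτ : 0 < τ.im) : lam (τ + 1) = lam τ / (lam τ - 1) := by
  have h0 := theta00_ne_zero hτ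
  have h1 := theta01_ne_zero hτ
  have h := one_sub_lam (im_add_one_pos hτ)
  rw [theta00_add_one, theta01_add_one] at h
  have h2 := one_sub_lam hτ
  have h3 := one_sub_lam_ne_zero hτ
  have h4 : lam τ - 1 ≠ 0 := fun h => h3 (by linear_combination -h)
  -- The shift exchanges ϑ₀₀ and ϑ₀₁, hence inverts 1 - λ = ϑ₀₁⁴/ϑ₀₀⁴.
  have h5 : (1 - lam (τ + 1)) * (1 - lam τ) = 1 := by
    rw [h, h2]
    field_simp
  rw [eq_div_iff h4]
  linear_combination h5

lemma lam_add_two {τ : ℂ} (hτ : 0 < τ.im) : lam (τ + 2) = lam τ := by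
  have h := one_sub_lam (τ := τ + 2) (by simpa using hτ)
  rw [theta00_add_two, theta01_add_two, ← one_sub_lam hτ] at h
  linear_combination -h

lemma lam_neg_inv {τ : ℂ} (hτ : 0 < τ.im) : lam (-1 / τ) = 1 - lam τ := by
  have h := one_sub_lam (im_neg_inv_pos hτ)
  have e (x : ℂ) : x ^ 4 = (x ^ 2) ^ 2 := by ring
  have hτ0 := ne_zero_of_im_pos hτ
  have h0 := theta00_ne_zero hτ
  rw [e (theta 0 1 _), e (theta 0 0 _), theta00_neg_inv_sq hτ0, theta01_neg_inv_sq hτ0] at h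
  have : (-Complex.I * τ * theta 1 0 τ ^ 2) ^ 2 / (-Complex.I * τ * theta 0 0 τ ^ 2) ^ 2 =
      lam τ := by
    rw [lam]
    have := Complex.I_ne_zero
    field_simp
  rw [this] at h
  linear_combination -h

lemma lam_conj {τ : ℂ} (hτ : 0 < τ.im) :
    lam (-(starRingEnd ℂ) τ) = (starRingEnd ℂ) (lam τ) := by
  have h := one_sub_lam (τ := -(starRingEnd ℂ) τ) (by simpa using hτ)
  rw [theta00_conj, theta01_conj, ← map_pow, ← map_pow, ← map_div₀, ← one_sub_lam hτ, map_sub,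
    map_one] at h
  linear_combination -h

lemma differentiableAt_lam {τ : ℂ} (hτ : 0 < τ.im) : DifferentiableAt ℂ lam τ :=
  ((differentiableAt_theta10 hτ).pow 4).fun_div ((differentiableAt_theta00 hτ).pow 4)
    (pow_ne_zero 4 (theta00_ne_zero hτ))

lemma differentiableAt_zetaC {τ : ℂ} (hτ : 0 < τ.im) : DifferentiableAt ℂ zetaC τ :=
  ((((differentiableAt_theta01 hτ).pow 4).const_mul 4).mul
    ((differentiableAt_theta10 hτ).pow 4)).fun_div ((differentiableAt_theta00 hτ).pow 8)
    (pow_ne_zero 8 (theta00_ne_zero hτ))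

lemma eventually_im_pos : ∀ᶠ τ : ℂ in comap Complex.im atTop, 0 < τ.im :=
  tendsto_comap.eventually (eventually_gt_atTop 0)

lemma tendsto_lam : Tendsto lam (comap Complex.im atTop) (𝓝 0) := by
  have h : Tendsto (fun τ => 1 - theta 0 1 τ ^ 4 / theta 0 0 τ ^ 4) (comap Complex.im atTop)
      (𝓝 (1 - 1 ^ 4 / 1 ^ 4)) :=
    ((tendsto_theta01.pow 4).div (tendsto_theta00.pow 4) (by norm_num)).const_sub 1
  rw [one_pow, div_one, sub_self] at h
  refine h.congr' ?_
  filter_upwards [eventually_im_pos] with τ hτ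
  rw [← one_sub_lam hτ]
  ring

lemma tendsto_zetaC : Tendsto zetaC (comap Complex.im atTop) (𝓝 0) := by
  have h : Tendsto (fun τ => 4 * lam τ * (1 - lam τ)) (comap Complex.im atTop)
      (𝓝 (4 * 0 * (1 - 0))) := (tendsto_lam.const_mul 4).mul (tendsto_lam.const_sub 1)
  rw [mul_zero, zero_mul] at h
  refine h.congr' ?_
  filter_upwards [eventually_im_pos] with τ hτ
  rw [zetaC_eq hτ]

/-! ### Landen's transformation and the derivative of `λ` -/

/-- The modulus `k(2τ)`, a square root of `λ(2τ)`. -/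
def modulus (τ : ℂ) : ℂ := theta 1 0 (2 * τ) ^ 2 / theta 0 0 (2 * τ) ^ 2

lemma modulus_sq (τ : ℂ) : modulus τ ^ 2 = lam (2 * τ) := by
  rw [modulus, lam]
  ring

lemma theta00_sq_eq_modulus {τ : ℂ} (hτ : 0 < τ.im) :
    theta 0 0 τ ^ 2 = (1 + modulus τ) * theta 0 0 (2 * τ) ^ 2 := by
  have h := theta00_ne_zero (im_two_mul_pos hτ)
  rw [theta00_sq hτ, modulus]
  field_simp

lemma theta01_sq_eq_modulus {τ : ℂ} (hτ : 0 < τ.im) :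
    theta 0 1 τ ^ 2 = (1 - modulus τ) * theta 0 0 (2 * τ) ^ 2 := by
  have h := theta00_ne_zero (im_two_mul_pos hτ)
  rw [theta01_sq hτ, modulus]
  field_simp

lemma one_add_modulus_ne_zero {τ : ℂ} (hτ : 0 < τ.im) : 1 + modulus τ ≠ 0 := by
  intro h
  have h2 := theta00_sq_eq_modulus hτ
  rw [h, zero_mul] at h2
  exact theta00_ne_zero hτ (pow_eq_zero_iff two_ne_zero |>.1 h2)

lemma one_sub_modulus_ne_zero {τ : ℂ} (hτ : 0 < τ.im) : 1 - modulus τ ≠ 0 := by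
  intro h
  have h2 := theta01_sq_eq_modulus hτ
  rw [h, zero_mul] at h2
  exact theta01_ne_zero hτ (pow_eq_zero_iff two_ne_zero |>.1 h2)

lemma modulus_ne_zero {τ : ℂ} (hτ : 0 < τ.im) : modulus τ ≠ 0 :=
  div_ne_zero (pow_ne_zero 2 (theta10_ne_zero (im_two_mul_pos hτ)))
    (pow_ne_zero 2 (theta00_ne_zero (im_two_mul_pos hτ)))

lemma lam_eq_modulus {τ : ℂ} (hτ : 0 < τ.im) :
    lam τ = 4 * modulus τ / (1 + modulus τ) ^ 2 := by
  have e (x : ℂ) : x ^ 4 = (x ^ 2) ^ 2 := by ring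
  have h := theta00_ne_zero (im_two_mul_pos hτ)
  have h1 := one_add_modulus_ne_zero hτ
  have h2 : theta 1 0 (2 * τ) ^ 2 = modulus τ * theta 0 0 (2 * τ) ^ 2 := by
    rw [modulus]
    field_simp
  rw [lam, e, e (theta 0 0 τ), theta10_sq hτ, theta00_sq_eq_modulus hτ, mul_pow, h2]
  field_simp
  ring

lemma tendsto_modulus : Tendsto modulus (comap Complex.im atTop) (𝓝 0) := by
  have h : Tendsto (fun τ => modulus τ ^ 2) (comap Complex.im atTop) (𝓝 0) := by
    simp only [modulus_sq]
    refine tendsto_lam.comp ?_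
    rw [tendsto_comap_iff]
    have : (Complex.im ∘ fun τ => 2 * τ) = fun τ : ℂ => 2 * τ.im := by
      ext τ; simp
    rw [this]
    exact tendsto_comap.const_mul_atTop two_pos
  rw [tendsto_zero_iff_norm_tendsto_zero] at h ⊢
  have h2 := h.sqrt
  simpa only [norm_pow, Real.sqrt_sq (norm_nonneg _), Real.sqrt_zero] using h2

lemma differentiableAt_modulus {τ : ℂ} (hτ : 0 < τ.im) : DifferentiableAt ℂ modulus τ := by
  have h2 := im_two_mul_pos hτ
  have hm : DifferentiableAt ℂ (fun t : ℂ => 2 * t) τ := by fun_prop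
  exact (((differentiableAt_theta10 h2).comp τ hm).pow 2).fun_div
    (((differentiableAt_theta00 h2).comp τ hm).pow 2) (pow_ne_zero 2 (theta00_ne_zero h2))

lemma eventually_im_pos_nhds {τ : ℂ} (hτ : 0 < τ.im) : ∀ᶠ t : ℂ in 𝓝 τ, 0 < t.im :=
  Complex.continuous_im.continuousAt.eventually (lt_mem_nhds hτ)

/-- With k the modulus, λ(2τ) = k² and λ(τ) = 4k/(1+k)². Differentiating both reduces either side to
k'/(k(1-k²)ϑ₀₀(2τ)⁴). -/
lemma logDeriv_lam_two_mul {τ : ℂ} (hτ : 0 < τ.im) :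
    deriv lam τ / (lam τ * theta 0 1 τ ^ 4) =
      deriv lam (2 * τ) / (lam (2 * τ) * theta 0 1 (2 * τ) ^ 4) := by
  have h2 := im_two_mul_pos hτ
  have hk := (differentiableAt_modulus hτ).hasDerivAt
  have h1 := one_add_modulus_ne_zero hτ
  have h1' := one_sub_modulus_ne_zero hτ
  have h0 := modulus_ne_zero hτ
  have ht := theta00_ne_zero h2
  have e1 : deriv lam τ = (4 * deriv modulus τ * (1 + modulus τ) ^ 2 -
      4 * modulus τ * (2 * (1 + modulus τ) * deriv modulus τ)) / ((1 + modulus τ) ^ 2) ^ 2 := by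
    have e : lam =ᶠ[𝓝 τ] fun t => 4 * modulus t / (1 + modulus t) ^ 2 := by
      filter_upwards [eventually_im_pos_nhds hτ] with t ht using lam_eq_modulus ht
    rw [e.deriv_eq]
    have := ((hk.const_mul 4).fun_div ((hk.const_add 1).fun_pow 2) (pow_ne_zero 2 h1)).deriv
    rw [this]
    simp
  have e2 : 2 * modulus τ * deriv modulus τ = deriv lam (2 * τ) * 2 := by
    have d1 : HasDerivAt (fun t => modulus t ^ 2) (2 * modulus τ * deriv modulus τ) τ := by
      simpa using hk.fun_pow 2
    have d2 : HasDerivAt (fun t => lam (2 * t)) (deriv lam (2 * τ) * 2) τ := by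
      have hm : HasDerivAt (fun t : ℂ => 2 * t) 2 τ := by
        simpa using (hasDerivAt_id τ).const_mul 2
      exact (differentiableAt_lam h2).hasDerivAt.comp τ hm
    simp only [modulus_sq] at d1
    exact d1.unique d2
  have e2' : deriv lam (2 * τ) = modulus τ * deriv modulus τ := by linear_combination -e2 / 2
  have e (x : ℂ) : x ^ 4 = (x ^ 2) ^ 2 := by ring
  have e3 : theta 0 1 (2 * τ) ^ 4 = (1 + modulus τ) * (1 - modulus τ) *
      (theta 0 0 (2 * τ) ^ 2) ^ 2 := by
    rw [theta01_two_mul_pow_four hτ, theta00_sq_eq_modulus hτ, theta01_sq_eq_modulus hτ]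
    ring
  rw [e3, e2', e1, ← modulus_sq, lam_eq_modulus hτ, e (theta 0 1 τ), theta01_sq_eq_modulus hτ]
  field_simp
  ring

/-- Cauchy's estimate on unit disks applied to f - c. -/
lemma tendsto_deriv_zero {f : ℂ → ℂ} {c : ℂ} (hd : ∀ τ : ℂ, 0 < τ.im → DifferentiableAt ℂ f τ)
    (hf : Tendsto f (comap Complex.im atTop) (𝓝 c)) :
    Tendsto (deriv f) (comap Complex.im atTop) (𝓝 0) := by
  rw [Metric.tendsto_nhds]
  intro ε hε
  have h1 := (Metric.tendsto_nhds.1 hf) (ε / 2) (by positivity)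
  rw [eventually_comap] at h1 ⊢
  obtain ⟨Y, hY⟩ := eventually_atTop.1 h1
  refine eventually_atTop.2 ⟨max Y 0 + 2, fun y hy τ hτ => ?_⟩
  have him (z : ℂ) (hz : z ∈ Metric.closedBall τ 1) : max Y 0 + 1 ≤ z.im := by
    have := (Complex.abs_im_le_norm (z - τ)).trans (mem_closedBall_iff_norm.1 hz)
    rw [Complex.sub_im, abs_le] at this
    linarith [this.1]
  have hd' : DifferentiableOn ℂ (fun t => f t - c) (Metric.closedBall τ 1) := by
    intro z hz
    have : 0 < z.im := by linarith [him z hz, le_max_right Y 0]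
    exact ((hd z this).sub_const c).differentiableWithinAt
  have key := Complex.norm_deriv_le_of_forall_mem_sphere_norm_le (f := fun t => f t - c) (c := τ)
    (R := 1) (C := ε / 2) one_pos (hd'.diffContOnCl_ball (c := τ) subset_rfl) (fun z hz => ?_)
  · rw [deriv_sub_const] at key
    rw [dist_zero_right]
    linarith
  · have := hY z.im (by linarith [him z (Metric.sphere_subset_closedBall hz), le_max_left Y 0]) z rfl
    rw [dist_eq_norm] at this
    exact this.le

lemma lam_eq_exp_mul (τ : ℂ) :
    lam τ = Complex.exp (Real.pi * Complex.I * τ) * (thetaTen τ ^ 4 / theta 0 0 τ ^ 4) := by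
  rw [lam, theta10_eq, ← thetaTen, mul_pow, ← Complex.exp_nat_mul, mul_div_assoc]
  congr 2
  push_cast
  ring

lemma thetaTen_ne_zero {τ : ℂ} (hτ : 0 < τ.im) : thetaTen τ ≠ 0 := by
  have h := theta10_ne_zero hτ
  rw [theta10_eq] at h
  exact right_ne_zero_of_mul h

/-- Isolates the factor exp(πiτ) of λ. The other factors have nonzero limits at i∞, so the
logarithmic derivative tends to πi. -/
lemma deriv_lam_div_lam {τ : ℂ} (hτ : 0 < τ.im) :
    deriv lam τ / lam τ = Real.pi * Complex.I + 4 * (deriv thetaTen τ / thetaTen τ) -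
      4 * (deriv (theta 0 0) τ / theta 0 0 τ) := by
  have h1 := (differentiableAt_thetaTen hτ).hasDerivAt
  have h2 := (differentiableAt_theta00 hτ).hasDerivAt
  have n1 := thetaTen_ne_zero hτ
  have n2 := theta00_ne_zero hτ
  have hE : HasDerivAt (fun t : ℂ => Complex.exp (Real.pi * Complex.I * t))
      (Complex.exp (Real.pi * Complex.I * τ) * (Real.pi * Complex.I)) τ := by
    simpa using ((hasDerivAt_id τ).const_mul (Real.pi * Complex.I)).cexp
  have h := (hE.fun_mul ((h1.fun_pow 4).fun_div (h2.fun_pow 4) (pow_ne_zero 4 n2))).deriv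
  rw [← funext lam_eq_exp_mul] at h
  rw [h, lam_eq_exp_mul]
  have := Complex.exp_ne_zero (Real.pi * Complex.I * τ)
  field_simp
  push_cast
  ring

/-- The quotient λ'/(λϑ₀₁⁴) is invariant under τ ↦ 2τ and tends to πi at i∞, so it is constant. This
replaces a differential equation for the theta constants. -/
lemma deriv_lam {τ : ℂ} (hτ : 0 < τ.im) :
    deriv lam τ = Real.pi * Complex.I * lam τ * theta 0 1 τ ^ 4 := by
  have hlim : Tendsto (fun τ => deriv lam τ / (lam τ * theta 0 1 τ ^ 4)) (comap Complex.im atTop)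
      (𝓝 ((Real.pi * Complex.I + 4 * (0 / 2) - 4 * (0 / 1)) / 1 ^ 4)) := by
    have h := (((((tendsto_deriv_zero (fun _ => differentiableAt_thetaTen) tendsto_thetaTen).div
      tendsto_thetaTen two_ne_zero).const_mul 4).const_add (Real.pi * Complex.I)).sub
      (((tendsto_deriv_zero (fun _ => differentiableAt_theta00) tendsto_theta00).div
      tendsto_theta00 one_ne_zero).const_mul 4)).div (tendsto_theta01.pow 4) (by norm_num)
    refine h.congr' ?_
    filter_upwards [eventually_im_pos] with t ht
    rw [← div_div, deriv_lam_div_lam ht]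
    rfl
  have key := eq_of_two_mul_invariant hlim hτ
    (fun n => logDeriv_lam_two_mul (im_two_pow_mul_pos hτ n))
  rw [div_eq_iff (mul_ne_zero (lam_ne_zero hτ) (pow_ne_zero 4 (theta01_ne_zero hτ)))] at key
  rw [key]
  ring

lemma deriv_lam_ne_zero {τ : ℂ} (hτ : 0 < τ.im) : deriv lam τ ≠ 0 := by
  rw [deriv_lam hτ]
  exact mul_ne_zero (mul_ne_zero (mul_ne_zero (by exact_mod_cast Real.pi_ne_zero) Complex.I_ne_zero)
    (lam_ne_zero hτ)) (pow_ne_zero 4 (theta01_ne_zero hτ))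

/-- By the chain rule ζ' = 4(1-2λ)λ', so ζ ramifies only where ζ = 1. -/
lemma deriv_zetaC_ne_zero {τ : ℂ} (hτ : 0 < τ.im) (h : zetaC τ ≠ 1) : deriv zetaC τ ≠ 0 := by
  have e : zetaC =ᶠ[𝓝 τ] fun t => 1 - (1 - 2 * lam t) ^ 2 := by
    filter_upwards [eventually_im_pos_nhds hτ] with t ht using zetaC_eq_one_sub_sq ht
  have hl := (differentiableAt_lam hτ).hasDerivAt
  have hd := ((((hl.const_mul 2).const_sub 1).fun_pow 2).const_sub 1).deriv
  rw [e.deriv_eq, hd]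
  have h1 : 1 - 2 * lam τ ≠ 0 := fun h' => h ((zetaC_eq_one_iff hτ).2 h')
  have h2 := deriv_lam_ne_zero hτ
  simp [h1, h2]

/-! ### The real part of `λ` on the fundamental region -/

/-- The interior of the region `𝔻₁₂`. -/
def innerD : Set ℂ := {τ | 0 < τ.im ∧ -1 < τ.re ∧ τ.re < 1 ∧ 1 < ‖τ‖}

lemma isOpen_innerD : IsOpen innerD :=
  ((isOpen_lt continuous_const Complex.continuous_im).inter
    ((isOpen_lt continuous_const Complex.continuous_re).inter
      ((isOpen_lt Complex.continuous_re continuous_const).inter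
        (isOpen_lt continuous_const continuous_norm))))

lemma one_lt_norm_iff (τ : ℂ) : 1 < ‖τ‖ ↔ 1 < τ.re ^ 2 + τ.im ^ 2 := by
  rw [← one_lt_sq_iff₀ (norm_nonneg _), ← Complex.normSq_eq_norm_sq, Complex.normSq_apply, sq, sq]

lemma one_le_norm_iff (τ : ℂ) : 1 ≤ ‖τ‖ ↔ 1 ≤ τ.re ^ 2 + τ.im ^ 2 := by
  rw [← one_le_sq_iff₀ (norm_nonneg _), ← Complex.normSq_eq_norm_sq, Complex.normSq_apply, sq, sq]

lemma isPreconnected_innerD : IsPreconnected innerD := by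
  -- The parameters are the real part and the height above the unit circle.
  have h : innerD = (fun p : ℝ × ℝ => ((p.1 : ℂ) + (√(1 - p.1 ^ 2) + p.2 : ℝ) * Complex.I)) ''
      (Set.Ioo (-1) 1 ×ˢ Set.Ioi 0) := by
    ext τ
    simp only [innerD, Set.mem_ofPred_eq, Set.mem_image, Set.mem_prod, Set.mem_Ioo, Set.mem_Ioi,
      Prod.exists, one_lt_norm_iff]
    constructor
    · rintro ⟨h1, h2, h3, h4⟩
      refine ⟨τ.re, τ.im - √(1 - τ.re ^ 2), ⟨⟨h2, h3⟩, ?_⟩, ?_⟩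
      · rw [sub_pos, Real.sqrt_lt' h1]
        linarith
      · apply Complex.ext <;> simp
    · rintro ⟨x, s, ⟨⟨h1, h2⟩, h3⟩, rfl⟩
      have h5 : 0 < 1 - x ^ 2 := by nlinarith
      have h6 := Real.sqrt_nonneg (1 - x ^ 2)
      have h7 := Real.sq_sqrt h5.le
      simp
      refine ⟨by linarith, h1, h2, by nlinarith⟩
  rw [h]
  refine (((convex_Ioo _ _).prod (convex_Ioi _)).isPreconnected).image _ ?_
  fun_prop

/-! ### Values of λ on the boundary of the region. -/

lemma lam_real_of_re_eq_zero {τ : ℂ} (hτ : 0 < τ.im) (hre : τ.re = 0) :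
    ∃ a : ℝ, 0 < a ∧ a < 1 ∧ lam τ = a := by
  -- The reflection τ ↦ -conj τ fixes the imaginary axis, so ϑ₀₀ and ϑ₀₁ are real there and 1 - λ is
  -- a quotient of fourth powers. Applying this also at -1/τ, where 1 - λ becomes λ, gives both
  -- bounds.
  have key : ∀ {t : ℂ}, 0 < t.im → t.re = 0 → ∃ a : ℝ, 0 < a ∧ 1 - lam t = a := by
    intro t ht htr
    have e : -(starRingEnd ℂ) t = t := by
      apply Complex.ext <;> simp [htr]
    have h0 := theta00_conj t
    have h1 := theta01_conj t
    rw [e] at h0 h1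
    obtain ⟨r, hr⟩ := Complex.conj_eq_iff_real.1 h0.symm
    obtain ⟨s, hs⟩ := Complex.conj_eq_iff_real.1 h1.symm
    have hr0 : r ≠ 0 := fun h => theta00_ne_zero ht (by rw [hr, h, Complex.ofReal_zero])
    have hs0 : s ≠ 0 := fun h => theta01_ne_zero ht (by rw [hs, h, Complex.ofReal_zero])
    refine ⟨s ^ 4 / r ^ 4, div_pos (by positivity) (by positivity), ?_⟩
    rw [one_sub_lam ht, hr, hs]
    push_cast
    rfl
  obtain ⟨a, ha, ha'⟩ := key hτ hre
  obtain ⟨b, hb, hb'⟩ := key (im_neg_inv_pos hτ) (by simp [Complex.div_re, hre])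
  rw [lam_neg_inv hτ, sub_sub_cancel] at hb'
  refine ⟨b, hb, ?_, hb'⟩
  rw [hb'] at ha'
  have : 1 - b = a := by exact_mod_cast ha'
  linarith

lemma norm_lam_lt_one_of_re_eq_zero {τ : ℂ} (hτ : 0 < τ.im) (hre : τ.re = 0) : ‖lam τ‖ < 1 := by
  obtain ⟨a, h0, h1, h⟩ := lam_real_of_re_eq_zero hτ hre
  rwa [h, Complex.norm_real, Real.norm_of_nonneg h0.le]

lemma neg_inv_eq_of_norm_eq_one {τ : ℂ} (h : ‖τ‖ = 1) : -1 / τ = -(starRingEnd ℂ) τ := by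
  rw [neg_div, one_div, Complex.inv_def, Complex.normSq_eq_norm_sq, h]
  simp

/-- On the unit circle the inversion and the reflection τ ↦ -conj τ agree. -/
lemma conj_lam_of_norm_eq_one {τ : ℂ} (hτ : 0 < τ.im) (h : ‖τ‖ = 1) :
    (starRingEnd ℂ) (lam τ) = 1 - lam τ := by
  rw [← lam_conj hτ, ← neg_inv_eq_of_norm_eq_one h, lam_neg_inv hτ]

lemma re_lam_of_norm_eq_one {τ : ℂ} (hτ : 0 < τ.im) (h : ‖τ‖ = 1) : (lam τ).re = 1 / 2 := by
  have := congrArg Complex.re (conj_lam_of_norm_eq_one hτ h)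
  simp at this
  linarith

lemma norm_lam_add_one {τ : ℂ} (hτ : 0 < τ.im) : ‖lam (τ + 1)‖ = ‖lam τ‖ / ‖1 - lam τ‖ := by
  rw [lam_add_one hτ, norm_div, norm_sub_rev]

lemma norm_lam_add_one_of_norm_eq_one {τ : ℂ} (hτ : 0 < τ.im) (h : ‖τ‖ = 1) :
    ‖lam (τ + 1)‖ = 1 := by
  rw [norm_lam_add_one hτ, ← conj_lam_of_norm_eq_one hτ h, RCLike.norm_conj, div_self]
  exact norm_ne_zero_iff.2 (lam_ne_zero hτ)

lemma norm_lt_norm_one_sub_iff (z : ℂ) : ‖z‖ < ‖1 - z‖ ↔ z.re < 1 / 2 := by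
  rw [← sq_lt_sq₀ (norm_nonneg _) (norm_nonneg _), ← Complex.normSq_eq_norm_sq,
    ← Complex.normSq_eq_norm_sq, Complex.normSq_apply, Complex.normSq_apply]
  simp
  constructor <;> intro h <;> nlinarith

lemma norm_lam_add_one_lt_one_iff {τ : ℂ} (hτ : 0 < τ.im) :
    ‖lam (τ + 1)‖ < 1 ↔ (lam τ).re < 1 / 2 := by
  rw [norm_lam_add_one hτ, div_lt_one (norm_pos_iff.2 (one_sub_lam_ne_zero hτ)),
    norm_lt_norm_one_sub_iff]

lemma exists_norm_lam_le {δ : ℝ} (hδ : 0 < δ) : ∃ Y : ℝ, 0 < Y ∧ ∀ τ : ℂ, Y ≤ τ.im → ‖lam τ‖ ≤ δ := by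
  have h1 := (Metric.tendsto_nhds.1 tendsto_lam) δ hδ
  rw [eventually_comap] at h1
  obtain ⟨Y, hY⟩ := eventually_atTop.1 h1
  refine ⟨max Y 1, by positivity, fun τ hτ => ?_⟩
  have := hY τ.im ((le_max_left _ _).trans hτ) τ rfl
  rw [dist_zero_right] at this
  exact this.le

/-- Controls the corners ±1 of the region, where λ(τ+1) need not be continuous. Translating the
corner to 0 and inverting sends the point high up: outside the unit circle the distance of Re τ to
±1 is at most (Im τ)², so Im(-1/σ) ≥ 1/(2 Im τ) ≥ Y. -/
lemma norm_lam_le_near_cusp {δ Y : ℝ} (hY : 0 < Y) (hY' : ∀ τ : ℂ, Y ≤ τ.im → ‖lam τ‖ ≤ δ)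
    {τ : ℂ} (h0 : 0 < τ.im) (h1 : τ.im ≤ 1) (h2 : 2 * τ.im * Y ≤ 1) (hre : |τ.re| ≤ 1)
    (hn : 1 ≤ ‖τ‖) : ‖lam (τ + 1)‖ ≤ 1 + δ := by
  rw [one_le_norm_iff] at hn
  have main : ∀ σ : ℂ, σ.im = τ.im → |σ.re| = 1 - |τ.re| → ‖lam σ‖ ≤ 1 + δ := by
    intro σ hσ hσr
    have hσ0 : 0 < σ.im := by rw [hσ]; exact h0
    have e : lam σ = 1 - lam (-1 / σ) := by rw [lam_neg_inv hσ0]; ring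
    rw [e]
    refine (norm_sub_le _ _).trans ?_
    rw [norm_one]
    gcongr
    apply hY'
    have hb : |σ.re| ≤ τ.im ^ 2 := by
      rw [hσr]
      rw [← sq_abs] at hn
      nlinarith [abs_nonneg τ.re]
    have hsq : σ.re ^ 2 ≤ τ.im ^ 2 := by
      rw [← sq_abs]
      have : τ.im ^ 2 ≤ τ.im := by nlinarith
      exact pow_le_pow_left₀ (abs_nonneg _) (hb.trans this) 2
    rw [im_neg_inv, le_div_iff₀ (Complex.normSq_pos.2 (ne_zero_of_im_pos hσ0)),
      Complex.normSq_apply, hσ]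
    have : σ.re * σ.re + τ.im * τ.im ≤ 2 * τ.im ^ 2 := by nlinarith
    nlinarith
  rcases le_or_gt 0 τ.re with h | h
  · have e : τ + 1 = (τ - 1) + 2 := by ring
    rw [e, lam_add_two (by simpa using h0)]
    refine main _ (by simp) ?_
    rw [abs_of_nonneg h] at hre ⊢
    rw [Complex.sub_re, Complex.one_re, abs_of_nonpos (by linarith)]
    ring
  · refine main _ (by simp) ?_
    rw [abs_of_neg h] at hre ⊢
    rw [Complex.add_re, Complex.one_re, abs_of_nonneg (by linarith)]
    ring

lemma differentiableAt_lam_add_one {τ : ℂ} (hτ : 0 < τ.im) :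
    DifferentiableAt ℂ (fun t => lam (t + 1)) τ :=
  (differentiableAt_lam (im_add_one_pos hτ)).comp (f := fun t : ℂ => t + 1) τ (by fun_prop)

/-- Maximum principle on the region truncated at heights ε and M. On the vertical sides λ(τ+1) is a
value of λ on the imaginary axis, on the arc its norm is 1, and on the horizontal cuts it is at most
1 + δ by smallness of λ at i∞; then δ → 0. -/
lemma norm_lam_add_one_le_one {τ : ℂ} (hτ : τ ∈ innerD) : ‖lam (τ + 1)‖ ≤ 1 := by
  refine le_of_forall_pos_le_add fun δ hδ => ?_
  obtain ⟨h1, h2, h3, h4⟩ := hτ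
  obtain ⟨Y, hY, hYδ⟩ := exists_norm_lam_le hδ
  obtain ⟨Y', hY', hY1⟩ := exists_norm_lam_le one_pos
  set ε : ℝ := min (min (τ.im / 2) 1) (1 / (2 * Y)) with hε
  set M : ℝ := max (τ.im + 1) Y' with hM
  have hε0 : 0 < ε := by positivity
  have hε1 : ε ≤ 1 := (min_le_left _ _).trans (min_le_right _ _)
  have hετ : ε < τ.im := ((min_le_left _ _).trans (min_le_left _ _)).trans_lt (by linarith)
  have hεY : 2 * ε * Y ≤ 1 := by
    have : ε ≤ 1 / (2 * Y) := min_le_right _ _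
    rw [le_div_iff₀ (by positivity)] at this
    linarith
  have hMτ : τ.im < M := lt_of_lt_of_le (by linarith) (le_max_left _ _)
  set U : Set ℂ := {t | ε < t.im ∧ t.im < M ∧ -1 < t.re ∧ t.re < 1 ∧ 1 < ‖t‖} with hU
  set K : Set ℂ := {t | ε ≤ t.im ∧ t.im ≤ M ∧ -1 ≤ t.re ∧ t.re ≤ 1 ∧ 1 ≤ ‖t‖} with hK
  have hUo : IsOpen U := ((isOpen_lt continuous_const Complex.continuous_im).inter
    ((isOpen_lt Complex.continuous_im continuous_const).inter
    ((isOpen_lt continuous_const Complex.continuous_re).inter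
      ((isOpen_lt Complex.continuous_re continuous_const).inter
        (isOpen_lt continuous_const continuous_norm)))))
  have hKc : IsClosed K := ((isClosed_le continuous_const Complex.continuous_im).inter
    ((isClosed_le Complex.continuous_im continuous_const).inter
    ((isClosed_le continuous_const Complex.continuous_re).inter
      ((isClosed_le Complex.continuous_re continuous_const).inter
        (isClosed_le continuous_const continuous_norm)))))
  have hUK : closure U ⊆ K :=
    closure_minimal (fun t ⟨a, b, c, d, e⟩ => ⟨a.le, b.le, c.le, d.le, e.le⟩) hKc
  have hb : Bornology.IsBounded U := by
    refine (Metric.isBounded_closedBall (x := (0 : ℂ)) (r := 1 + M)).subset ?_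
    rintro t ⟨a, b, c, d, e⟩
    rw [mem_closedBall_zero_iff]
    refine (Complex.norm_le_abs_re_add_abs_im t).trans ?_
    rw [abs_of_pos (hε0.trans a)]
    have : |t.re| ≤ 1 := abs_le.2 ⟨c.le, d.le⟩
    linarith
  have hd : DiffContOnCl ℂ (fun t => lam (t + 1)) U := by
    refine DifferentiableOn.diffContOnCl fun t ht => ?_
    exact (differentiableAt_lam_add_one (hε0.trans_le (hUK ht).1)).differentiableWithinAt
  refine Complex.norm_le_of_forall_mem_frontier_norm_le hb hd (fun z hz => ?_)
    (subset_closure ⟨hετ, hMτ, h2, h3, h4⟩)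
  rw [frontier, hUo.interior_eq] at hz
  obtain ⟨a, b, c, d, e⟩ := hUK hz.1
  have hz0 : 0 < z.im := hε0.trans_le a
  have hone : (1 : ℝ) ≤ 1 + δ := by linarith
  by_cases c1 : z.im = ε
  · exact norm_lam_le_near_cusp hY hYδ hz0 (by linarith) (by rw [c1]; exact hεY)
      (abs_le.2 ⟨c, d⟩) e
  by_cases c2 : z.im = M
  · refine (hY1 _ ?_).trans hone
    simp only [Complex.add_im, Complex.one_im, add_zero, c2]
    exact le_max_right _ _
  by_cases c3 : z.re = -1
  · exact (norm_lam_lt_one_of_re_eq_zero (im_add_one_pos hz0) (by simp [c3])).le.trans hone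
  by_cases c4 : z.re = 1
  · have e' : z + 1 = (z - 1) + 2 := by ring
    rw [e', lam_add_two (by simpa using hz0)]
    exact (norm_lam_lt_one_of_re_eq_zero (by simpa using hz0) (by simp [c4])).le.trans hone
  by_cases c5 : ‖z‖ = 1
  · exact (norm_lam_add_one_of_norm_eq_one hz0 c5).le.trans hone
  · exact absurd ⟨lt_of_le_of_ne a (Ne.symm c1), lt_of_le_of_ne b c2, lt_of_le_of_ne c (Ne.symm c3),
      lt_of_le_of_ne d c4, lt_of_le_of_ne e (Ne.symm c5)⟩ hz.2

lemma mem_innerD_of_large {y : ℝ} (hy : 1 < y) : (y : ℂ) * Complex.I ∈ innerD := by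
  refine ⟨by simp; linarith, by simp, by simp, ?_⟩
  simp
  exact lt_of_lt_of_le hy (le_abs_self y)

/-- Equality at one point would make |λ(τ+1)| attain its maximum, hence be constantly 1, which is
false near i∞. -/
lemma re_lam_lt_half_of_mem_innerD {τ : ℂ} (hτ : τ ∈ innerD) : (lam τ).re < 1 / 2 := by
  rw [← norm_lam_add_one_lt_one_iff hτ.1]
  refine lt_of_le_of_ne (norm_lam_add_one_le_one hτ) fun h => ?_
  have hmax : IsMaxOn (norm ∘ fun t => lam (t + 1)) innerD τ := fun t ht => by
    simp only [Function.comp, Set.mem_ofPred_eq, h]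
    exact norm_lam_add_one_le_one ht
  have hc := Complex.eqOn_of_isPreconnected_of_isMaxOn_norm isPreconnected_innerD isOpen_innerD
    (fun t ht => (differentiableAt_lam_add_one ht.1).differentiableWithinAt) hτ hmax
  obtain ⟨Y, hY, hY'⟩ := exists_norm_lam_le (δ := 1 / 2) (by norm_num)
  have h1 := hc (mem_innerD_of_large (y := Y + 2) (by linarith))
  have h2 := hY' ((Y + 2 : ℝ) * Complex.I + 1) (by simp)
  simp only [Function.const] at h1
  rw [h1, h] at h2
  norm_num at h2

lemma re_lam_lt_half_of_re_eq_one {τ : ℂ} (hτ : 0 < τ.im) (h : τ.re = 1) :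
    (lam τ).re < 1 / 2 := by
  rw [← norm_lam_add_one_lt_one_iff hτ]
  have e' : τ + 1 = (τ - 1) + 2 := by ring
  rw [e', lam_add_two (by simpa using hτ)]
  exact norm_lam_lt_one_of_re_eq_zero (by simpa using hτ) (by simp [h])

lemma mem_slitDomain_iff (z : ℂ) : z ∈ slitDomain ↔ 1 - z ∈ Complex.slitPlane := by
  rw [slitDomain, Set.mem_ofPred_eq, Complex.mem_slitPlane_iff]
  simp
  constructor
  · intro h
    by_cases h1 : z.im = 0
    · exact Or.inl (h h1)
    · exact Or.inr h1
  · rintro (h | h) h1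
    · exact h
    · exact absurd h1 h

/-- 1 - ζ is the square of 1 - 2λ, which has positive real part, so it avoids (-∞, 0]. -/
lemma zetaC_mem_slitDomain {τ : ℂ} (hτ : 0 < τ.im) (h : (lam τ).re < 1 / 2) :
    zetaC τ ∈ slitDomain := by
  rw [mem_slitDomain_iff, zetaC_eq_one_sub_sq hτ, sub_sub_cancel, sq]
  have h1 : 0 < (1 - 2 * lam τ).re := by simp; linarith
  rw [Complex.mem_slitPlane_iff]
  by_cases hi : (1 - 2 * lam τ).im = 0
  · left
    rw [Complex.mul_re, hi]
    nlinarith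
  · right
    rw [Complex.mul_im]
    intro h0
    exact hi (by nlinarith)

/-! ### The unit circle -/

lemma hasDerivAt_lam_circle {φ : ℝ} (hφ : 0 < Real.sin φ) :
    HasDerivAt (fun t : ℝ => lam (Complex.exp (t * Complex.I)))
      (-(Real.pi * Complex.exp (φ * Complex.I) * lam (Complex.exp (φ * Complex.I)) *
        theta 0 1 (Complex.exp (φ * Complex.I)) ^ 4)) φ := by
  set τ := Complex.exp (φ * Complex.I) with hτ
  have him : 0 < τ.im := by rwa [hτ, Complex.exp_ofReal_mul_I_im]
  have hE : HasDerivAt (fun t : ℝ => Complex.exp (t * Complex.I)) (τ * Complex.I) φ := by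
    have := ((Complex.ofRealCLM.hasDerivAt (x := φ)).mul_const Complex.I).cexp
    simpa using this
  have h1 := (differentiableAt_lam him).hasDerivAt
  rw [deriv_lam him] at h1
  refine (h1.comp φ hE).congr_deriv ?_
  linear_combination (Real.pi * lam τ * theta 0 1 τ ^ 4 * τ) * Complex.I_sq

lemma hasDerivAt_im_lam_circle {φ : ℝ} (hφ : 0 < Real.sin φ) :
    HasDerivAt (fun t : ℝ => (lam (Complex.exp (t * Complex.I))).im)
      (-(Real.pi * Complex.exp (φ * Complex.I) * lam (Complex.exp (φ * Complex.I)) *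
        theta 0 1 (Complex.exp (φ * Complex.I)) ^ 4)).im φ :=
  Complex.imCLM.hasFDerivAt.comp_hasDerivAt φ (hasDerivAt_lam_circle hφ)

/-- Re λ is constant on the circle, so a zero of this derivative would be a zero of λ'. -/
lemma deriv_im_lam_circle_ne_zero {φ : ℝ} (hφ : 0 < Real.sin φ) :
    (-(Real.pi * Complex.exp (φ * Complex.I) * lam (Complex.exp (φ * Complex.I)) *
        theta 0 1 (Complex.exp (φ * Complex.I)) ^ 4)).im ≠ 0 := by
  have hre : HasDerivAt (fun t : ℝ => (lam (Complex.exp (t * Complex.I))).re)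
      (-(Real.pi * Complex.exp (φ * Complex.I) * lam (Complex.exp (φ * Complex.I)) *
        theta 0 1 (Complex.exp (φ * Complex.I)) ^ 4)).re φ :=
    Complex.reCLM.hasFDerivAt.comp_hasDerivAt φ (hasDerivAt_lam_circle hφ)
  have hc : (fun t : ℝ => (lam (Complex.exp (t * Complex.I))).re) =ᶠ[𝓝 φ] fun _ => 1 / 2 := by
    filter_upwards [Real.continuous_sin.continuousAt.eventually (lt_mem_nhds hφ)] with t ht
    exact re_lam_of_norm_eq_one (by rwa [Complex.exp_ofReal_mul_I_im])
      (Complex.norm_exp_ofReal_mul_I t)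
  have h0 := hre.unique ((hasDerivAt_const φ (1 / 2 : ℝ)).congr_of_eventuallyEq hc)
  have him : 0 < (Complex.exp (φ * Complex.I)).im := by rwa [Complex.exp_ofReal_mul_I_im]
  intro h
  have h2 := Complex.ext (w := 0) h0 h
  rw [neg_eq_zero] at h2
  exact mul_ne_zero (mul_ne_zero (mul_ne_zero (by exact_mod_cast Real.pi_ne_zero)
    (Complex.exp_ne_zero _)) (lam_ne_zero him)) (pow_ne_zero 4 (theta01_ne_zero him)) h2

lemma lam_I : lam Complex.I = 1 / 2 := by
  obtain ⟨a, -, -, h⟩ := lam_real_of_re_eq_zero (τ := Complex.I) (by simp) (by simp)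
  have h2 := re_lam_of_norm_eq_one (τ := Complex.I) (by simp) (by simp)
  rw [h] at h2 ⊢
  rw [Complex.ofReal_re] at h2
  rw [h2]
  norm_num

/-- Along e^{iφ} the derivative of Im λ never vanishes, so by Darboux it keeps the sign it has at φ
= π/2. There it is explicitly negative and Im λ = 0, hence Im λ > 0 for φ < π/2. -/
lemma im_lam_pos_of_norm_eq_one {τ : ℂ} (hτ : 0 < τ.im) (hn : ‖τ‖ = 1) (hre : 0 < τ.re) :
    0 < (lam τ).im := by
  set y : ℝ → ℝ := fun t => (lam (Complex.exp (t * Complex.I))).im with hy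
  set d : ℝ → ℝ := fun φ => (-(Real.pi * Complex.exp (φ * Complex.I) *
    lam (Complex.exp (φ * Complex.I)) * theta 0 1 (Complex.exp (φ * Complex.I)) ^ 4)).im with hd
  have hI : Complex.exp ((Real.pi / 2 : ℝ) * Complex.I) = Complex.I := by
    push_cast
    exact Complex.exp_pi_div_two_mul_I
  have hyd : ∀ φ ∈ Set.Ioo 0 Real.pi, HasDerivAt y (d φ) φ := fun φ hφ =>
    hasDerivAt_im_lam_circle (Real.sin_pos_of_mem_Ioo hφ)
  have hd0 : ∀ φ ∈ Set.Ioo 0 Real.pi, d φ ≠ 0 := fun φ hφ =>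
    deriv_im_lam_circle_ne_zero (Real.sin_pos_of_mem_Ioo hφ)
  have hpi2 : Real.pi / 2 ∈ Set.Ioo 0 Real.pi := ⟨by positivity, by linarith [Real.pi_pos]⟩
  have hneg : d (Real.pi / 2) < 0 := by
    obtain ⟨s, hs⟩ := Complex.conj_eq_iff_real.1 (theta01_conj Complex.I ▸ by simp :
      (starRingEnd ℂ) (theta 0 1 Complex.I) = theta 0 1 Complex.I)
    have hs0 : s ≠ 0 := fun h => theta01_ne_zero (τ := Complex.I) (by simp)
      (by rw [hs, h, Complex.ofReal_zero])
    simp only [hd]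
    rw [hI, lam_I, hs]
    have : -((Real.pi : ℂ) * Complex.I * (1 / 2) * (s : ℂ) ^ 4) =
        ((-(Real.pi / 2 * s ^ 4) : ℝ) : ℂ) * Complex.I := by
      push_cast; ring
    rw [this, Complex.im_ofReal_mul]
    simp
    positivity
  have hall : ∀ φ ∈ Set.Ioo 0 Real.pi, d φ < 0 := by
    rcases hasDerivWithinAt_forall_lt_or_forall_gt_of_forall_ne (convex_Ioo 0 Real.pi)
      (fun φ hφ => (hyd φ hφ).hasDerivWithinAt) hd0 with h | h
    · exact h
    · exact absurd (h _ hpi2) (not_lt.2 hneg.le)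
  have hanti : StrictAntiOn y (Set.Ioo 0 Real.pi) := by
    refine strictAntiOn_of_deriv_neg (convex_Ioo 0 Real.pi)
      (fun φ hφ => (hyd φ hφ).continuousAt.continuousWithinAt) fun φ hφ => ?_
    rw [interior_Ioo] at hφ
    rw [(hyd φ hφ).deriv]
    exact hall φ hφ
  have harg : τ = Complex.exp ((Complex.arg τ : ℝ) * Complex.I) := by
    conv_lhs => rw [← Complex.norm_mul_exp_arg_mul_I τ, hn]
    simp
  have harg2 : Complex.arg τ < Real.pi / 2 :=
    (abs_lt.1 (Complex.abs_arg_lt_pi_div_two_iff.2 (Or.inl hre))).2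
  have harg0 : 0 < Complex.arg τ := by
    refine lt_of_le_of_ne (Complex.arg_nonneg_iff.2 hτ.le) fun h => ?_
    rw [← h] at harg
    rw [harg] at hτ
    simp at hτ
  have := hanti ⟨harg0, harg2.trans hpi2.2⟩ hpi2 harg2
  simp only [hy] at this
  rw [hI, lam_I, ← harg] at this
  simpa using this

/-! ### Second order equations with a regular singular point at `0` -/

/-- Near `0` the function `y` solves `x p(x) y'' + u(x) y' + v(x) y = 0`. -/
def SolvesODE (p u v y : ℂ → ℂ) : Prop :=
  ∃ y1 y2 : ℂ → ℂ, ∀ᶠ x in 𝓝 0, HasDerivAt y (y1 x) x ∧ HasDerivAt y1 (y2 x) x ∧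
    x * p x * y2 x + u x * y1 x + v x * y x = 0

lemma SolvesODE.sub {p u v y z : ℂ → ℂ} (hy : SolvesODE p u v y) (hz : SolvesODE p u v z) :
    SolvesODE p u v (fun x => y x - z x) := by
  obtain ⟨y1, y2, hy⟩ := hy
  obtain ⟨z1, z2, hz⟩ := hz
  refine ⟨fun x => y1 x - z1 x, fun x => y2 x - z2 x, ?_⟩
  filter_upwards [hy, hz] with x ⟨a, b, c⟩ ⟨a', b', c'⟩
  exact ⟨a.sub a', b.sub b', by linear_combination c - c'⟩

/-- The indicial equation at 0 is r² = 0. A nonzero solution vanishing at 0 would start with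
x^(m+1), and the lowest coefficient of the equation would be (m+1)² g(0) ≠ 0. -/
lemma SolvesODE.eventually_eq_zero {p u v y : ℂ → ℂ} (h : SolvesODE p u v y)
    (hp : ContinuousAt p 0) (hu : ContinuousAt u 0) (hv : ContinuousAt v 0)
    (hp0 : p 0 = 1) (hu0 : u 0 = 1) (hy0 : y 0 = 0) : ∀ᶠ x in 𝓝 0, y x = 0 := by
  obtain ⟨y1, y2, h⟩ := h
  have hya : AnalyticAt ℂ y 0 := Complex.analyticAt_iff_eventually_differentiableAt.2
    (h.mono fun x hx => hx.1.differentiableAt)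
  by_contra hne
  obtain ⟨n, g, hg, hg0, hyg⟩ := hya.exists_eventuallyEq_pow_smul_nonzero_iff.2 hne
  simp only [sub_zero, smul_eq_mul] at hyg
  obtain ⟨m, rfl⟩ : ∃ m, n = m + 1 := by
    refine ⟨n - 1, ?_⟩
    rcases Nat.eq_zero_or_pos n with rfl | hn
    · have := hyg.self_of_nhds
      rw [hy0, pow_zero, one_mul] at this
      exact absurd this.symm hg0
    · omega
  have hgd := hg.eventually_analyticAt
  have e1 : ∀ᶠ x in 𝓝 0, y1 x = (m + 1) * x ^ m * g x + x ^ (m + 1) * deriv g x := by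
    filter_upwards [hyg.eventually_nhds, hgd, h] with x hx hgx hh
    have d := ((hasDerivAt_pow (m + 1) x).fun_mul hgx.differentiableAt.hasDerivAt)
    have := (d.congr_of_eventuallyEq hx).unique hh.1
    rw [← this]
    simp
  have e2 : ∀ᶠ x in 𝓝 0, x * y2 x = (m + 1) * m * x ^ m * g x +
      2 * (m + 1) * x ^ (m + 1) * deriv g x + x ^ (m + 2) * deriv (deriv g) x := by
    filter_upwards [e1.eventually_nhds, hgd, h] with x hx hgx hh
    have hg' := hgx.differentiableAt.hasDerivAt
    have d := ((((hasDerivAt_pow m x).const_mul ((m : ℂ) + 1)).fun_mul hg').fun_add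
      ((hasDerivAt_pow (m + 1) x).fun_mul hgx.deriv.differentiableAt.hasDerivAt))
    have := (d.congr_of_eventuallyEq hx).unique hh.2.1
    rw [← this]
    rcases m with _ | k
    · simp; ring
    · simp only [Nat.add_sub_cancel]
      push_cast
      ring
  -- The left side of the equation divided by x^m. It vanishes off 0, hence at 0 by continuity.
  set R : ℂ → ℂ := fun x => p x * ((m + 1) * m * g x + 2 * (m + 1) * x * deriv g x +
      x ^ 2 * deriv (deriv g) x) + u x * ((m + 1) * g x + x * deriv g x) + v x * x * g x with hR
  have hR0 : ∀ᶠ x in 𝓝[≠] 0, R x = 0 := by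
    filter_upwards [e1.filter_mono nhdsWithin_le_nhds, e2.filter_mono nhdsWithin_le_nhds,
      h.filter_mono nhdsWithin_le_nhds, hyg.filter_mono nhdsWithin_le_nhds,
      self_mem_nhdsWithin] with x a b c d hx
    have c3 := c.2.2
    rw [d, a] at c3
    have : x ^ m * R x = 0 := by
      rw [← c3, hR]
      linear_combination -p x * b
    exact (mul_eq_zero.1 this).resolve_left (pow_ne_zero m hx)
  have hRc : ContinuousAt R 0 := by
    have h1 := hg.continuousAt
    have h2 := hg.deriv.continuousAt
    have h3 := hg.deriv.deriv.continuousAt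
    simp only [hR]
    fun_prop
  have hlim := tendsto_nhds_unique (tendsto_const_nhds.congr' (hR0.mono fun x hx => hx.symm))
    (hRc.tendsto.mono_left (nhdsWithin_le_nhds (s := {0}ᶜ)))
  simp only [hR, hp0, hu0] at hlim
  have : ((m : ℂ) + 1) ^ 2 * g 0 = 0 := by linear_combination -hlim
  exact mul_ne_zero (pow_ne_zero 2 (Nat.cast_add_one_ne_zero m)) hg0 this

lemma SolvesODE.unique {p u v y z : ℂ → ℂ} (hy : SolvesODE p u v y) (hz : SolvesODE p u v z)
    (hp : ContinuousAt p 0) (hu : ContinuousAt u 0) (hv : ContinuousAt v 0)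
    (hp0 : p 0 = 1) (hu0 : u 0 = 1) (hyz : y 0 = z 0) : y =ᶠ[𝓝 0] z := by
  filter_upwards [(hy.sub hz).eventually_eq_zero hp hu hv hp0 hu0 (sub_eq_zero.2 hyz)] with x hx
  exact sub_eq_zero.1 hx

/-! ### The hypergeometric equation -/

lemma hasSum_mul_of_shift {d : ℕ → ℂ} {x s : ℂ} (h : HasSum (fun n => d (n + 1) * x ^ n) s)
    (h0 : d 0 = 0) : HasSum (fun n => d n * x ^ n) (x * s) := by
  rw [← hasSum_nat_add_iff' 1]
  simp only [Finset.range_one, Finset.sum_singleton, h0, zero_mul, sub_zero]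
  refine (h.mul_left x).congr_fun fun n => ?_
  ring

/-- Neither `a` nor `b` is a nonpositive integer. -/
def Generic (a b : ℂ) : Prop := ∀ n : ℕ, (n : ℂ) ≠ -a ∧ (n : ℂ) ≠ -b

lemma Generic.hasFPowerSeriesOnBall {a b : ℂ} (h : Generic a b) :
    HasFPowerSeriesOnBall (ordinaryHypergeometric a b 1) (ordinaryHypergeometricSeries ℂ a b 1)
      0 1 := by
  have hr := ordinaryHypergeometricSeries_radius_eq_one (𝔸 := ℂ) a b 1
    (fun n => ⟨(h n).1, (h n).2, fun h' => by
      have : ((n + 1 : ℕ) : ℂ) = 0 := by push_cast; rw [h']; ring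
      exact absurd this (Nat.cast_ne_zero.2 n.succ_ne_zero)⟩)
  have := (ordinaryHypergeometricSeries ℂ a b 1).hasFPowerSeriesOnBall (by rw [hr]; exact one_pos)
  rwa [hr] at this

lemma Generic.analyticOnNhd {a b : ℂ} (h : Generic a b) :
    AnalyticOnNhd ℂ (ordinaryHypergeometric a b (1 : ℂ) : ℂ → ℂ) (Metric.ball 0 1) := by
  have := h.hasFPowerSeriesOnBall.analyticOnNhd
  rwa [← ENNReal.ofReal_one, Metric.eball_ofReal] at this

lemma coefficient_succ (a b : ℂ) (n : ℕ) :
    ((n : ℂ) + 1) ^ 2 * ordinaryHypergeometricCoefficient a b 1 (n + 1) =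
      (n + a) * (n + b) * ordinaryHypergeometricCoefficient a b 1 n := by
  simp only [ordinaryHypergeometricCoefficient, ascPochhammer_succ_eval, ascPochhammer_eval_one,
    Nat.factorial_succ]
  have h1 : ((n : ℂ) + 1) ≠ 0 := Nat.cast_add_one_ne_zero n
  have h2 : (n.factorial : ℂ) ≠ 0 := Nat.cast_ne_zero.2 n.factorial_ne_zero
  have h3 : (1 : ℂ) + n ≠ 0 := by rwa [add_comm]
  push_cast
  field_simp
  ring

lemma Generic.hasSum {a b : ℂ} (h : Generic a b) {x : ℂ} (hx : x ∈ Metric.ball (0 : ℂ) 1) :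
    HasSum (fun n => ordinaryHypergeometricCoefficient a b 1 n * x ^ n)
        (ordinaryHypergeometric a b 1 x) ∧
      HasSum (fun n : ℕ => (n + 1) * ordinaryHypergeometricCoefficient a b 1 (n + 1) * x ^ n)
        (deriv (ordinaryHypergeometric a b 1 : ℂ → ℂ) x) ∧
      HasSum (fun n : ℕ => (n + 1) * (n + 2) * ordinaryHypergeometricCoefficient a b 1 (n + 2) *
        x ^ n) (deriv (deriv (ordinaryHypergeometric a b 1 : ℂ → ℂ)) x) := by
  set F : ℂ → ℂ := ordinaryHypergeometric a b 1 with hF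
  have hd : AnalyticOnNhd ℂ F (Metric.ball 0 1) := h.analyticOnNhd
  -- Uniqueness of power series identifies the Taylor coefficients at 0, so the expansions of F, F'
  -- and F'' all come from Taylor's theorem on the disk.
  have hc : (fun n : ℕ => iteratedDeriv n F 0 / n.factorial) =
      ordinaryHypergeometricCoefficient a b 1 := by
    refine FormalMultilinearSeries.ofScalars_series_injective ℂ ℂ ?_
    exact (hd 0 (by simp)).hasFPowerSeriesAt.eq_formalMultilinearSeries
      h.hasFPowerSeriesOnBall.hasFPowerSeriesAt
  have hc' (n : ℕ) : iteratedDeriv n F 0 =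
      n.factorial * ordinaryHypergeometricCoefficient a b 1 n := by
    rw [← hc]
    have : (n.factorial : ℂ) ≠ 0 := Nat.cast_ne_zero.2 n.factorial_ne_zero
    field_simp
  have h0 := Complex.hasSum_taylorSeries_on_ball hd.differentiableOn hx
  have h1 := Complex.hasSum_taylorSeries_on_ball hd.deriv.differentiableOn hx
  have h2 := Complex.hasSum_taylorSeries_on_ball hd.deriv.deriv.differentiableOn hx
  simp only [← iteratedDeriv_succ', hc', sub_zero, smul_eq_mul, Nat.factorial_succ] at h0 h1 h2
  generalize ordinaryHypergeometricCoefficient a b (1 : ℂ) = c at h0 h1 h2 ⊢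
  refine ⟨h0.congr_fun fun n => ?_, h1.congr_fun fun n => ?_, h2.congr_fun fun n => ?_⟩ <;>
  · have : (n.factorial : ℂ) ≠ 0 := Nat.cast_ne_zero.2 n.factorial_ne_zero
    push_cast
    have : (n : ℂ) + 1 ≠ 0 := Nat.cast_add_one_ne_zero n
    field_simp
    try ring

lemma Generic.ode {a b : ℂ} (h : Generic a b) {x : ℂ} (hx : x ∈ Metric.ball (0 : ℂ) 1) :
    x * (1 - x) * deriv (deriv (ordinaryHypergeometric a b 1)) x +
      (1 - (a + b + 1) * x) * deriv (ordinaryHypergeometric a b 1) x -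
      a * b * ordinaryHypergeometric a b 1 x = 0 := by
  obtain ⟨h0, h1, h2⟩ := h.hasSum hx
  set c := ordinaryHypergeometricCoefficient a b (1 : ℂ) with hc
  have s1 : HasSum (fun n : ℕ => (n : ℂ) * c n * x ^ n)
      (x * deriv (ordinaryHypergeometric a b 1) x) :=
    hasSum_mul_of_shift (d := fun n => (n : ℂ) * c n) (by simpa using h1) (by simp)
  have s2 : HasSum (fun n : ℕ => (n : ℂ) * (n + 1) * c (n + 1) * x ^ n)
      (x * deriv (deriv (ordinaryHypergeometric a b 1)) x) :=
    hasSum_mul_of_shift (d := fun n => (n : ℂ) * (n + 1) * c (n + 1))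
      (h2.congr_fun fun n => by push_cast; ring) (by simp)
  have s3 : HasSum (fun n : ℕ => ((n : ℂ) - 1) * n * c n * x ^ n)
      (x * (x * deriv (deriv (ordinaryHypergeometric a b 1)) x)) :=
    hasSum_mul_of_shift (d := fun n => ((n : ℂ) - 1) * n * c n)
      (s2.congr_fun fun n => by push_cast; ring) (by simp)
  have s := ((((s2.sub s3).add h1).sub (s1.mul_left (a + b + 1))).sub (h0.mul_left (a * b)))
  have hz : (fun n : ℕ => (n : ℂ) * (n + 1) * c (n + 1) * x ^ n - ((n : ℂ) - 1) * n * c n * x ^ n +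
      (n + 1) * c (n + 1) * x ^ n - (a + b + 1) * (n * c n * x ^ n) - a * b * (c n * x ^ n)) =
      fun _ => 0 := by
    -- Comparing coefficients of xⁿ leaves exactly the two-term recursion.
    funext n
    linear_combination x ^ n * coefficient_succ a b n
  rw [hz] at s
  have := s.unique hasSum_zero
  linear_combination this

/-- A product `A(x) F(φ(x))`, with `F` a hypergeometric function, solves any equation that follows
formally from the hypergeometric equation. -/
lemma Generic.solvesODE {a b : ℂ} (h : Generic a b) {A A1 A2 φ φ1 φ2 p u v : ℂ → ℂ}
    (hA : ∀ᶠ x in 𝓝 0, HasDerivAt A (A1 x) x ∧ HasDerivAt A1 (A2 x) x)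
    (hφ : ∀ᶠ x in 𝓝 0, HasDerivAt φ (φ1 x) x ∧ HasDerivAt φ1 (φ2 x) x) (hφ0 : φ 0 = 0)
    (hode : ∀ᶠ x in 𝓝 0, ∀ f f1 f2 : ℂ,
      φ x * (1 - φ x) * f2 + (1 - (a + b + 1) * φ x) * f1 - a * b * f = 0 →
      x * p x * (A2 x * f + 2 * (A1 x * (f1 * φ1 x)) + A x * (f2 * φ1 x ^ 2 + f1 * φ2 x)) +
        u x * (A1 x * f + A x * (f1 * φ1 x)) + v x * (A x * f) = 0) :
    SolvesODE p u v (fun x => A x * ordinaryHypergeometric a b 1 (φ x)) := by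
  set F : ℂ → ℂ := ordinaryHypergeometric a b 1 with hF
  refine ⟨fun x => A1 x * F (φ x) + A x * (deriv F (φ x) * φ1 x),
    fun x => A2 x * F (φ x) + 2 * (A1 x * (deriv F (φ x) * φ1 x)) +
      A x * (deriv (deriv F) (φ x) * φ1 x ^ 2 + deriv F (φ x) * φ2 x), ?_⟩
  have hball : ∀ᶠ x in 𝓝 0, φ x ∈ Metric.ball (0 : ℂ) 1 := by
    have hc := hφ.self_of_nhds.1.continuousAt
    refine hc.eventually ?_
    rw [hφ0]
    exact Metric.ball_mem_nhds 0 one_pos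
  filter_upwards [hA, hφ, hode, hball] with x ⟨a0, a1⟩ ⟨p0, p1⟩ ho hx
  have f0 := (h.analyticOnNhd _ hx).differentiableAt.hasDerivAt.comp x p0
  have f1 := (h.analyticOnNhd _ hx).deriv.differentiableAt.hasDerivAt.comp x p0
  refine ⟨a0.fun_mul f0, ((a1.fun_mul f0).fun_add (a0.fun_mul (f1.fun_mul p1))).congr_deriv ?_,
    ho _ _ _ (h.ode hx)⟩
  simp only [Function.comp]
  ring

/-! ### The principal square root -/

/-- The principal branch of the square root. -/
def csqrt (z : ℂ) : ℂ := Complex.exp (Complex.log z / 2)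

lemma csqrt_ne_zero (z : ℂ) : csqrt z ≠ 0 := Complex.exp_ne_zero _

lemma csqrt_one : csqrt 1 = 1 := by simp [csqrt]

lemma csqrt_sq {z : ℂ} (hz : z ≠ 0) : csqrt z ^ 2 = z := by
  rw [csqrt, ← Complex.exp_nat_mul]
  push_cast
  rw [mul_div_cancel₀ _ two_ne_zero, Complex.exp_log hz]

lemma csqrt_re_pos {z : ℂ} (hz : z ∈ Complex.slitPlane) : 0 < (csqrt z).re := by
  rw [csqrt, Complex.exp_re]
  refine mul_pos (Real.exp_pos _) (Real.cos_pos_of_mem_Ioo ?_)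
  have h : (Complex.log z / 2).im = z.arg / 2 := by simp [Complex.log_im]
  have h1 := Complex.neg_pi_lt_arg z
  have h2 := lt_of_le_of_ne (Complex.arg_le_pi z) (Complex.mem_slitPlane_iff_arg.1 hz).1
  rw [h]
  constructor <;> linarith

lemma csqrt_sq_of_re_pos {z : ℂ} (hz : 0 < z.re) : csqrt (z ^ 2) = z := by
  have hz0 : z ≠ 0 := by rintro rfl; simp at hz
  have hs : z ^ 2 ∈ Complex.slitPlane := by
    rw [Complex.mem_slitPlane_iff, sq, Complex.mul_re, Complex.mul_im]
    by_cases hi : z.im = 0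
    · left
      rw [hi]
      nlinarith
    · right
      intro h0
      exact hi (by nlinarith)
  rcases sq_eq_sq_iff_eq_or_eq_neg.1 (csqrt_sq (pow_ne_zero 2 hz0)) with h | h
  · exact h
  · have := csqrt_re_pos hs
    rw [h, Complex.neg_re] at this
    linarith

lemma hasDerivAt_csqrt {z : ℂ} (hz : z ∈ Complex.slitPlane) :
    HasDerivAt csqrt (csqrt z / (2 * z)) z := by
  refine ((Complex.hasDerivAt_log hz).div_const 2).cexp.congr_deriv ?_
  rw [csqrt]
  field_simp

lemma eventually_one_sub_mem_slitPlane : ∀ᶠ x : ℂ in 𝓝 0, 1 - x ∈ Complex.slitPlane := by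
  have : ContinuousAt (fun x : ℂ => 1 - x) 0 := by fun_prop
  exact this.eventually (Complex.isOpen_slitPlane.mem_nhds (by simp))

lemma hasDerivAt_inv_csqrt_one_sub {x : ℂ} (hx : 1 - x ∈ Complex.slitPlane) :
    HasDerivAt (fun t => (csqrt (1 - t))⁻¹) ((csqrt (1 - x))⁻¹ / (2 * (1 - x))) x := by
  have h1 : HasDerivAt (fun t : ℂ => 1 - t) (-1) x := (hasDerivAt_id x).const_sub 1
  refine (((hasDerivAt_csqrt hx).comp x h1).fun_inv (csqrt_ne_zero _)).congr_deriv ?_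
  have := csqrt_ne_zero (1 - x)
  have := Complex.slitPlane_ne_zero hx
  simp only [Function.comp]
  field_simp

lemma hasDerivAt_inv_csqrt_one_sub' {x : ℂ} (hx : 1 - x ∈ Complex.slitPlane) :
    HasDerivAt (fun t => (csqrt (1 - t))⁻¹ / (2 * (1 - t)))
      (3 * (csqrt (1 - x))⁻¹ / (4 * (1 - x) ^ 2)) x := by
  have h1 : HasDerivAt (fun t : ℂ => 1 - t) (-1) x := (hasDerivAt_id x).const_sub 1
  have h0 := Complex.slitPlane_ne_zero hx
  refine ((hasDerivAt_inv_csqrt_one_sub hx).fun_div (h1.const_mul 2)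
    (mul_ne_zero two_ne_zero h0)).congr_deriv ?_
  have := csqrt_ne_zero (1 - x)
  field_simp
  ring

/-! ### Quadratic transformations -/

lemma generic_of_re_pos {a b : ℂ} (ha : 0 < a.re) (hb : 0 < b.re) : Generic a b := by
  refine fun n => ⟨fun h => ?_, fun h => ?_⟩ <;>
  · have := congrArg Complex.re h
    simp at this
    linarith [(Nat.cast_nonneg n : (0 : ℝ) ≤ n)]

lemma generic_half : Generic (1 / 2) (1 / 2) := generic_of_re_pos (by norm_num) (by norm_num)

lemma generic_quarter : Generic (1 / 4) (1 / 4) := generic_of_re_pos (by norm_num) (by norm_num)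

lemma generic_three_quarters : Generic (3 / 4) (3 / 4) :=
  generic_of_re_pos (by norm_num) (by norm_num)

lemma Generic.solvesODE_self {a b : ℂ} (h : Generic a b) :
    SolvesODE (fun x => 1 - x) (fun x => 1 - (a + b + 1) * x) (fun _ => -(a * b))
      (ordinaryHypergeometric a b 1) := by
  have := h.solvesODE (A := fun _ => 1) (A1 := fun _ => 0) (A2 := fun _ => 0) (φ := fun x => x)
    (φ1 := fun _ => 1) (φ2 := fun _ => 0) (p := fun x => 1 - x)
    (u := fun x => 1 - (a + b + 1) * x) (v := fun _ => -(a * b))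
    (Eventually.of_forall fun x => ⟨hasDerivAt_const _ _, hasDerivAt_const _ _⟩)
    (Eventually.of_forall fun x => ⟨hasDerivAt_id x, hasDerivAt_const _ _⟩) rfl
    (Eventually.of_forall fun x f f1 f2 hf => by linear_combination hf)
  simpa using this

lemma quadratic_transformation : ∀ᶠ x : ℂ in 𝓝 0,
    ordinaryHypergeometric (1 / 4 : ℂ) (1 / 4) (1 : ℂ) (4 * x * (1 - x)) =
      ordinaryHypergeometric (1 / 2 : ℂ) (1 / 2) (1 : ℂ) x := by
  have h := generic_quarter.solvesODE (A := fun _ => 1) (A1 := fun _ => 0) (A2 := fun _ => 0)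
    (φ := fun x => 4 * x * (1 - x)) (φ1 := fun x => 4 - 8 * x) (φ2 := fun _ => -8)
    (p := fun x => 1 - x) (u := fun x => 1 - (1 / 2 + 1 / 2 + 1) * x)
    (v := fun _ => -(1 / 2 * (1 / 2)))
    (Eventually.of_forall fun x => ⟨hasDerivAt_const _ _, hasDerivAt_const _ _⟩)
    (Eventually.of_forall fun x => ⟨?_, ?_⟩) (by simp)
    (Eventually.of_forall fun x f f1 f2 hf => by linear_combination 4 * hf)
  · have := h.unique generic_half.solvesODE_self (by fun_prop) (by fun_prop) (by fun_prop)
      (by simp) (by simp) (by simp)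
    filter_upwards [this] with x hx
    rw [← hx, one_mul]
  · have h1 := ((hasDerivAt_id x).const_mul 4).fun_mul ((hasDerivAt_id x).const_sub 1)
    refine h1.congr_deriv ?_
    simp
    ring
  · have h1 := ((hasDerivAt_id x).const_mul 8).const_sub 4
    refine h1.congr_deriv (by simp)

lemma eventually_one_add_ne_zero : ∀ᶠ k : ℂ in 𝓝 0, 1 + k ≠ 0 := by
  have : ContinuousAt (fun k : ℂ => 1 + k) 0 := by fun_prop
  exact this.eventually_ne (by simp)

lemma hasDerivAt_pow_inv_one_add {k : ℂ} (hk : 1 + k ≠ 0) (n : ℕ) :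
    HasDerivAt (fun x : ℂ => ((1 + x) ^ n)⁻¹) (-n * ((1 + k) ^ (n + 1))⁻¹) k := by
  have h1 : HasDerivAt (fun x : ℂ => 1 + x) 1 k := (hasDerivAt_id k).const_add 1
  refine ((h1.fun_pow n).fun_inv (pow_ne_zero n hk)).congr_deriv ?_
  rcases n with _ | n
  · simp
  · simp only [Nat.add_sub_cancel]
    field_simp
    ring

/-- F(k²) and F(4k/(1+k)²)/(1+k) solve the same equation in k and agree at k = 0. -/
lemma landen_transformation : ∀ᶠ k : ℂ in 𝓝 0,
    ordinaryHypergeometric (1 / 2 : ℂ) (1 / 2) (1 : ℂ) (4 * k / (1 + k) ^ 2) =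
      (1 + k) * ordinaryHypergeometric (1 / 2 : ℂ) (1 / 2) (1 : ℂ) (k ^ 2) := by
  have h1 := generic_half.solvesODE (A := fun _ => 1) (A1 := fun _ => 0) (A2 := fun _ => 0)
    (φ := fun x => x ^ 2) (φ1 := fun x => 2 * x) (φ2 := fun _ => 2)
    (p := fun k => 1 - k ^ 2) (u := fun k => 1 - 3 * k ^ 2) (v := fun k => -k)
    (Eventually.of_forall fun x => ⟨hasDerivAt_const _ _, hasDerivAt_const _ _⟩)
    (Eventually.of_forall fun x => ⟨by simpa using hasDerivAt_pow 2 x,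
      by simpa using (hasDerivAt_id x).const_mul 2⟩) (by simp)
    (Eventually.of_forall fun x f f1 f2 hf => by linear_combination 4 * x * hf)
  have h2 := generic_half.solvesODE (A := fun k => ((1 + k) ^ 1)⁻¹)
    (A1 := fun k => -(((1 + k) ^ 2)⁻¹)) (A2 := fun k => 2 * ((1 + k) ^ 3)⁻¹)
    (φ := fun k => 4 * k / (1 + k) ^ 2) (φ1 := fun k => 4 * (1 - k) * ((1 + k) ^ 3)⁻¹)
    (φ2 := fun k => (8 * k - 16) * ((1 + k) ^ 4)⁻¹)
    (p := fun k => 1 - k ^ 2) (u := fun k => 1 - 3 * k ^ 2) (v := fun k => -k)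
    ?_ ?_ (by simp) ?_
  · have := h2.unique h1 (by fun_prop) (by fun_prop) (by fun_prop)
      (by simp) (by simp) (by simp)
    filter_upwards [this, eventually_one_add_ne_zero] with k hk hk0
    rw [pow_one, one_mul] at hk
    rw [← hk]
    field_simp
  · filter_upwards [eventually_one_add_ne_zero] with k hk0
    refine ⟨by simpa using hasDerivAt_pow_inv_one_add hk0 1, ?_⟩
    refine (hasDerivAt_pow_inv_one_add hk0 2).fun_neg.congr_deriv (by push_cast; ring)
  · filter_upwards [eventually_one_add_ne_zero] with k hk0
    constructor
    · refine (((hasDerivAt_id k).const_mul 4).fun_mul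
        (hasDerivAt_pow_inv_one_add hk0 2)).congr_deriv ?_
      simp only [id]
      field_simp
      push_cast
      ring
    · refine ((((hasDerivAt_id k).const_sub 1).const_mul 4).fun_mul
        (hasDerivAt_pow_inv_one_add hk0 3)).congr_deriv ?_
      simp only [id]
      field_simp
      push_cast
      ring
  · filter_upwards [eventually_one_add_ne_zero] with k hk0 f f1 f2 hf
    have : (4 * (1 - k) / (1 + k) ^ 2) * (4 * k / (1 + k) ^ 2 * (1 - 4 * k / (1 + k) ^ 2) * f2 +
      (1 - (1 / 2 + 1 / 2 + 1) * (4 * k / (1 + k) ^ 2)) * f1 - 1 / 2 * (1 / 2) * f) = 0 := by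
      rw [hf, mul_zero]
    rw [← this]
    field_simp
    ring

/-- The Koebe map m ↦ -4m/(1-m)² carries the unit disk onto ℂ - [1,∞), so read backwards this
formula continues F(1/4,1/4,1) to the slit plane. -/
lemma koebe_transformation : ∀ᶠ m : ℂ in 𝓝 0,
    (csqrt (1 - m))⁻¹ * ordinaryHypergeometric (1 / 4 : ℂ) (1 / 4) (1 : ℂ) (-4 * m / (1 - m) ^ 2) =
      ordinaryHypergeometric (1 / 2 : ℂ) (1 / 2) (1 : ℂ) m := by
  have h := generic_quarter.solvesODE (A := fun m => (csqrt (1 - m))⁻¹)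
    (A1 := fun m => (csqrt (1 - m))⁻¹ / (2 * (1 - m)))
    (A2 := fun m => 3 * (csqrt (1 - m))⁻¹ / (4 * (1 - m) ^ 2))
    (φ := fun m => -4 * m / (1 - m) ^ 2) (φ1 := fun m => -4 * (1 + m) / (1 - m) ^ 3)
    (φ2 := fun m => (-16 - 8 * m) / (1 - m) ^ 4)
    (p := fun x => 1 - x) (u := fun x => 1 - (1 / 2 + 1 / 2 + 1) * x)
    (v := fun _ => -(1 / 2 * (1 / 2))) ?_ ?_ (by simp) ?_
  · exact h.unique generic_half.solvesODE_self (by fun_prop) (by fun_prop) (by fun_prop)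
      (by simp) (by simp) (by simp [csqrt_one])
  · filter_upwards [eventually_one_sub_mem_slitPlane] with m hm
    exact ⟨hasDerivAt_inv_csqrt_one_sub hm, hasDerivAt_inv_csqrt_one_sub' hm⟩
  · filter_upwards [eventually_one_sub_mem_slitPlane] with m hm
    have h0 := Complex.slitPlane_ne_zero hm
    have h1 : HasDerivAt (fun t : ℂ => 1 - t) (-1) m := (hasDerivAt_id m).const_sub 1
    constructor
    · refine (((hasDerivAt_id m).const_mul (-4)).fun_div (h1.fun_pow 2)
        (pow_ne_zero 2 h0)).congr_deriv ?_
      simp only [id]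
      field_simp
      push_cast
      ring
    · refine ((((hasDerivAt_id m).const_add 1).const_mul (-4)).fun_div (h1.fun_pow 3)
        (pow_ne_zero 3 h0)).congr_deriv ?_
      simp only [id]
      field_simp
      push_cast
      ring
  · filter_upwards [eventually_one_sub_mem_slitPlane] with m hm f f1 f2 hf
    have h0 := Complex.slitPlane_ne_zero hm
    have hs := csqrt_ne_zero (1 - m)
    have : (-4 * (csqrt (1 - m))⁻¹ / (1 - m)) *
      (-4 * m / (1 - m) ^ 2 * (1 - -4 * m / (1 - m) ^ 2) * f2 +
      (1 - (1 / 4 + 1 / 4 + 1) * (-4 * m / (1 - m) ^ 2)) * f1 - 1 / 4 * (1 / 4) * f) = 0 := by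
      rw [hf, mul_zero]
    rw [← this]
    generalize csqrt (1 - m) = s at hs
    field_simp
    ring

lemma euler_transformation : ∀ᶠ x : ℂ in 𝓝 0,
    (csqrt (1 - x))⁻¹ * ordinaryHypergeometric (1 / 4 : ℂ) (1 / 4) (1 : ℂ) x =
      ordinaryHypergeometric (3 / 4 : ℂ) (3 / 4) (1 : ℂ) x := by
  have h := generic_quarter.solvesODE (A := fun m => (csqrt (1 - m))⁻¹)
    (A1 := fun m => (csqrt (1 - m))⁻¹ / (2 * (1 - m)))
    (A2 := fun m => 3 * (csqrt (1 - m))⁻¹ / (4 * (1 - m) ^ 2))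
    (φ := fun m => m) (φ1 := fun _ => 1) (φ2 := fun _ => 0)
    (p := fun x => 1 - x) (u := fun x => 1 - (3 / 4 + 3 / 4 + 1) * x)
    (v := fun _ => -(3 / 4 * (3 / 4))) ?_
    (Eventually.of_forall fun x => ⟨hasDerivAt_id x, hasDerivAt_const _ _⟩) rfl ?_
  · exact h.unique generic_three_quarters.solvesODE_self (by fun_prop) (by fun_prop) (by fun_prop)
      (by simp) (by simp) (by simp [csqrt_one])
  · filter_upwards [eventually_one_sub_mem_slitPlane] with m hm
    exact ⟨hasDerivAt_inv_csqrt_one_sub hm, hasDerivAt_inv_csqrt_one_sub' hm⟩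
  · filter_upwards [eventually_one_sub_mem_slitPlane] with m hm f f1 f2 hf
    have h0 := Complex.slitPlane_ne_zero hm
    have hs := csqrt_ne_zero (1 - m)
    have : (csqrt (1 - m))⁻¹ * (m * (1 - m) * f2 +
      (1 - (1 / 4 + 1 / 4 + 1) * m) * f1 - 1 / 4 * (1 / 4) * f) = 0 := by
      rw [hf, mul_zero]
    refine Eq.trans ?_ this
    generalize csqrt (1 - m) = s at hs
    field_simp
    ring

/-! ### The continuation to the slit plane -/

lemma slitDomain_eq_image : slitDomain = (fun z => 1 - z) '' Complex.slitPlane := by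
  ext z
  rw [mem_slitDomain_iff]
  constructor
  · intro h
    exact ⟨1 - z, h, by ring⟩
  · rintro ⟨w, hw, rfl⟩
    rwa [sub_sub_cancel]

lemma isOpen_slitDomain : IsOpen slitDomain := by
  have : slitDomain = (fun z => 1 - z) ⁻¹' Complex.slitPlane := by
    ext z
    exact mem_slitDomain_iff z
  rw [this]
  exact Complex.isOpen_slitPlane.preimage (by fun_prop)

lemma isPreconnected_slitDomain : IsPreconnected slitDomain := by
  rw [slitDomain_eq_image]
  refine IsPreconnected.image ?_ _ (by fun_prop)
  exact (Complex.starConvex_one_slitPlane.isPathConnected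
    Complex.one_mem_slitPlane).isConnected.isPreconnected

lemma ball_subset_slitDomain : Metric.ball (0 : ℂ) 1 ⊆ slitDomain := by
  intro z hz
  rw [mem_slitDomain_iff, Complex.mem_slitPlane_iff]
  left
  have := (Complex.re_le_norm z).trans_lt (mem_ball_zero_iff.1 hz)
  simp
  linarith

/-- Since `hgSlit` is a choice, its properties require some continuation to exist; agreement near 0
is enough, by the identity theorem on the disk. -/
lemma Generic.hgSlit_spec {a b : ℂ} (h : Generic a b) {f : ℂ → ℂ}
    (hf : DifferentiableOn ℂ f slitDomain)
    (he : ∀ᶠ w in 𝓝 0, f w = ordinaryHypergeometric a b (1 : ℂ) w) :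
    DifferentiableOn ℂ (hgSlit a b 1) slitDomain ∧
      Set.EqOn (hgSlit a b 1) (fun z => ordinaryHypergeometric a b (1 : ℂ) z)
        (Metric.ball 0 1) := by
  refine Classical.epsilon_spec (p := fun f : ℂ → ℂ => DifferentiableOn ℂ f slitDomain ∧
    Set.EqOn f (fun z => ordinaryHypergeometric a b (1 : ℂ) z) (Metric.ball 0 1)) ⟨f, hf, ?_⟩
  exact ((hf.mono ball_subset_slitDomain).analyticOnNhd
    Metric.isOpen_ball).eqOn_of_preconnected_of_eventuallyEq h.analyticOnNhd
    (convex_ball _ _).isPreconnected (Metric.mem_ball_self one_pos) he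

/-- The Koebe coordinate `(√(1-w) - 1) / (√(1-w) + 1)` on the slit plane. -/
def koebe (w : ℂ) : ℂ := (csqrt (1 - w) - 1) / (csqrt (1 - w) + 1)

lemma csqrt_add_one_ne_zero {w : ℂ} (hw : w ∈ slitDomain) : csqrt (1 - w) + 1 ≠ 0 := by
  have := csqrt_re_pos ((mem_slitDomain_iff w).1 hw)
  intro h
  have := congrArg Complex.re h
  simp at this
  linarith

lemma differentiableAt_csqrt_one_sub {w : ℂ} (hw : w ∈ slitDomain) :
    DifferentiableAt ℂ (fun w => csqrt (1 - w)) w :=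
  (hasDerivAt_csqrt ((mem_slitDomain_iff w).1 hw)).differentiableAt.comp
    (f := fun w : ℂ => 1 - w) w (by fun_prop)

lemma differentiableAt_koebe {w : ℂ} (hw : w ∈ slitDomain) : DifferentiableAt ℂ koebe w :=
  ((differentiableAt_csqrt_one_sub hw).sub_const 1).fun_div
    ((differentiableAt_csqrt_one_sub hw).add_const 1) (csqrt_add_one_ne_zero hw)

/-- The Cayley transform sends the right half plane, where the root lies, to the unit disk. -/
lemma norm_koebe_lt_one {w : ℂ} (hw : w ∈ slitDomain) : ‖koebe w‖ < 1 := by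
  have h := csqrt_re_pos ((mem_slitDomain_iff w).1 hw)
  rw [koebe, norm_div, div_lt_one (norm_pos_iff.2 (csqrt_add_one_ne_zero hw)),
    ← sq_lt_sq₀ (norm_nonneg _) (norm_nonneg _), ← Complex.normSq_eq_norm_sq,
    ← Complex.normSq_eq_norm_sq, Complex.normSq_apply, Complex.normSq_apply]
  simp
  nlinarith

lemma koebe_inverse {w : ℂ} (hw : w ∈ slitDomain) : -4 * koebe w / (1 - koebe w) ^ 2 = w := by
  have h1 := csqrt_add_one_ne_zero hw
  have h2 := csqrt_sq (Complex.slitPlane_ne_zero ((mem_slitDomain_iff w).1 hw))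
  have h3 : 1 - koebe w = 2 / (csqrt (1 - w) + 1) := by
    rw [koebe]
    field_simp
    ring
  rw [h3, koebe]
  generalize csqrt (1 - w) = s at *
  field_simp
  linear_combination -4 * h2

lemma koebe_zero : koebe 0 = 0 := by simp [koebe, csqrt_one]

lemma zero_mem_slitDomain : (0 : ℂ) ∈ slitDomain :=
  ball_subset_slitDomain (Metric.mem_ball_self one_pos)

lemma hgSlit_quarter_spec :
    DifferentiableOn ℂ (hgSlit (1 / 4) (1 / 4) 1) slitDomain ∧
      Set.EqOn (hgSlit (1 / 4) (1 / 4) 1)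
        (fun z => ordinaryHypergeometric (1 / 4 : ℂ) (1 / 4) (1 : ℂ) z) (Metric.ball 0 1) := by
  refine generic_quarter.hgSlit_spec (f := fun w => csqrt (1 - koebe w) *
    ordinaryHypergeometric (1 / 2 : ℂ) (1 / 2) (1 : ℂ) (koebe w)) ?_ ?_
  · intro w hw
    have hb : koebe w ∈ Metric.ball (0 : ℂ) 1 := by simpa using norm_koebe_lt_one hw
    refine DifferentiableAt.differentiableWithinAt (DifferentiableAt.mul ?_ ?_)
    · exact (differentiableAt_csqrt_one_sub (ball_subset_slitDomain hb)).comp w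
        (differentiableAt_koebe hw)
    · exact (generic_half.analyticOnNhd _ hb).differentiableAt.comp w (differentiableAt_koebe hw)
  · have hk : Tendsto koebe (𝓝 0) (𝓝 0) := by
      have := (differentiableAt_koebe zero_mem_slitDomain).continuousAt.tendsto
      rwa [koebe_zero] at this
    filter_upwards [hk.eventually koebe_transformation,
      isOpen_slitDomain.mem_nhds zero_mem_slitDomain] with w hw hs
    rw [← hw, koebe_inverse hs, mul_inv_cancel_left₀ (csqrt_ne_zero _)]

lemma differentiableOn_euler :
    DifferentiableOn ℂ (fun w => (csqrt (1 - w))⁻¹ * hgSlit (1 / 4) (1 / 4) 1 w) slitDomain := by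
  intro w hw
  exact (((differentiableAt_csqrt_one_sub hw).inv
    (csqrt_ne_zero _)).differentiableWithinAt).mul (hgSlit_quarter_spec.1 w hw)

lemma hgSlit_three_quarters_spec :
    DifferentiableOn ℂ (hgSlit (3 / 4) (3 / 4) 1) slitDomain ∧
      Set.EqOn (hgSlit (3 / 4) (3 / 4) 1)
        (fun z => ordinaryHypergeometric (3 / 4 : ℂ) (3 / 4) (1 : ℂ) z) (Metric.ball 0 1) := by
  refine generic_three_quarters.hgSlit_spec differentiableOn_euler ?_
  filter_upwards [euler_transformation, Metric.ball_mem_nhds (0 : ℂ) one_pos] with w hw hs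
  rw [← hw, hgSlit_quarter_spec.2 hs]

lemma hgSlit_three_quarters {w : ℂ} (hw : w ∈ slitDomain) :
    hgSlit (3 / 4) (3 / 4) 1 w = (csqrt (1 - w))⁻¹ * hgSlit (1 / 4) (1 / 4) 1 w := by
  refine (hgSlit_three_quarters_spec.1.analyticOnNhd
    isOpen_slitDomain).eqOn_of_preconnected_of_eventuallyEq
    (differentiableOn_euler.analyticOnNhd isOpen_slitDomain) isPreconnected_slitDomain
    zero_mem_slitDomain ?_ hw
  filter_upwards [euler_transformation, Metric.ball_mem_nhds (0 : ℂ) one_pos] with w hw hs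
  rw [hgSlit_quarter_spec.2 hs, hgSlit_three_quarters_spec.2 hs]
  exact hw.symm

/-! ### The hypergeometric function composed with `ζ` -/

lemma exists_of_eventually_im {P : ℂ → Prop} (h : ∀ᶠ τ in comap Complex.im atTop, P τ) :
    ∃ Y : ℝ, 0 < Y ∧ ∀ τ : ℂ, Y ≤ τ.im → P τ := by
  rw [eventually_comap] at h
  obtain ⟨Y, hY⟩ := eventually_atTop.1 h
  exact ⟨max Y 1, by positivity, fun τ hτ => hY τ.im ((le_max_left _ _).trans hτ) τ rfl⟩

/-- Landen's transformation and ϑ₀₀(τ)² = (1+k)ϑ₀₀(2τ)² supply the same factor 1 + k, so F(λ)/ϑ₀₀²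
is invariant under doubling and equals its limit 1. -/
lemma hypergeometric_lam : ∀ᶠ τ in comap Complex.im atTop,
    ordinaryHypergeometric (1 / 2 : ℂ) (1 / 2) (1 : ℂ) (lam τ) = theta 0 0 τ ^ 2 := by
  -- Landen's formula is known only for small k, that is above some height Y; doubling τ stays above
  -- it.
  obtain ⟨Y, hY, hL⟩ := exists_of_eventually_im (tendsto_modulus.eventually landen_transformation)
  have hlim : Tendsto (fun τ => ordinaryHypergeometric (1 / 2 : ℂ) (1 / 2) (1 : ℂ) (lam τ) /
      theta 0 0 τ ^ 2) (comap Complex.im atTop) (𝓝 (1 / 1 ^ 2)) := by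
    have hc := ((generic_half.analyticOnNhd 0 (Metric.mem_ball_self one_pos)).continuousAt.tendsto)
    rw [ordinaryHypergeometric_zero] at hc
    exact (hc.comp tendsto_lam).div (tendsto_theta00.pow 2) (by norm_num)
  filter_upwards [tendsto_comap.eventually (eventually_ge_atTop Y)] with τ hτ
  have hτ0 : 0 < τ.im := hY.trans_le hτ
  have key := eq_of_two_mul_invariant hlim hτ0 fun n => ?_
  · rw [one_pow, div_one, div_eq_one_iff_eq (pow_ne_zero 2 (theta00_ne_zero hτ0))] at key
    exact key
  · set t := 2 ^ n * τ with ht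
    have ht0 : 0 < t.im := im_two_pow_mul_pos hτ0 n
    have htY : Y ≤ t.im := by
      have : t.im = 2 ^ n * τ.im := by
        rw [ht, show ((2 : ℂ) ^ n) = ((2 ^ n : ℝ) : ℂ) by push_cast; rfl, Complex.im_ofReal_mul]
      rw [this]
      nlinarith [one_le_pow₀ (M₀ := ℝ) one_le_two (n := n)]
    rw [lam_eq_modulus ht0, hL t htY, theta00_sq_eq_modulus ht0, modulus_sq,
      mul_div_mul_left _ _ (one_add_modulus_ne_zero ht0)]

lemma hypergeometric_zetaC : ∀ᶠ τ in comap Complex.im atTop,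
    ordinaryHypergeometric (1 / 4 : ℂ) (1 / 4) (1 : ℂ) (zetaC τ) = theta 0 0 τ ^ 2 := by
  filter_upwards [hypergeometric_lam, tendsto_lam.eventually quadratic_transformation,
    eventually_im_pos] with τ h1 h2 h3
  rw [zetaC_eq h3, h2, h1]

lemma differentiableAt_hgSlit_zetaC {τ : ℂ} (hτ : 0 < τ.im) (h : zetaC τ ∈ slitDomain) :
    DifferentiableAt ℂ (fun t => hgSlit (1 / 4) (1 / 4) 1 (zetaC t)) τ :=
  ((hgSlit_quarter_spec.1 _ h).differentiableAt (isOpen_slitDomain.mem_nhds h)).comp τ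
    (differentiableAt_zetaC hτ)

lemma differentiableAt_theta00_sq {τ : ℂ} (hτ : 0 < τ.im) :
    DifferentiableAt ℂ (fun t => theta 0 0 t ^ 2) τ := (differentiableAt_theta00 hτ).fun_pow 2

/-- Both sides are holomorphic on the connected interior and agree near i∞. -/
lemma hgSlit_quarter_zetaC {τ : ℂ} (hτ : τ ∈ innerD) :
    hgSlit (1 / 4) (1 / 4) 1 (zetaC τ) = theta 0 0 τ ^ 2 := by
  have h1 : DifferentiableOn ℂ (fun t => hgSlit (1 / 4) (1 / 4) 1 (zetaC t)) innerD := fun t ht =>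
    (differentiableAt_hgSlit_zetaC ht.1 (zetaC_mem_slitDomain ht.1
      (re_lam_lt_half_of_mem_innerD ht))).differentiableWithinAt
  have h2 : DifferentiableOn ℂ (fun t => theta 0 0 t ^ 2) innerD := fun t ht =>
    (differentiableAt_theta00_sq ht.1).differentiableWithinAt
  obtain ⟨Y, hY, hF⟩ := exists_of_eventually_im (hypergeometric_zetaC.and
    (tendsto_zetaC.eventually (Metric.ball_mem_nhds 0 one_pos)))
  have hmem := mem_innerD_of_large (y := Y + 2) (by linarith)
  refine (h1.analyticOnNhd isOpen_innerD).eqOn_of_preconnected_of_eventuallyEq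
    (h2.analyticOnNhd isOpen_innerD) isPreconnected_innerD hmem ?_ hτ
  have ho : ∀ᶠ t : ℂ in 𝓝 ((Y + 2 : ℝ) * Complex.I), Y < t.im :=
    Complex.continuous_im.continuousAt.eventually (lt_mem_nhds (by simp))
  filter_upwards [ho] with t ht
  obtain ⟨e1, e2⟩ := hF t ht.le
  rw [hgSlit_quarter_spec.2 e2, ← e1]

/-- The region where the principal branch of the hypergeometric function is attained. -/
def mainRegion : Set ℂ := {τ | 0 < τ.im ∧ -1 < τ.re ∧ τ.re ≤ 1 ∧ 1 < ‖τ‖}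

lemma re_lam_lt_half_of_mem_mainRegion {τ : ℂ} (hτ : τ ∈ mainRegion) : (lam τ).re < 1 / 2 := by
  obtain ⟨h1, h2, h3, h4⟩ := hτ
  rcases h3.lt_or_eq with h | h
  · exact re_lam_lt_half_of_mem_innerD ⟨h1, h2, h, h4⟩
  · exact re_lam_lt_half_of_re_eq_one h1 h

lemma zetaC_mem_slitDomain_of_mem {τ : ℂ} (hτ : τ ∈ mainRegion) : zetaC τ ∈ slitDomain :=
  zetaC_mem_slitDomain hτ.1 (re_lam_lt_half_of_mem_mainRegion hτ)

lemma analyticAt_of_im_pos {f : ℂ → ℂ} (hf : ∀ t : ℂ, 0 < t.im → DifferentiableAt ℂ f t) {τ : ℂ}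
    (hτ : 0 < τ.im) : AnalyticAt ℂ f τ :=
  Complex.analyticAt_iff_eventually_differentiableAt.2 ((eventually_im_pos_nhds hτ).mono hf)

/-- Extends the identity across the side Re τ = 1, where ζ is still off the cut: the points τ - s
with small s > 0 are interior, and isolation of zeros does the rest. -/
lemma eventually_hgSlit_quarter_zetaC {τ : ℂ} (hτ : τ ∈ mainRegion) :
    ∀ᶠ t in 𝓝 τ, hgSlit (1 / 4) (1 / 4) 1 (zetaC t) = theta 0 0 t ^ 2 := by
  obtain ⟨h1, h2, h3, h4⟩ := id hτ
  have hz := zetaC_mem_slitDomain_of_mem hτ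
  have ha1 : AnalyticAt ℂ (fun t => hgSlit (1 / 4) (1 / 4) 1 (zetaC t)) τ :=
    ((hgSlit_quarter_spec.1.analyticOnNhd isOpen_slitDomain) _ hz).comp
      (analyticAt_of_im_pos (fun _ => differentiableAt_zetaC) h1)
  have ha2 : AnalyticAt ℂ (fun t => theta 0 0 t ^ 2) τ :=
    analyticAt_of_im_pos (fun _ => differentiableAt_theta00_sq) h1
  refine (ha1.frequently_eq_iff_eventually_eq ha2).1 ?_
  have hc : Tendsto (fun s : ℝ => τ - s) (𝓝[>] 0) (𝓝[≠] τ) := by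
    refine tendsto_nhdsWithin_iff.2 ⟨?_, ?_⟩
    · have : ContinuousAt (fun s : ℝ => τ - (s : ℂ)) 0 := by fun_prop
      have := this.tendsto.mono_left (nhdsWithin_le_nhds (s := Set.Ioi 0))
      simpa using this
    · filter_upwards [self_mem_nhdsWithin] with s hs
      have : (s : ℂ) ≠ 0 := Complex.ofReal_ne_zero.2 (ne_of_gt hs)
      simpa using this
  refine hc.frequently (Eventually.frequently ?_)
  have e1 : ∀ᶠ s : ℝ in 𝓝 0, -1 < (τ - s).re ∧ 1 < ‖τ - s‖ := by
    have c1 : ContinuousAt (fun s : ℝ => (τ - (s : ℂ)).re) 0 := by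
      simp only [Complex.sub_re, Complex.ofReal_re]; fun_prop
    have c2 : ContinuousAt (fun s : ℝ => ‖τ - (s : ℂ)‖) 0 := by fun_prop
    exact (c1.eventually (lt_mem_nhds (by simpa using h2))).and
      (c2.eventually (lt_mem_nhds (by simpa using h4)))
  filter_upwards [e1.filter_mono nhdsWithin_le_nhds, self_mem_nhdsWithin] with s hs hs0
  refine hgSlit_quarter_zetaC ⟨by simpa using h1, hs.1, ?_, hs.2⟩
  have : 0 < s := hs0
  simp
  linarith

/-- The modular form `ϑ₀₀⁶ / (ϑ₀₁⁴ - ϑ₁₀⁴)`. -/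
def thetaQuot (τ : ℂ) : ℂ := theta 0 0 τ ^ 6 / (theta 0 1 τ ^ 4 - theta 1 0 τ ^ 4)

lemma thetaQuot_eq {τ : ℂ} (hτ : 0 < τ.im) :
    thetaQuot τ = (1 - 2 * lam τ)⁻¹ * theta 0 0 τ ^ 2 := by
  have h := theta00_ne_zero hτ
  rw [one_sub_two_mul_lam hτ, thetaQuot, inv_div]
  rw [div_mul_eq_mul_div]
  ring

lemma hgSlit_three_quarters_zetaC {τ : ℂ} (hτ : 0 < τ.im) (hre : (lam τ).re < 1 / 2)
    (h : hgSlit (1 / 4) (1 / 4) 1 (zetaC τ) = theta 0 0 τ ^ 2) :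
    hgSlit (3 / 4) (3 / 4) 1 (zetaC τ) = thetaQuot τ := by
  rw [hgSlit_three_quarters (zetaC_mem_slitDomain hτ hre), h, thetaQuot_eq hτ,
    zetaC_eq_one_sub_sq hτ, sub_sub_cancel, csqrt_sq_of_re_pos]
  simp
  linarith

lemma eventually_hgSlit_three_quarters_zetaC {τ : ℂ} (hτ : τ ∈ mainRegion) :
    ∀ᶠ t in 𝓝 τ, hgSlit (3 / 4) (3 / 4) 1 (zetaC t) = thetaQuot t := by
  have hre : ∀ᶠ t in 𝓝 τ, (lam t).re < 1 / 2 :=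
    (Complex.continuous_re.continuousAt.comp (differentiableAt_lam hτ.1).continuousAt).eventually
      (gt_mem_nhds (re_lam_lt_half_of_mem_mainRegion hτ))
  filter_upwards [hre, eventually_hgSlit_quarter_zetaC hτ, eventually_im_pos_nhds hτ.1] with t a b c
  exact hgSlit_three_quarters_zetaC c a b

lemma differentiableAt_thetaQuot {τ : ℂ} (hτ : 0 < τ.im) (h : zetaC τ ≠ 1) :
    DifferentiableAt ℂ thetaQuot τ := by
  have h1 : theta 0 1 τ ^ 4 - theta 1 0 τ ^ 4 ≠ 0 := by
    intro h0
    apply h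
    rw [zetaC_eq_one_iff hτ, one_sub_two_mul_lam hτ, h0, zero_div]
  exact ((differentiableAt_theta00 hτ).pow 6).fun_div (((differentiableAt_theta01 hτ).pow 4).sub
    ((differentiableAt_theta10 hτ).pow 4)) h1

/-! ### Analytic continuation along paths -/

/-- The parameters at which the germs agree form a nonempty clopen subset of the interval;
closedness uses the identity theorem on a small disk. -/
lemma IsAnalyticContinuationAlong.unique {ρ : unitInterval → ℂ} (hρ : Continuous ρ)
    {Φ Ψ : unitInterval → ℂ → ℂ} (hΦ : IsAnalyticContinuationAlong ρ Φ)
    (hΨ : IsAnalyticContinuationAlong ρ Ψ) (h0 : Φ 0 =ᶠ[𝓝 (ρ 0)] Ψ 0) (t : unitInterval) :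
    Φ t =ᶠ[𝓝 (ρ t)] Ψ t := by
  set S : Set unitInterval := {t | Φ t =ᶠ[𝓝 (ρ t)] Ψ t} with hS
  have hopen : IsOpen S := by
    rw [isOpen_iff_mem_nhds]
    intro t ht
    filter_upwards [hΦ.compatible t, hΨ.compatible t,
      hρ.continuousAt.eventually ht.eventually_nhds] with s a b c
    exact (a.trans c).trans b.symm
  have hclosed : IsClosed S := by
    refine isClosed_of_closure_subset fun t ht => ?_
    obtain ⟨r, hr, hr'⟩ := Metric.eventually_nhds_iff_ball.1
      ((hΦ.analyticAt t).eventually_analyticAt.and (hΨ.analyticAt t).eventually_analyticAt)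
    have hev := ((hΦ.compatible t).and (hΨ.compatible t)).and
      (hρ.continuousAt.eventually (Metric.ball_mem_nhds (ρ t) hr))
    obtain ⟨s, hs, ⟨a, b⟩, c⟩ := ((mem_closure_iff_frequently.1 ht).and_eventually hev).exists
    have he : Φ t =ᶠ[𝓝 (ρ s)] Ψ t := (a.symm.trans hs).trans b
    have := AnalyticOnNhd.eqOn_of_preconnected_of_eventuallyEq (fun z hz => (hr' z hz).1)
      (fun z hz => (hr' z hz).2) (convex_ball (ρ t) r).isPreconnected c he
    exact this.eventuallyEq_of_mem (Metric.ball_mem_nhds _ hr)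
  have : S = Set.univ := IsClopen.eq_univ ⟨hclosed, hopen⟩ ⟨0, h0⟩
  have ht : t ∈ S := this ▸ Set.mem_univ t
  exact ht

lemma nhdsWithin_upper_neBot {z : ℂ} (hz : z.im = 0) : (𝓝[{w : ℂ | 0 < w.im}] z).NeBot := by
  rw [← mem_closure_iff_nhdsWithin_neBot, Complex.closure_setOfPred_lt_im]
  exact hz.ge

lemma IsHGContinuation.unique {a b c : ℂ} {ρ : unitInterval → ℂ} (hρ : Continuous ρ)
    {Φ Ψ : unitInterval → ℂ → ℂ} (hΦ : IsHGContinuation a b c ρ Φ)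
    (hΨ : IsHGContinuation a b c ρ Ψ) : Φ 1 (ρ 1) = Ψ 1 (ρ 1) := by
  refine (hΦ.continuation.unique hρ hΨ.continuation ?_ 1).eq_of_nhds
  by_cases h : ρ 0 ∈ slitDomain
  · exact (hΦ.start h).trans (hΨ.start h).symm
  · refine ((hΦ.continuation.analyticAt 0).frequently_eq_iff_eventually_eq
      (hΨ.continuation.analyticAt 0)).1 ?_
    have him : (ρ 0).im = 0 := (not_not.1 h).1
    have := nhdsWithin_upper_neBot him
    -- Equality on the upper side of the cut already determines an analytic germ; those points
    -- differ from the starting point, which is real.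
    refine ((hΦ.start_cut h).trans (hΨ.start_cut h).symm).frequently.filter_mono ?_
    refine nhdsWithin_mono _ fun w hw hw' => ?_
    have hw0 : 0 < w.im := hw
    rw [hw', him] at hw0
    exact lt_irrefl _ hw0

lemma exists_local_branch {Z Θ : ℂ → ℂ} {τ : ℂ} (hZ : AnalyticAt ℂ Z τ) (hd : deriv Z τ ≠ 0)
    (hΘ : AnalyticAt ℂ Θ τ) : ∃ φ, AnalyticAt ℂ φ (Z τ) ∧ ∀ᶠ t in 𝓝 τ, φ (Z t) = Θ t := by
  have hinv := hZ.hasStrictDerivAt.eventually_left_inverse hd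
  refine ⟨Θ ∘ hZ.hasStrictDerivAt.localInverse _ _ _ hd, ?_, ?_⟩
  · refine AnalyticAt.comp ?_ (hZ.analyticAt_localInverse hd)
    rwa [hinv.self_of_nhds]
  · filter_upwards [hinv] with t ht
    simp only [Function.comp, ht]

lemma map_nhds_of_deriv_ne_zero {Z : ℂ → ℂ} {τ : ℂ} (hZ : AnalyticAt ℂ Z τ)
    (hd : deriv Z τ ≠ 0) : map Z (𝓝 τ) = 𝓝 (Z τ) := hZ.hasStrictDerivAt.map_nhds_eq hd

/-- A limit in the variable Z(t) can be computed in t when Z maps neighbourhoods onto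
neighbourhoods. It serves for the boundary values of F, with Z = ζ or Z = λ. -/
lemma tendsto_nhdsWithin_of_map {Z f g : ℂ → ℂ} {τ : ℂ} {S : Set ℂ}
    (hZ : map Z (𝓝 τ) = 𝓝 (Z τ)) (h : ∀ᶠ t in 𝓝 τ, Z t ∈ S → f (Z t) = g t)
    (hg : ContinuousAt g τ) : Tendsto f (𝓝[S] (Z τ)) (𝓝 (g τ)) := by
  intro V hV
  rw [mem_map, mem_nhdsWithin_iff_eventually, ← hZ, eventually_map]
  filter_upwards [h, hg.eventually hV] with t h1 h2 h3
  rw [Set.mem_preimage, h1 h3]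
  exact h2

lemma analyticAt_zetaC {τ : ℂ} (hτ : 0 < τ.im) : AnalyticAt ℂ zetaC τ :=
  analyticAt_of_im_pos (fun _ => differentiableAt_zetaC) hτ

lemma analyticAt_lam {τ : ℂ} (hτ : 0 < τ.im) : AnalyticAt ℂ lam τ :=
  analyticAt_of_im_pos (fun _ => differentiableAt_lam) hτ

lemma eventually_zetaC_ne_one {τ : ℂ} (hτ : 0 < τ.im) (h : zetaC τ ≠ 1) :
    ∀ᶠ t in 𝓝 τ, zetaC t ≠ 1 :=
  (differentiableAt_zetaC hτ).continuousAt.eventually_ne h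

/-! ### Boundary values on the cut -/

/-- Inside the circle, -1/t lies in the region, so Re λ(t) = 1 - Re λ(-1/t) > 1/2; on the circle Re
λ = 1/2. Only points outside remain. -/
lemma eventually_mem_innerD_of_re_lam {τ : ℂ} (hτ : 0 < τ.im) (hn : ‖τ‖ = 1) :
    ∀ᶠ t in 𝓝 τ, (lam t).re < 1 / 2 → t ∈ innerD := by
  have hτ0 := ne_zero_of_im_pos hτ
  have hsq : τ.re ^ 2 + τ.im ^ 2 = 1 := by
    have := Complex.normSq_eq_norm_sq τ
    rw [hn, Complex.normSq_apply] at this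
    nlinarith
  have hre : τ.re ∈ Set.Ioo (-1 : ℝ) 1 := by
    constructor <;> nlinarith
  have hre' : (-1 / τ).re ∈ Set.Ioo (-1 : ℝ) 1 := by
    rw [neg_inv_eq_of_norm_eq_one hn]
    simp only [Complex.neg_re, Complex.conj_re, Set.mem_Ioo]
    constructor <;> linarith [hre.1, hre.2]
  have hc : ContinuousAt (fun t : ℂ => (-1 / t).re) τ :=
    Complex.continuous_re.continuousAt.comp (continuousAt_const.div continuousAt_id hτ0)
  filter_upwards [eventually_im_pos_nhds hτ, Complex.continuous_re.continuousAt.eventually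
    (isOpen_Ioo.mem_nhds hre), hc.eventually (isOpen_Ioo.mem_nhds hre')] with t h1 h2 h3 h4
  refine ⟨h1, h2.1, h2.2, ?_⟩
  by_contra hle
  rcases (not_lt.1 hle).lt_or_eq with hlt | heq
  · have hmem : -1 / t ∈ innerD := by
      refine ⟨im_neg_inv_pos h1, h3.1, h3.2, ?_⟩
      rw [norm_div, norm_neg, norm_one, one_lt_div (norm_pos_iff.2 (ne_zero_of_im_pos h1))]
      exact hlt
    have := re_lam_lt_half_of_mem_innerD hmem
    rw [lam_neg_inv h1] at this
    simp at this
    linarith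
  · rw [re_lam_of_norm_eq_one h1 heq] at h4
    exact lt_irrefl _ h4

lemma im_zetaC {τ : ℂ} (hτ : 0 < τ.im) :
    (zetaC τ).im = 4 * (1 - 2 * (lam τ).re) * (lam τ).im := by
  rw [zetaC_eq_one_sub_sq hτ, sq]
  simp
  ring

/-- Im ζ = 4(1 - 2 Re λ) Im λ with Im λ > 0 near the arc, so Im ζ > 0 forces Re λ < 1/2. Thus the
upper side of the cut corresponds to the region itself. -/
lemma eventually_mem_innerD_of_im_zetaC {τ : ℂ} (hτ : 0 < τ.im) (hn : ‖τ‖ = 1) (hre : 0 < τ.re) :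
    ∀ᶠ t in 𝓝 τ, 0 < (zetaC t).im → t ∈ innerD := by
  have hpos : ∀ᶠ t in 𝓝 τ, 0 < (lam t).im :=
    (Complex.continuous_im.continuousAt.comp (differentiableAt_lam hτ).continuousAt).eventually
      (lt_mem_nhds (im_lam_pos_of_norm_eq_one hτ hn hre))
  filter_upwards [eventually_mem_innerD_of_re_lam hτ hn, hpos, eventually_im_pos_nhds hτ]
    with t h1 h2 h3 h4
  refine h1 ?_
  rw [im_zetaC h3] at h4
  have := pos_of_mul_pos_left h4 h2.le
  linarith

lemma zetaC_of_norm_eq_one {τ : ℂ} (hτ : 0 < τ.im) (hn : ‖τ‖ = 1) :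
    zetaC τ = ((1 + 4 * (lam τ).im ^ 2 : ℝ) : ℂ) := by
  have h := re_lam_of_norm_eq_one hτ hn
  have e : lam τ = 1 / 2 + (lam τ).im * Complex.I := by
    apply Complex.ext <;> simp
    rw [h]
    norm_num
  rw [zetaC_eq_one_sub_sq hτ]
  generalize (lam τ).im = y at e
  rw [e]
  push_cast
  linear_combination (-4 * (y : ℂ) ^ 2) * Complex.I_sq

lemma zetaC_notMem_slitDomain {τ : ℂ} (hτ : 0 < τ.im) (hn : ‖τ‖ = 1) :
    zetaC τ ∉ slitDomain := by
  rw [zetaC_of_norm_eq_one hτ hn]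
  refine fun h => h ⟨Complex.ofReal_im _, ?_⟩
  rw [Complex.ofReal_re]
  nlinarith [sq_nonneg (lam τ).im]

lemma zetaC_ne_one_of_norm_eq_one {τ : ℂ} (hτ : 0 < τ.im) (hn : ‖τ‖ = 1) (hre : 0 < τ.re) :
    zetaC τ ≠ 1 := by
  rw [zetaC_of_norm_eq_one hτ hn]
  have := im_lam_pos_of_norm_eq_one hτ hn hre
  intro h
  have h2 : 1 + 4 * (lam τ).im ^ 2 = 1 := by exact_mod_cast h
  have : 0 < (lam τ).im ^ 2 := by positivity
  linarith

lemma hg_of_mem {a b c z : ℂ} (hz : z ∈ slitDomain) : hg a b c z = hgSlit a b c z := by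
  rw [hg, if_pos hz]

lemma mem_slitDomain_of_im_pos {z : ℂ} (hz : 0 < z.im) : z ∈ slitDomain :=
  fun h => hz.ne' h.1

/-- The function `Θ` on the upper half plane is obtained from the principal branch of
`F(a,b,c; ζ)`. -/
structure IsUniformization (a b c : ℂ) (Θ : ℂ → ℂ) : Prop where
  differentiableAt : ∀ {τ : ℂ}, 0 < τ.im → zetaC τ ≠ 1 → DifferentiableAt ℂ Θ τ
  eventually_eq : ∀ {τ : ℂ}, τ ∈ mainRegion → ∀ᶠ t in 𝓝 τ, hgSlit a b c (zetaC t) = Θ t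

namespace IsUniformization

variable {a b c : ℂ} {Θ : ℂ → ℂ}

lemma analyticAt (h : IsUniformization a b c Θ) {τ : ℂ} (hτ : 0 < τ.im) (hz : zetaC τ ≠ 1) :
    AnalyticAt ℂ Θ τ :=
  Complex.analyticAt_iff_eventually_differentiableAt.2
    (((eventually_im_pos_nhds hτ).and (eventually_zetaC_ne_one hτ hz)).mono
      fun _ ht => h.differentiableAt ht.1 ht.2)

lemma hgSlit_of_mem_innerD (h : IsUniformization a b c Θ) {τ : ℂ} (hτ : τ ∈ innerD) :
    hgSlit a b c (zetaC τ) = Θ τ :=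
  (h.eventually_eq (τ := τ) ⟨hτ.1, hτ.2.1, hτ.2.2.1.le, hτ.2.2.2⟩).self_of_nhds

lemma hg_of_mem_mainRegion (h : IsUniformization a b c Θ) {τ : ℂ} (hτ : τ ∈ mainRegion) :
    hg a b c (zetaC τ) = Θ τ := by
  rw [hg_of_mem (zetaC_mem_slitDomain_of_mem hτ)]
  exact (h.eventually_eq hτ).self_of_nhds

lemma hg_of_norm_eq_one (h : IsUniformization a b c Θ) {τ : ℂ} (hτ : 0 < τ.im) (hn : ‖τ‖ = 1)
    (hre : 0 < τ.re) : hg a b c (zetaC τ) = Θ τ := by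
  have h1 := zetaC_ne_one_of_norm_eq_one hτ hn hre
  rw [hg, if_neg (zetaC_notMem_slitDomain hτ hn), if_neg h1]
  have him : (zetaC τ).im = 0 := by
    rw [zetaC_of_norm_eq_one hτ hn, Complex.ofReal_im]
  have := nhdsWithin_upper_neBot him
  refine Tendsto.limUnder_eq ?_
  refine tendsto_nhdsWithin_of_map
    (map_nhds_of_deriv_ne_zero (analyticAt_zetaC hτ) (deriv_zetaC_ne_zero hτ h1)) ?_
    (h.differentiableAt hτ h1).continuousAt
  filter_upwards [eventually_mem_innerD_of_im_zetaC hτ hn hre] with t ht hz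
  exact h.hgSlit_of_mem_innerD (ht hz)

lemma hgContinuesTo (h : IsUniformization a b c Θ) {τ τ₀ : UpperHalfPlane}
    (hτ₀ : (τ₀ : ℂ) ∈ mainRegion ∨ ‖(τ₀ : ℂ)‖ = 1 ∧ 0 < τ₀.re) (γ : Path τ₀ τ)
    (hγ : ∀ t, zeta (γ t) ≠ 1) :
    HGContinuesTo a b c (fun t => zeta (γ t)) (Θ τ) := by
  have hpos (t : unitInterval) : 0 < (γ t : ℂ).im := (γ t).im_pos
  have hcoe : Continuous fun t => (γ t : ℂ) := UpperHalfPlane.continuous_coe.comp γ.continuous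
  have hz (t : unitInterval) : AnalyticAt ℂ zetaC (γ t) := analyticAt_zetaC (hpos t)
  have hmap (t : unitInterval) : map zetaC (𝓝 (γ t : ℂ)) = 𝓝 (zetaC (γ t)) :=
    map_nhds_of_deriv_ne_zero (hz t) (deriv_zetaC_ne_zero (hpos t) (hγ t))
  have hρ : Continuous fun t => zeta (γ t) := by
    rw [continuous_iff_continuousAt]
    intro t
    exact (hz t).continuousAt.comp (f := fun t => (γ t : ℂ)) hcoe.continuousAt
  -- The germ at time t is Θ composed with a local inverse of ζ at γ(t).
  choose Φ hΦa hΦ using fun t : unitInterval => exists_local_branch (hz t)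
    (deriv_zetaC_ne_zero (hpos t) (hγ t)) (h.analyticAt (hpos t) (hγ t))
  have hΦc : IsHGContinuation a b c (fun t => zeta (γ t)) Φ := by
    refine ⟨⟨hΦa, fun t => ?_⟩, fun hs => ?_, fun hs => ?_⟩
    · filter_upwards [hcoe.continuousAt.eventually (hΦ t).eventually_nhds] with s hs
      simp only [zeta_eq_zetaC]
      -- Germs at ζ(γ(s)) are compared after pulling back by ζ, where both become Θ.
      rw [EventuallyEq, ← hmap s, eventually_map]
      filter_upwards [hs, hΦ s] with z h1 h2
      rw [h1, h2]
    · simp only [zeta_eq_zetaC, γ.source] at hs ⊢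
      rcases hτ₀ with hm | ⟨hn, -⟩
      · have hm0 := hmap 0
        have hΦ0 := hΦ 0
        rw [γ.source] at hm0 hΦ0
        rw [EventuallyEq, ← hm0, eventually_map]
        filter_upwards [hΦ0, h.eventually_eq hm, (analyticAt_zetaC hm.1).continuousAt.eventually
          (isOpen_slitDomain.mem_nhds hs)] with z h1 h2 h3
        rw [h1, hg_of_mem h3, h2]
      · exact absurd hs (zetaC_notMem_slitDomain τ₀.im_pos hn)
    · simp only [zeta_eq_zetaC, γ.source] at hs ⊢
      rcases hτ₀ with hm | ⟨hn, hre⟩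
      · exact absurd (zetaC_mem_slitDomain_of_mem hm) hs
      · have hm0 := hmap 0
        have hΦ0 := hΦ 0
        rw [γ.source] at hm0 hΦ0
        rw [EventuallyEq, eventually_nhdsWithin_iff, ← hm0, eventually_map]
        filter_upwards [hΦ0, eventually_mem_innerD_of_im_zetaC τ₀.im_pos hn hre] with z h1 h2 h3
        rw [h1, hg_of_mem (mem_slitDomain_of_im_pos h3), h.hgSlit_of_mem_innerD (h2 h3)]
  refine ⟨⟨Φ, hΦc⟩, fun Ψ hΨ => ?_⟩
  rw [hΨ.unique hρ hΦc]
  have := (hΦ 1).self_of_nhds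
  rw [γ.target] at this
  simp only [zeta_eq_zetaC, γ.target]
  exact this

end IsUniformization

lemma isUniformization_quarter : IsUniformization (1 / 4) (1 / 4) 1 (fun t => theta 0 0 t ^ 2) :=
  ⟨fun hτ _ => differentiableAt_theta00_sq hτ, eventually_hgSlit_quarter_zetaC⟩

lemma isUniformization_three_quarters : IsUniformization (3 / 4) (3 / 4) 1 thetaQuot :=
  ⟨differentiableAt_thetaQuot, eventually_hgSlit_three_quarters_zetaC⟩

/-! ### The value at `ζ = 1` -/

lemma norm_csqrt {z : ℂ} (hz : z ≠ 0) : ‖csqrt z‖ = √‖z‖ := by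
  rw [eq_comm, Real.sqrt_eq_iff_eq_sq (norm_nonneg _) (norm_nonneg _), ← norm_pow, csqrt_sq hz]

lemma zetaC_I : zetaC Complex.I = 1 := by
  rw [zetaC_eq_one_iff (by simp), lam_I]
  norm_num

/-- ζ ramifies at i, but λ does not. The limit is therefore taken in the coordinate u = λ with w =
4u(1-u), choosing the root u = (1-√(1-w))/2, for which Re u < 1/2. -/
lemma hg_quarter_one : hg (1 / 4) (1 / 4) 1 1 = theta 0 0 Complex.I ^ 2 := by
  have hI : 0 < Complex.I.im := by simp
  have h1 : (1 : ℂ) ∉ slitDomain := fun h => h ⟨by simp, by simp⟩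
  rw [hg, if_neg h1, if_pos rfl]
  have hne : (𝓝[Metric.ball 0 1] (1 : ℂ)).NeBot := by
    rw [← mem_closure_iff_nhdsWithin_neBot, closure_ball _ one_ne_zero]
    simp
  refine Tendsto.limUnder_eq ?_
  have key : Tendsto (fun u => hgSlit (1 / 4) (1 / 4) 1 (4 * u * (1 - u)))
      (𝓝[{u : ℂ | u.re < 1 / 2}] (lam Complex.I)) (𝓝 (theta 0 0 Complex.I ^ 2)) := by
    refine tendsto_nhdsWithin_of_map (g := fun t => theta 0 0 t ^ 2)
      (map_nhds_of_deriv_ne_zero (analyticAt_lam hI) (deriv_lam_ne_zero hI)) ?_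
      (differentiableAt_theta00_sq hI).continuousAt
    filter_upwards [eventually_mem_innerD_of_re_lam hI (by simp), eventually_im_pos_nhds hI]
      with t ht ht0 hz
    rw [← zetaC_eq ht0]
    exact hgSlit_quarter_zetaC (ht hz)
  have hu : Tendsto (fun w : ℂ => (1 - csqrt (1 - w)) / 2) (𝓝[Metric.ball 0 1] 1)
      (𝓝[{u : ℂ | u.re < 1 / 2}] (lam Complex.I)) := by
    refine tendsto_nhdsWithin_iff.2 ⟨?_, ?_⟩
    · have hs : Tendsto (fun w : ℂ => csqrt (1 - w)) (𝓝[Metric.ball 0 1] 1) (𝓝 0) := by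
        rw [tendsto_zero_iff_norm_tendsto_zero]
        have hc : ContinuousAt (fun w : ℂ => √‖1 - w‖) 1 := by fun_prop
        have := hc.tendsto.mono_left (nhdsWithin_le_nhds (s := Metric.ball 0 1))
        simp only [sub_self, norm_zero, Real.sqrt_zero] at this
        refine this.congr' ?_
        filter_upwards [self_mem_nhdsWithin] with w hw
        exact (norm_csqrt (Complex.slitPlane_ne_zero
          ((mem_slitDomain_iff w).1 (ball_subset_slitDomain hw)))).symm
      have := (hs.const_sub 1).div_const 2
      rwa [sub_zero, ← lam_I] at this
    · filter_upwards [self_mem_nhdsWithin] with w hw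
      have := csqrt_re_pos ((mem_slitDomain_iff w).1 (ball_subset_slitDomain hw))
      have e : ((1 - csqrt (1 - w)) / 2).re = (1 - (csqrt (1 - w)).re) / 2 := by simp
      change ((1 - csqrt (1 - w)) / 2).re < 1 / 2
      rw [e]
      linarith
  refine (key.comp hu).congr' ?_
  filter_upwards [self_mem_nhdsWithin] with w hw
  have := csqrt_sq (Complex.slitPlane_ne_zero
    ((mem_slitDomain_iff w).1 (ball_subset_slitDomain hw)))
  simp only [Function.comp]
  congr 1
  linear_combination -this

/-! ### Transformation under `Γ(2,4)` -/

lemma theta00_periodic : Function.Periodic (theta 0 0) 2 := theta00_add_two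

lemma lam_periodic : Function.Periodic lam 2 := by
  intro τ
  have e (x : ℂ) : x ^ 4 = (x ^ 2) ^ 2 := by ring
  rw [lam, lam, theta00_add_two, e, theta10_add_two_sq, neg_sq, ← e]

lemma theta00_add_int (τ : ℂ) (k : ℤ) : theta 0 0 (τ + 2 * k) = theta 0 0 τ := by
  rw [mul_comm]
  exact theta00_periodic.int_mul k τ

lemma lam_add_int (τ : ℂ) (k : ℤ) : lam (τ + 2 * k) = lam τ := by
  rw [mul_comm]
  exact lam_periodic.int_mul k τ

/-- Conjugating translation by 2k with the inversion gives the lower unipotent generators. -/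
lemma lower_unipotent {τ σ : ℂ} (hτ : 0 < τ.im) (hσ : 0 < σ.im) (k : ℤ)
    (h : -1 / τ = -1 / σ + 2 * k) :
    theta 0 0 τ ^ 2 = (1 - 2 * k * σ) * theta 0 0 σ ^ 2 ∧ lam τ = lam σ := by
  have h1 := ne_zero_of_im_pos hτ
  have h2 := ne_zero_of_im_pos hσ
  constructor
  · have e1 := theta00_neg_inv_sq h1
    rw [h, theta00_add_int, theta00_neg_inv_sq h2] at e1
    have e2 : σ = τ * (1 - 2 * k * σ) := by
      field_simp at h
      linear_combination -h
    have e3 : τ * theta 0 0 τ ^ 2 = σ * theta 0 0 σ ^ 2 := by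
      have := Complex.I_ne_zero
      refine mul_left_cancel₀ (neg_ne_zero.2 this) ?_
      linear_combination -e1
    refine mul_left_cancel₀ h1 ?_
    rw [e3]
    linear_combination theta 0 0 σ ^ 2 * e2
  · have e1 := lam_neg_inv hτ
    rw [h, lam_add_int, lam_neg_inv hσ] at e1
    linear_combination e1

/-- Euclid's algorithm on the first column (a, c), with left multiplication by the even unipotent
matrices. The congruences persist because b and c are even. -/
lemma gamma24_transformation (n : ℕ) : ∀ a b c d : ℤ, a.natAbs + c.natAbs = n →
    a * d - b * c = 1 → a % 4 = 1 → d % 4 = 1 → b % 2 = 0 → c % 2 = 0 →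
    ∀ τ : ℂ, 0 < τ.im → 0 < ((a * τ + b) / (c * τ + d)).im →
    theta 0 0 ((a * τ + b) / (c * τ + d)) ^ 2 = (c * τ + d) * theta 0 0 τ ^ 2 ∧
      lam ((a * τ + b) / (c * τ + d)) = lam τ := by
  induction n using Nat.strong_induction_on with
  | _ n ih =>
  intro a b c d hn hdet ha hd hb hc τ hτ him
  have hden : (c : ℂ) * τ + d ≠ 0 := by
    intro h
    rw [h, div_zero] at him
    exact lt_irrefl _ him
  have hnum : (a : ℂ) * τ + b ≠ 0 := by
    intro h
    rw [h, zero_div] at him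
    exact lt_irrefl _ him
  by_cases hc0 : c = 0
  · subst hc0
    have had : a * d = 1 := by linarith
    have ha1 : a = 1 := by
      rcases Int.eq_one_or_neg_one_of_mul_eq_one had with h | h <;> omega
    have hd1 : d = 1 := by rw [ha1] at had; linarith
    obtain ⟨k, rfl⟩ : ∃ k, b = 2 * k := ⟨b / 2, by omega⟩
    subst ha1 hd1
    have e : ((1 : ℤ) * τ + (2 * k : ℤ)) / ((0 : ℤ) * τ + (1 : ℤ)) = τ + 2 * k := by
      push_cast
      ring
    rw [e, theta00_add_int, lam_add_int]
    push_cast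
    simp
  -- a is odd and c is even and nonzero, so |a| ≠ |c|. Changing the larger by twice the smaller,
  -- with the sign that reduces it, decreases its absolute value.
  · have hlt : ∃ k : ℤ, (a - 2 * k * c).natAbs < a.natAbs ∨ (c - 2 * k * a).natAbs < c.natAbs := by
      by_cases hs : (0 < a) ↔ (0 < c)
      · exact ⟨1, by omega⟩
      · exact ⟨-1, by omega⟩
    obtain ⟨k, hk⟩ := hlt
    rcases hk with hk | hk
    · have e : ((a - 2 * k * c : ℤ) * τ + (b - 2 * k * d : ℤ)) / (c * τ + d) =
          (a * τ + b) / (c * τ + d) + 2 * (-k : ℤ) := by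
        push_cast
        field_simp
        ring
      have m1 : (2 * k * c) % 4 = 0 := by
        obtain ⟨c', rfl⟩ : ∃ c', c = 2 * c' := ⟨c / 2, by omega⟩
        rw [show 2 * k * (2 * c') = 4 * (k * c') by ring]
        omega
      have m2 : (2 * k * d) % 2 = 0 := by rw [mul_assoc]; omega
      have := ih ((a - 2 * k * c).natAbs + c.natAbs) (by omega) (a - 2 * k * c) (b - 2 * k * d) c d
        rfl (by linear_combination hdet) (by omega) hd (by omega) hc τ hτ (by
          rw [e]
          simpa using him)
      rwa [e, theta00_add_int, lam_add_int] at this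
    · have m1 : (2 * k * b) % 4 = 0 := by
        obtain ⟨b', rfl⟩ : ∃ b', b = 2 * b' := ⟨b / 2, by omega⟩
        rw [show 2 * k * (2 * b') = 4 * (k * b') by ring]
        omega
      have m2 : (2 * k * a) % 2 = 0 := by rw [mul_assoc]; omega
      set z := (a * τ + b) / (c * τ + d) with hz
      -- σ is the image under the reduced matrix, and -1/σ differs from -1/z by an even integer.
      set σ := (a * τ + b) / ((c - 2 * k * a : ℤ) * τ + (d - 2 * k * b : ℤ)) with hσ
      have hz0 := ne_zero_of_im_pos him
      have e1 : -1 / σ = -1 / z + 2 * k := by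
        rw [hσ, hz]
        push_cast
        rw [div_div_eq_mul_div, div_div_eq_mul_div]
        field_simp
        ring
      have him' : 0 < (-1 / σ).im := by
        rw [e1]
        have := im_neg_inv_pos him
        simpa using this
      have hσim : 0 < σ.im := by
        have := im_neg_inv_pos him'
        rwa [div_div_eq_mul_div, neg_one_mul, neg_div_neg_eq, div_one] at this
      have hσ0 := ne_zero_of_im_pos hσim
      obtain ⟨i1, i2⟩ := ih (a.natAbs + (c - 2 * k * a).natAbs) (by omega) a b (c - 2 * k * a)
        (d - 2 * k * b) rfl (by linear_combination hdet) ha (by omega) hb (by omega) τ hτ hσim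
      obtain ⟨u1, u2⟩ := lower_unipotent him hσim (-k) (by
        push_cast
        linear_combination -e1)
      rw [← hσ] at i1 i2
      refine ⟨?_, u2.trans i2⟩
      have hden' : ((c - 2 * k * a : ℤ) : ℂ) * τ + (d - 2 * k * b : ℤ) ≠ 0 := by
        intro h
        rw [hσ, h, div_zero] at hσ0
        exact hσ0 rfl
      have e2 : (1 - 2 * ((-k : ℤ) : ℂ) * σ) *
          (((c - 2 * k * a : ℤ) : ℂ) * τ + (d - 2 * k * b : ℤ)) = c * τ + d := by
        have hσd : σ * (((c - 2 * k * a : ℤ) : ℂ) * τ + (d - 2 * k * b : ℤ)) = a * τ + b := by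
          rw [hσ, div_mul_cancel₀ _ hden']
        push_cast at hσd ⊢
        linear_combination (2 * k : ℂ) * hσd
      rw [u1, i1, ← e2]
      ring

/-! ### The extended group -/

lemma entry_toGLGauss (h : Matrix.SpecialLinearGroup (Fin 2) ℤ) (i j : Fin 2) :
    entry (toGLGauss h) i j = (h i j : ℂ) := by
  simp [entry, toGLGauss]

lemma toComplex_gaussI : GaussianInt.toComplex gaussI = Complex.I := by
  simp [gaussI, GaussianInt.toComplex_def]

lemma iJ_mul_iJ : iJ * iJ = 1 := by
  ext : 1
  exact iJ.val_inv

lemma entry_iJ_mul (g : GL (Fin 2) GaussianInt) (j : Fin 2) :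
    entry (iJ * g) 0 j = Complex.I * entry g 1 j ∧
      entry (iJ * g) 1 j = -Complex.I * entry g 0 j := by
  simp [entry, iJ, Matrix.mul_apply, Fin.sum_univ_two, toComplex_gaussI]

lemma detC_iJ_mul (g : GL (Fin 2) GaussianInt) : detC (iJ * g) = -detC g := by
  have : (iJ : Matrix (Fin 2) (Fin 2) GaussianInt).det = -1 := by
    simp only [iJ, Matrix.det_fin_two]
    decide
  rw [detC, Units.val_mul, Matrix.det_mul, this, detC]
  simp

lemma Gamma24.mod_eq {h : Matrix.SpecialLinearGroup (Fin 2) ℤ} (hh : h ∈ Gamma24) :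
    h 0 0 % 4 = 1 ∧ h 1 1 % 4 = 1 ∧ h 0 1 % 2 = 0 ∧ h 1 0 % 2 = 0 := hh

lemma det_eq (h : Matrix.SpecialLinearGroup (Fin 2) ℤ) : h 0 0 * h 1 1 - h 0 1 * h 1 0 = 1 := by
  rw [← Matrix.det_fin_two]
  exact h.det_coe

lemma im_mobius_pos {a b c d : ℤ} (hdet : a * d - b * c = 1) {τ : ℂ} (hτ : 0 < τ.im) :
    0 < ((a * τ + b) / (c * τ + d)).im := by
  let M : Matrix.SpecialLinearGroup (Fin 2) ℤ :=
    ⟨!![a, b; c, d], by rw [Matrix.det_fin_two_of]; linarith⟩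
  let t : UpperHalfPlane := ⟨τ, hτ⟩
  have key : ((a : ℂ) * τ + b) / (c * τ + d) = (M • t : UpperHalfPlane) := by
    rw [UpperHalfPlane.specialLinearGroup_apply]
    simp [M, t]
  rw [key]
  exact UpperHalfPlane.im_pos _

lemma detC_toGLGauss (h : Matrix.SpecialLinearGroup (Fin 2) ℤ) : detC (toGLGauss h) = 1 := by
  have e (g : GL (Fin 2) GaussianInt) :
      detC g = entry g 0 0 * entry g 1 1 - entry g 0 1 * entry g 1 0 := by
    simp [detC, entry, Matrix.det_fin_two]
  rw [e]
  simp only [entry_toGLGauss]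
  exact_mod_cast det_eq h

/-- The effect of an element `g` of `Γ(2,4)⟨iJ⟩` on the theta constants. -/
lemma gamma24iJ_transformation {g : GL (Fin 2) GaussianInt} (hg : g ∈ Gamma24iJ)
    {τ τ₀ : ℂ} (hτ₀ : 0 < τ₀.im)
    (h : τ = (entry g 0 0 * τ₀ + entry g 0 1) / (entry g 1 0 * τ₀ + entry g 1 1)) :
    entry g 1 0 * τ₀ + entry g 1 1 ≠ 0 ∧
    (-entry g 1 0 * τ + entry g 0 0) * (entry g 1 0 * τ₀ + entry g 1 1) = detC g ∧
    theta 0 0 τ ^ 2 = (entry g 1 0 * τ₀ + entry g 1 1) * theta 0 0 τ₀ ^ 2 ∧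
    (detC g = 1 ∨ detC g = -1) ∧ 1 - 2 * lam τ = detC g * (1 - 2 * lam τ₀) := by
  have main : ∀ k ∈ Gamma24, ∃ z : ℂ, 0 < z.im ∧
      (k 1 0 : ℂ) * τ₀ + k 1 1 ≠ 0 ∧ (k 0 0 : ℂ) * τ₀ + k 0 1 = z * (k 1 0 * τ₀ + k 1 1) ∧
      (k 0 0 : ℂ) * k 1 1 - k 0 1 * k 1 0 = 1 ∧
      theta 0 0 z ^ 2 = (k 1 0 * τ₀ + k 1 1) * theta 0 0 τ₀ ^ 2 ∧ lam z = lam τ₀ := by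
    intro k hk
    obtain ⟨h1, h2, h3, h4⟩ := Gamma24.mod_eq hk
    have him := im_mobius_pos (det_eq k) hτ₀
    have hden : (k 1 0 : ℂ) * τ₀ + k 1 1 ≠ 0 := by
      intro h
      rw [h, div_zero] at him
      exact lt_irrefl _ him
    obtain ⟨t1, t2⟩ := gamma24_transformation _ (k 0 0) (k 0 1) (k 1 0) (k 1 1) rfl (det_eq k)
      h1 h2 h3 h4 τ₀ hτ₀ him
    exact ⟨_, him, hden, (div_mul_cancel₀ _ hden).symm, by exact_mod_cast det_eq k, t1, t2⟩
  rcases hg with ⟨k, hk, rfl⟩ | ⟨k, hk, hkg⟩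
  · obtain ⟨z, him, hden, hz, hdet, t1, t2⟩ := main k hk
    simp only [entry_toGLGauss] at h ⊢
    have hτz : τ = z := by rw [h, hz, mul_div_cancel_right₀ _ hden]
    rw [detC_toGLGauss, hτz, t1, t2]
    refine ⟨hden, ?_, rfl, Or.inl rfl, by ring⟩
    linear_combination hdet + (k 1 0 : ℂ) * hz
  · obtain ⟨z, him, hden, hz, hdet, t1, t2⟩ := main k hk
    -- The second coset reduces to the first followed by z ↦ -1/z, because iJ is an involution.
    have hgk : g = iJ * toGLGauss k := by rw [hkg, ← mul_assoc, iJ_mul_iJ, one_mul]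
    subst hgk
    simp only [entry_iJ_mul, entry_toGLGauss] at h ⊢
    rw [detC_iJ_mul, detC_toGLGauss]
    have hz0 := ne_zero_of_im_pos him
    have e1 : -Complex.I * (k 0 0 : ℂ) * τ₀ + -Complex.I * k 0 1 =
        -Complex.I * z * (k 1 0 * τ₀ + k 1 1) := by
      linear_combination -Complex.I * hz
    have hτz : τ = -1 / z := by
      have : Complex.I * (k 1 0 : ℂ) * τ₀ + Complex.I * k 1 1 =
        Complex.I * (k 1 0 * τ₀ + k 1 1) := by ring
      rw [h, e1, this, mul_div_mul_right _ _ hden]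
      have := Complex.I_ne_zero
      field_simp
    have hτ0 : τ * z = -1 := by rw [hτz, div_mul_cancel₀ _ hz0]
    refine ⟨?_, ?_, ?_, Or.inr rfl, ?_⟩
    · rw [e1]
      exact mul_ne_zero (mul_ne_zero (neg_ne_zero.2 Complex.I_ne_zero) hz0) hden
    · rw [e1]
      have e2 : (k 0 0 * τ * z + k 1 0 * z) * (k 1 0 * τ₀ + k 1 1) = -1 := by
        rw [mul_assoc, hτ0]
        linear_combination -hdet - (k 1 0 : ℂ) * hz
      linear_combination e2 - (k 0 0 * τ * z + k 1 0 * z) * (k 1 0 * τ₀ + k 1 1) * Complex.I_sq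
    · rw [e1, hτz, theta00_neg_inv_sq hz0, t1]
      ring
    · rw [hτz, lam_neg_inv him, t2]
      ring

/-! ### The fundamental region -/

/-- Membership in the theta group: `g` is congruent to `1` or `S` modulo `2`. -/
def IsTheta (g : Matrix.SpecialLinearGroup (Fin 2) ℤ) : Prop :=
  (g 0 1 % 2 = 0 ∧ g 1 0 % 2 = 0) ∨ (g 0 0 % 2 = 0 ∧ g 1 1 % 2 = 0)

lemma mul_entry (g h : Matrix.SpecialLinearGroup (Fin 2) ℤ) (i j : Fin 2) :
    (g * h) i j = g i 0 * h 0 j + g i 1 * h 1 j := by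
  rw [Matrix.SpecialLinearGroup.coe_mul, Matrix.mul_apply, Fin.sum_univ_two]

lemma IsTheta.mul {g h : Matrix.SpecialLinearGroup (Fin 2) ℤ} (hg : IsTheta g) (hh : IsTheta h) :
    IsTheta (g * h) := by
  simp only [IsTheta, mul_entry, ← Int.even_iff, Int.even_add, Int.even_mul] at *
  rcases hg with ⟨a, b⟩ | ⟨a, b⟩ <;> rcases hh with ⟨c, d⟩ | ⟨c, d⟩ <;> simp [a, b, c, d]

lemma T_zpow_entry (n : ℤ) : (ModularGroup.T ^ n) 0 0 = 1 ∧ (ModularGroup.T ^ n) 0 1 = n ∧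
    (ModularGroup.T ^ n) 1 0 = 0 ∧ (ModularGroup.T ^ n) 1 1 = 1 := by
  rw [ModularGroup.coe_T_zpow]
  simp

lemma S_inv_entry : ModularGroup.S⁻¹ 0 0 = 0 ∧ ModularGroup.S⁻¹ 0 1 = 1 ∧
    ModularGroup.S⁻¹ 1 0 = -1 ∧ ModularGroup.S⁻¹ 1 1 = 0 := by
  rw [Matrix.SpecialLinearGroup.coe_inv, ModularGroup.coe_S, Matrix.adjugate_fin_two_of]
  simp

/-- The theta group has index 3 in SL₂(ℤ); reduced mod 2, its cosets are represented by 1, T and TS.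
Leaving the odd exponents m and n free allows a choice of sign. -/
lemma isTheta_coset (M : Matrix.SpecialLinearGroup (Fin 2) ℤ) {m n : ℤ} (hm : m % 2 = 1)
    (hn : n % 2 = 1) : IsTheta M ∨ IsTheta (M * (ModularGroup.T ^ m)⁻¹) ∨
      IsTheta (M * (ModularGroup.T ^ n * ModularGroup.S)⁻¹) := by
  have hdet : ¬ Even (M 0 0 * M 1 1 - M 0 1 * M 1 0) := by
    rw [show M 0 0 * M 1 1 - M 0 1 * M 1 0 = 1 by linarith [det_eq M]]
    exact Int.not_even_one
  rw [mul_inv_rev, ← zpow_neg, ← zpow_neg]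
  obtain ⟨s1, s2, s3, s4⟩ := S_inv_entry
  obtain ⟨t1, t2, t3, t4⟩ := T_zpow_entry (-m)
  obtain ⟨u1, u2, u3, u4⟩ := T_zpow_entry (-n)
  have hm' : ¬ Even m := by rw [Int.even_iff]; omega
  have hn' : ¬ Even n := by rw [Int.even_iff]; omega
  simp only [IsTheta, mul_entry, s1, s2, s3, s4, t1, t2, t3, t4, u1, u2, u3, u4, ← Int.even_iff]
  simp only [Int.even_add, Int.even_sub, Int.even_mul, even_neg, hm', hn', Int.not_even_one,
    Even.zero] at hdet ⊢
  generalize Even (M 0 0) = a at *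
  generalize Even (M 0 1) = b at *
  generalize Even (M 1 0) = c at *
  generalize Even (M 1 1) = d at *
  clear s1 s2 s3 s4 t1 t2 t3 t4 u1 u2 u3 u4
  by_cases a <;> by_cases b <;> by_cases c <;> by_cases d <;> simp_all

lemma re_T_zpow_smul (n : ℤ) (t : UpperHalfPlane) : (ModularGroup.T ^ n • t).re = n + t.re := by
  rw [UpperHalfPlane.modular_T_zpow_smul, UpperHalfPlane.vadd_re]

lemma im_T_zpow_smul (n : ℤ) (t : UpperHalfPlane) : (ModularGroup.T ^ n • t).im = t.im := by
  rw [UpperHalfPlane.modular_T_zpow_smul, UpperHalfPlane.vadd_im]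

lemma coe_S_smul (t : UpperHalfPlane) : ((ModularGroup.S • t : UpperHalfPlane) : ℂ) = -1 / t := by
  rw [UpperHalfPlane.modular_S_smul, UpperHalfPlane.coe_mk, inv_neg, neg_div, one_div]

/-- The closure of the region `𝔻₁₂`. -/
def closedD : Set UpperHalfPlane := {t | -1 ≤ t.re ∧ t.re ≤ 1 ∧ 1 ≤ t.re ^ 2 + t.im ^ 2}

/-- A shift by ±1 towards the far side changes |Re t| to 1 - |Re t|, which is why the hypothesis has
this form. -/
lemma exists_T_zpow_mem_closedD {t : UpperHalfPlane} (h1 : -(1 / 2) ≤ t.re) (h2 : t.re ≤ 1 / 2)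
    (h3 : 1 ≤ (1 - |t.re|) ^ 2 + t.im ^ 2) :
    ∃ n : ℤ, n % 2 = 1 ∧ ModularGroup.T ^ n • t ∈ closedD := by
  rcases le_total t.re 0 with h | h
  · refine ⟨1, rfl, ?_⟩
    rw [abs_of_nonpos h] at h3
    simp only [closedD, Set.mem_ofPred_eq, re_T_zpow_smul, im_T_zpow_smul]
    push_cast
    refine ⟨by linarith, by linarith, by linarith⟩
  · refine ⟨-1, rfl, ?_⟩
    rw [abs_of_nonneg h] at h3
    simp only [closedD, Set.mem_ofPred_eq, re_T_zpow_smul, im_T_zpow_smul]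
    push_cast
    refine ⟨by linarith, by linarith, by nlinarith⟩

/-- Move τ to a point t of the standard fundamental domain. For suitable signs t, T^{±1}t and
T^{±1}St all lie in the closed region, and one of them is equivalent to τ under the theta group. -/
lemma exists_isTheta_smul_closedD (τ : UpperHalfPlane) :
    ∃ t ∈ closedD, ∃ g, IsTheta g ∧ τ = g • t := by
  obtain ⟨k, hk⟩ := ModularGroup.exists_smul_mem_fd τ
  set t := k • τ with ht
  have hτ : τ = k⁻¹ • t := (inv_smul_smul k τ).symm
  obtain ⟨hN, habs⟩ := hk
  have habs' := abs_le.1 habs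
  have hN' : Complex.normSq (t : ℂ) = t.re ^ 2 + t.im ^ 2 := by
    rw [Complex.normSq_apply, sq, sq]
    rfl
  rw [hN'] at hN
  have h0 : t ∈ closedD := ⟨by linarith, by linarith, hN⟩
  obtain ⟨m, hm, hm'⟩ := exists_T_zpow_mem_closedD (t := t) (by linarith) (by linarith) (by
    have h5 := sq_abs t.re
    nlinarith)
  have hpos : 0 < t.re ^ 2 + t.im ^ 2 := by linarith
  have hre : (ModularGroup.S • t).re = -t.re / (t.re ^ 2 + t.im ^ 2) := by
    rw [← UpperHalfPlane.coe_re, coe_S_smul, neg_div, one_div, Complex.neg_re, Complex.inv_re, hN',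
      UpperHalfPlane.coe_re, neg_div]
  have him : (ModularGroup.S • t).im = t.im / (t.re ^ 2 + t.im ^ 2) := by
    rw [← UpperHalfPlane.coe_im, coe_S_smul, im_neg_inv, hN', UpperHalfPlane.coe_im]
  obtain ⟨n, hn, hn'⟩ := exists_T_zpow_mem_closedD (t := ModularGroup.S • t)
    (by rw [hre, le_div_iff₀ hpos]; nlinarith) (by rw [hre, div_le_iff₀ hpos]; nlinarith) (by
    rw [hre, him, abs_div, abs_neg, abs_of_pos hpos]
    have h5 := sq_abs t.re
    have e : (1 - |t.re| / (t.re ^ 2 + t.im ^ 2)) ^ 2 + (t.im / (t.re ^ 2 + t.im ^ 2)) ^ 2 =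
        1 + (1 - 2 * |t.re|) / (t.re ^ 2 + t.im ^ 2) := by
      rw [← h5] at hpos ⊢
      field_simp
      ring
    rw [e, le_add_iff_nonneg_right]
    exact div_nonneg (by linarith) hpos.le)
  rcases isTheta_coset k⁻¹ hm hn with h | h | h
  · exact ⟨t, h0, _, h, hτ⟩
  · refine ⟨_, hm', _, h, ?_⟩
    rw [smul_smul, inv_mul_cancel_right, hτ]
  · rw [smul_smul] at hn'
    refine ⟨_, hn', _, h, ?_⟩
    rw [smul_smul, inv_mul_cancel_right, hτ]

lemma norm_coe_eq_one_iff (t : UpperHalfPlane) : ‖(t : ℂ)‖ = 1 ↔ t.re ^ 2 + t.im ^ 2 = 1 := by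
  rw [← pow_eq_one_iff_of_nonneg (norm_nonneg _) two_ne_zero, ← Complex.normSq_eq_norm_sq, Complex.normSq_apply,
    sq, sq]
  rfl

lemma mem_D12_of_one_lt {t : UpperHalfPlane} (h1 : -1 < t.re) (h2 : t.re ≤ 1)
    (h3 : 1 < t.re ^ 2 + t.im ^ 2) : t ∈ D12 :=
  Or.inl ⟨h1, h2, (one_lt_norm_iff _).2 h3⟩

/-- The boundary is normalized by T², which moves Re = -1 to Re = 1, and by S, which exchanges the
halves of the arc. -/
lemma exists_isTheta_smul_D12 (τ : UpperHalfPlane) :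
    ∃ t ∈ D12, ∃ g, IsTheta g ∧ τ = g • t := by
  obtain ⟨t, ⟨h1, h2, h3⟩, g, hg, rfl⟩ := exists_isTheta_smul_closedD τ
  have him := t.im_pos
  rcases h1.lt_or_eq with h1 | h1
  · rcases h3.lt_or_eq with h3 | h3
    · exact ⟨t, mem_D12_of_one_lt h1 h2 h3, g, hg, rfl⟩
    · rcases le_or_gt 0 t.re with h | h
      · exact ⟨t, Or.inr ⟨(norm_coe_eq_one_iff t).2 h3.symm, h, h2⟩, g, hg, rfl⟩
      · have hn := (norm_coe_eq_one_iff t).2 h3.symm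
        have hS : IsTheta ModularGroup.S⁻¹ := by
          obtain ⟨s1, s2, s3, s4⟩ := S_inv_entry
          exact Or.inr ⟨by rw [s1]; rfl, by rw [s4]; rfl⟩
        have hre : (ModularGroup.S • t).re = -t.re := by
          rw [← UpperHalfPlane.coe_re, coe_S_smul, neg_inv_eq_of_norm_eq_one hn]
          simp
        refine ⟨ModularGroup.S • t, Or.inr ⟨?_, ?_, ?_⟩, g * ModularGroup.S⁻¹, hg.mul hS, ?_⟩
        · rw [coe_S_smul, norm_div, norm_neg, norm_one, hn, div_one]
        · rw [hre]; linarith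
        · rw [hre]; linarith
        · rw [smul_smul, inv_mul_cancel_right]
  · have hT : IsTheta (ModularGroup.T ^ (-2 : ℤ)) := by
      obtain ⟨s1, s2, s3, s4⟩ := T_zpow_entry (-2)
      exact Or.inl ⟨by rw [s2]; rfl, by rw [s3]; rfl⟩
    refine ⟨ModularGroup.T ^ (2 : ℤ) • t, ?_, g * ModularGroup.T ^ (-2 : ℤ), hg.mul hT, ?_⟩
    · refine mem_D12_of_one_lt ?_ ?_ ?_ <;> simp only [re_T_zpow_smul, im_T_zpow_smul, ← h1] <;>
        norm_num
      exact pow_pos t.im_pos 2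
    · rw [smul_smul, mul_assoc, ← zpow_add]
      simp

/-- Only the Möbius action matters, so scalars are free: the determinant forces the residues mod 4
up to a common sign. -/
lemma exists_gamma24iJ_of_isTheta {g : Matrix.SpecialLinearGroup (Fin 2) ℤ} (hg : IsTheta g) :
    ∃ k ∈ Gamma24iJ, ∀ z : ℂ,
      (entry k 0 0 * z + entry k 0 1) / (entry k 1 0 * z + entry k 1 1) =
        (g 0 0 * z + g 0 1) / (g 1 0 * z + g 1 1) := by
  have hdet := det_eq g
  have hI := Complex.I_ne_zero
  generalize ha : g 0 0 = a at *
  generalize hb : g 0 1 = b at *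
  generalize hc : g 1 0 = c at *
  generalize hd : g 1 1 = d at *
  rw [IsTheta, ha, hb, hc, hd] at hg
  rcases hg with ⟨h1, h2⟩ | ⟨h1, h2⟩
  · have hmod : (a % 4 = 1 ∧ d % 4 = 1) ∨ (a % 4 = 3 ∧ d % 4 = 3) := by
      have e : b * c = 4 * (b / 2 * (c / 2)) := by
        rw [← Int.mul_ediv_cancel' (Int.dvd_of_emod_eq_zero h1),
          ← Int.mul_ediv_cancel' (Int.dvd_of_emod_eq_zero h2)]
        simp
        ring
      have e2 : a * d % 4 = 1 := by omega
      rw [Int.mul_emod] at e2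
      have l1 := Int.emod_nonneg a (by norm_num : (4 : ℤ) ≠ 0)
      have l2 := Int.emod_lt_of_pos a (by norm_num : (0 : ℤ) < 4)
      have l3 := Int.emod_nonneg d (by norm_num : (4 : ℤ) ≠ 0)
      have l4 := Int.emod_lt_of_pos d (by norm_num : (0 : ℤ) < 4)
      generalize a % 4 = x at *
      generalize d % 4 = y at *
      interval_cases x <;> interval_cases y <;> simp at e2 ⊢
    rcases hmod with ⟨m1, m2⟩ | ⟨m1, m2⟩
    · refine ⟨toGLGauss g, Or.inl ⟨g, ⟨?_, ?_, ?_, ?_⟩, rfl⟩, fun z => ?_⟩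
      · rw [ha]; exact m1
      · rw [hd]; exact m2
      · rw [hb]; exact h1
      · rw [hc]; exact h2
      · simp only [entry_toGLGauss, ha, hb, hc, hd]
    · have en (i j : Fin 2) : (-g) i j = -g i j := by simp
      refine ⟨toGLGauss (-g), Or.inl ⟨-g, ⟨?_, ?_, ?_, ?_⟩, rfl⟩, fun z => ?_⟩
      · rw [en, ha, Int.ModEq]; omega
      · rw [en, hd, Int.ModEq]; omega
      · rw [en, hb, Int.ModEq]; omega
      · rw [en, hc, Int.ModEq]; omega
      · simp only [entry_toGLGauss, en, ha, hb, hc, hd]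
        push_cast
        rw [← neg_div_neg_eq]
        congr 1 <;> ring
  · have hmod : (b % 4 = 1 ∧ c % 4 = 3) ∨ (b % 4 = 3 ∧ c % 4 = 1) := by
      have e : a * d = 4 * (a / 2 * (d / 2)) := by
        rw [← Int.mul_ediv_cancel' (Int.dvd_of_emod_eq_zero h1),
          ← Int.mul_ediv_cancel' (Int.dvd_of_emod_eq_zero h2)]
        simp
        ring
      have e2 : b * c % 4 = 3 := by omega
      rw [Int.mul_emod] at e2
      have l1 := Int.emod_nonneg b (by norm_num : (4 : ℤ) ≠ 0)
      have l2 := Int.emod_lt_of_pos b (by norm_num : (0 : ℤ) < 4)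
      have l3 := Int.emod_nonneg c (by norm_num : (4 : ℤ) ≠ 0)
      have l4 := Int.emod_lt_of_pos c (by norm_num : (0 : ℤ) < 4)
      generalize b % 4 = x at *
      generalize c % 4 = y at *
      interval_cases x <;> interval_cases y <;> simp at e2 ⊢
    obtain ⟨s, hs, hs1, hs2⟩ : ∃ s : ℤ, (s = 1 ∨ s = -1) ∧ (-(s * c)) % 4 = 1 ∧ (s * b) % 4 = 1 := by
      rcases hmod with ⟨m1, m2⟩ | ⟨m1, m2⟩
      · exact ⟨1, Or.inl rfl, by omega, by omega⟩
      · exact ⟨-1, Or.inr rfl, by omega, by omega⟩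
    have hss : s * s = 1 := by rcases hs with rfl | rfl <;> rfl
    -- Chosen so that iJ·k = i s g; the sign s puts k into Γ(2,4).
    let k : Matrix.SpecialLinearGroup (Fin 2) ℤ := ⟨!![-(s * c), -(s * d); s * a, s * b], by
      rw [Matrix.det_fin_two_of]
      linear_combination hdet + (a * d - b * c) * hss⟩
    have k00 : k 0 0 = -(s * c) := rfl
    have k01 : k 0 1 = -(s * d) := rfl
    have k10 : k 1 0 = s * a := rfl
    have k11 : k 1 1 = s * b := rfl
    refine ⟨iJ * toGLGauss k, Or.inr ⟨k, ⟨hs1, hs2, ?_, ?_⟩, ?_⟩, fun z => ?_⟩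
    · rw [k01, Int.ModEq]
      rcases hs with rfl | rfl <;> omega
    · rw [k10, Int.ModEq]
      rcases hs with rfl | rfl <;> omega
    · rw [← mul_assoc, iJ_mul_iJ, one_mul]
    · simp only [entry_iJ_mul, entry_toGLGauss, k00, k01, k10, k11]
      have hs0 : Complex.I * (s : ℂ) ≠ 0 := by
        refine mul_ne_zero hI ?_
        rcases hs with rfl | rfl <;> simp
      rw [← mul_div_mul_left ((a : ℂ) * z + b) _ hs0]
      push_cast
      congr 1 <;> ring

lemma exists_D12_gamma24iJ (τ : UpperHalfPlane) : ∃ τ₀ ∈ D12, ∃ g ∈ Gamma24iJ,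
    (τ : ℂ) = (entry g 0 0 * τ₀ + entry g 0 1) / (entry g 1 0 * τ₀ + entry g 1 1) := by
  obtain ⟨t, ht, g, hg, rfl⟩ := exists_isTheta_smul_D12 τ
  obtain ⟨k, hk, h⟩ := exists_gamma24iJ_of_isTheta hg
  refine ⟨t, ht, k, hk, ?_⟩
  rw [h, UpperHalfPlane.coe_specialLinearGroup_apply]
  simp

/-! ### Values of F at ζ(τ) on all of 𝔻₁₂. -/

lemma eq_I_of_norm_eq_one {τ : UpperHalfPlane} (hn : ‖(τ : ℂ)‖ = 1) (hre : τ.re = 0) :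
    (τ : ℂ) = Complex.I := by
  rw [norm_coe_eq_one_iff, hre] at hn
  have := τ.im_pos
  have him : τ.im = 1 := by nlinarith
  apply Complex.ext
  · simpa using hre
  · simpa using him

lemma mem_mainRegion_or_arc {τ : UpperHalfPlane} (hτ : τ ∈ D12) (h : zeta τ ≠ 1) :
    (τ : ℂ) ∈ mainRegion ∨ ‖(τ : ℂ)‖ = 1 ∧ 0 < τ.re := by
  rcases hτ with ⟨h1, h2, h3⟩ | ⟨h1, h2, h3⟩
  · exact Or.inl ⟨τ.im_pos, h1, h2, h3⟩
  · refine Or.inr ⟨h1, lt_of_le_of_ne h2 fun h0 => h ?_⟩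
    rw [zeta_eq_zetaC, eq_I_of_norm_eq_one h1 h0.symm, zetaC_I]

lemma IsUniformization.hg_zeta {a b c : ℂ} {Θ : ℂ → ℂ} (h : IsUniformization a b c Θ)
    {τ : UpperHalfPlane} (hτ : τ ∈ D12) (hz : zeta τ ≠ 1) : hg a b c (zeta τ) = Θ τ := by
  rcases mem_mainRegion_or_arc hτ hz with hm | ⟨hn, hre⟩
  · exact h.hg_of_mem_mainRegion hm
  · exact h.hg_of_norm_eq_one τ.im_pos hn hre

lemma hg_quarter_zeta {τ : UpperHalfPlane} (hτ : τ ∈ D12) :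
    hg (1 / 4) (1 / 4) 1 (zeta τ) = theta 0 0 τ ^ 2 := by
  by_cases hz : zeta τ = 1
  · have hI : (τ : ℂ) = Complex.I := by
      rcases hτ with ⟨h1, h2, h3⟩ | ⟨h1, h2, h3⟩
      · have hm := zetaC_mem_slitDomain_of_mem (τ := τ) ⟨τ.im_pos, h1, h2, h3⟩
        rw [← zeta_eq_zetaC, hz] at hm
        exact absurd ⟨Complex.one_im, Complex.one_re.ge⟩ hm
      · refine eq_I_of_norm_eq_one h1 (le_antisymm (not_lt.1 fun hre => ?_) h2)
        exact zetaC_ne_one_of_norm_eq_one τ.im_pos h1 hre hz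
    rw [hz, hg_quarter_one, hI]
  · exact isUniformization_quarter.hg_zeta hτ hz

end HGTheta

end

theorem mainTheorem4 :
    -- every point of the upper half plane is of the form `g · τ₀`
    (∀ τ : UpperHalfPlane, ∃ τ₀ ∈ HGTheta.D12, ∃ g ∈ HGTheta.Gamma24iJ,
      (τ : ℂ) = (HGTheta.entry g 0 0 * τ₀ + HGTheta.entry g 0 1) /
        (HGTheta.entry g 1 0 * τ₀ + HGTheta.entry g 1 1)) ∧
    ∀ (τ τ₀ : UpperHalfPlane) (g : GL (Fin 2) GaussianInt),
      τ₀ ∈ HGTheta.D12 → g ∈ HGTheta.Gamma24iJ →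
      (τ : ℂ) = (HGTheta.entry g 0 0 * τ₀ + HGTheta.entry g 0 1) /
        (HGTheta.entry g 1 0 * τ₀ + HGTheta.entry g 1 1) →
      -- the formulas for `F(1/4, 1/4, 1)`
      ((∀ γ : Path τ₀ τ, (∀ t, HGTheta.zeta (γ t) ≠ 1) →
          HGTheta.HGContinuesTo (1 / 4) (1 / 4) 1 (fun t => HGTheta.zeta (γ t))
            (HGTheta.theta 0 0 τ ^ 2)) ∧
        HGTheta.theta 0 0 τ ^ 2 =
          (HGTheta.entry g 1 0 * τ₀ + HGTheta.entry g 1 1) *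
            HGTheta.hg (1 / 4) (1 / 4) 1 (HGTheta.zeta τ₀) ∧
        HGTheta.theta 0 0 τ ^ 2 =
          HGTheta.detC g * HGTheta.hg (1 / 4) (1 / 4) 1 (HGTheta.zeta τ) /
            (-HGTheta.entry g 1 0 * τ + HGTheta.entry g 0 0)) ∧
      -- the formulas for `F(3/4, 3/4, 1)`, away from the poles `ζ(τ) = 1`
      (HGTheta.zeta τ ≠ 1 →
        HGTheta.theta 0 1 τ ^ 4 - HGTheta.theta 1 0 τ ^ 4 ≠ 0 ∧
        (∀ γ : Path τ₀ τ, (∀ t, HGTheta.zeta (γ t) ≠ 1) →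
          HGTheta.HGContinuesTo (3 / 4) (3 / 4) 1 (fun t => HGTheta.zeta (γ t))
            (HGTheta.theta 0 0 τ ^ 6 /
              (HGTheta.theta 0 1 τ ^ 4 - HGTheta.theta 1 0 τ ^ 4))) ∧
        HGTheta.theta 0 0 τ ^ 6 / (HGTheta.theta 0 1 τ ^ 4 - HGTheta.theta 1 0 τ ^ 4) =
          (HGTheta.entry g 1 0 * τ₀ + HGTheta.entry g 1 1) / HGTheta.detC g *
            HGTheta.hg (3 / 4) (3 / 4) 1 (HGTheta.zeta τ₀) ∧
        HGTheta.theta 0 0 τ ^ 6 / (HGTheta.theta 0 1 τ ^ 4 - HGTheta.theta 1 0 τ ^ 4) =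
          HGTheta.hg (3 / 4) (3 / 4) 1 (HGTheta.zeta τ) /
            (-HGTheta.entry g 1 0 * τ + HGTheta.entry g 0 0)) := by
  refine ⟨HGTheta.exists_D12_gamma24iJ, fun τ τ₀ g hτ₀ hg hτ => ?_⟩
  obtain ⟨hj, hinv, h00, hD, hlam⟩ := HGTheta.gamma24iJ_transformation hg τ₀.im_pos hτ
  set j := HGTheta.entry g 1 0 * τ₀ + HGTheta.entry g 1 1 with hj_def
  have hD0 : HGTheta.detC g ≠ 0 := by rcases hD with h | h <;> rw [h] <;> norm_num
  have hDD : HGTheta.detC g * HGTheta.detC g = 1 := by rcases hD with h | h <;> rw [h] <;> norm_num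
  have hinv0 : -HGTheta.entry g 1 0 * τ + HGTheta.entry g 0 0 ≠ 0 := by
    intro h
    rw [h, zero_mul] at hinv
    exact hD0 hinv.symm
  -- 1 - 2λ changes by det g = ±1, which disappears on squaring.
  have hzeta : HGTheta.zeta τ = HGTheta.zeta τ₀ := by
    rw [HGTheta.zeta_eq_zetaC, HGTheta.zeta_eq_zetaC, HGTheta.zetaC_eq_one_sub_sq τ.im_pos,
      HGTheta.zetaC_eq_one_sub_sq τ₀.im_pos, hlam]
    linear_combination (-(1 - 2 * HGTheta.lam τ₀) ^ 2) * hDD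
  -- Here 1 - 2λ enters to the power -1, so the factor det g survives.
  have hquot : HGTheta.thetaQuot τ = j / HGTheta.detC g * HGTheta.thetaQuot τ₀ := by
    rw [HGTheta.thetaQuot_eq τ.im_pos, HGTheta.thetaQuot_eq τ₀.im_pos, hlam, h00, mul_inv]
    ring
  refine ⟨⟨fun γ hγ => ?_, ?_, ?_⟩, fun hz => ⟨?_, fun γ hγ => ?_, ?_, ?_⟩⟩
  · have h0 := hγ 0
    rw [γ.source] at h0
    exact HGTheta.isUniformization_quarter.hgContinuesTo
      (HGTheta.mem_mainRegion_or_arc hτ₀ h0) γ hγ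
  · rw [HGTheta.hg_quarter_zeta hτ₀, h00]
  -- The second form follows from (-g₂₁τ + g₁₁)(g₂₁τ₀ + g₂₂) = det g and the invariance of ζ.
  · rw [hzeta, HGTheta.hg_quarter_zeta hτ₀, h00, eq_div_iff hinv0, ← hinv]
    ring
  · intro h
    refine hz ((HGTheta.zetaC_eq_one_iff τ.im_pos).2 ?_)
    rw [HGTheta.one_sub_two_mul_lam τ.im_pos, h, zero_div]
  · exact HGTheta.isUniformization_three_quarters.hgContinuesTo
      (HGTheta.mem_mainRegion_or_arc hτ₀ (hzeta ▸ hz)) γ hγ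
  · rw [HGTheta.isUniformization_three_quarters.hg_zeta hτ₀ (hzeta ▸ hz)]
    exact hquot
  · rw [hzeta, HGTheta.isUniformization_three_quarters.hg_zeta hτ₀ (hzeta ▸ hz), eq_div_iff hinv0]
    change HGTheta.thetaQuot τ * _ = _
    rw [hquot, div_mul_eq_mul_div, div_mul_eq_mul_div, div_eq_iff hD0]
    linear_combination HGTheta.thetaQuot τ₀ * hinv
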